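/- Let $(M_1^{2m+1},\varphi,\xi,\eta,g_1)$ be a Sasakian space form of constant $\varphi$-sectional curvature $c$. That is, $(\varphi,\xi,\eta,g_1)$ is an almost contact metric structure ($\varphi^2=-\mathrm{id}+\eta\otimes\xi$, $\eta(\xi)=1$, $\eta\circ\varphi=0$, $\eta=g_1(\xi,\cdot)$, $g_1(\varphi X,\varphi Y)=g_1(X,Y)-\eta(X)\eta(Y)$) which is contact, $g_1(X,\varphi Y)=d\eta(X,Y)$, and normal, $N_\varphi+2\,d\eta\otimes\xi=0$, where $d\eta(X,Y)=\tfrac12\big(X\eta(Y)-Y\eta(X)-\eta([X,Y])\big)$ and $N_\varphi$ is the Nijenhuis tensor of $\varphi$; and every plane spanned by $X,\varphi X$ with $0\ne X\perp\xi$ has sectional curvature $c$. Let $(M_2^{2n},J,g_2)$ be a complex space form, i.e. a Kähler manifold with curvature tensor $$R^2(X,Y)Z=k\{g_2(Y,Z)X-g_2(X,Z)Y+g_2(JY,Z)JX-g_2(JX,Z)JY-2g_2(JX,Y)JZ\}$$ for a constant $k$. Let $f:M_1\to(0,\infty)$ be smooth, and let $M_1\times_f M_2$ be the warped product, i.e.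 $M_1\times M_2$ with the metric $g_f=\pi^*g_1+f^2\sigma^*g_2$, where $\pi,\sigma$ are the projections. Let $M^{2(m+n)}$ be a nonempty Riemannian manifold and $\psi:M\to M_1\times_f M_2$ an isometric immersion (a hypersurface) with second fundamental form $B$ and mean curvature vector $H=\frac{1}{2(m+n)}\operatorname{trace}B$. Assume that the vector field $(\xi,0)$ is tangent to $M$, that $H$ is horizontal (tangent to the factor $M_1$), and that $|H|$ is a nonzero constant. Then $\psi$ is proper biharmonic, i.e. not harmonic and with $$\tau_2(\psi)=\operatorname{trace}\nabla^2\tau(\psi)-\operatorname{trace}R^f(d\psi(\cdot),\tau(\psi))d\psi(\cdot)=0,\qquad \tau(\psi)=\operatorname{trace}\nabla d\psi,$$ where $R^f(X,Y)=[\nabla_X,\nabla_Y]-\nabla_{[X,Y]}$ is the curvature tensor of $g_f$, if and only if, at every point of $M$, $$|B|^2H=\frac{c(m+1)+3m-1}{2}\,H-\frac{2n}{f}\,\nabla_H\nabla f,$$ where $\nabla$ is the Levi-Civita connection of $g_f$ and $\nabla f$ is the gradient of $f\circ\pi$. -/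

import Mathlib

open Set Bundle
open scoped Manifold ContDiff

noncomputable section

namespace WarpedBiharmonic

/-! ### Riemannian geometry in coordinates

`E`, `F` are the coordinate spaces of two charts. A metric in coordinates is a map
`G : E → E →L[ℝ] E →L[ℝ] ℝ`, and tangent vectors are identified with their component vectors. -/

section Coordinates

variable {E F : Type*} [NormedAddCommGroup E] [NormedSpace ℝ E]
  [NormedAddCommGroup F] [NormedSpace ℝ F]

/-- The vector `α♯` with `G_x(α♯, w) = α(w)` for all `w`. -/
def sharp (G : E → E →L[ℝ] E →L[ℝ] ℝ) (x : E) : (E →L[ℝ] ℝ) →L[ℝ] E :=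
  (G x).inverse

/-- The covector `w ↦ ½ (∂_u G(v, w) + ∂_v G(u, w) - ∂_w G(u, v))`. -/
def koszul (G : E → E →L[ℝ] E →L[ℝ] ℝ) (x u v : E) : E →L[ℝ] ℝ :=
  (1 / 2 : ℝ) • (fderiv ℝ G x u v + fderiv ℝ G x v u - ((fderiv ℝ G x).flip u).flip v)

/-- The Christoffel symbols `Γ_x(u, v)` of the Levi-Civita connection of `G`. -/
def christoffel (G : E → E →L[ℝ] E →L[ℝ] ℝ) (x u v : E) : E :=
  sharp G x (koszul G x u v)

/-- The covariant derivative at `x`, in the direction `u`, of a vector field `V` along the map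
`ψ : E → F`, for the Levi-Civita connection of the metric `G` of the target. With `ψ = id` this is
the usual covariant derivative `∇_u V` of a vector field. -/
def covDeriv (G : F → F →L[ℝ] F →L[ℝ] ℝ) (ψ V : E → F) (x u : E) : F :=
  fderiv ℝ V x u + christoffel G (ψ x) (fderiv ℝ ψ x u) (V x)

/-- The curvature tensor `R(u, v)w = ∇_u ∇_v w - ∇_v ∇_u w - ∇_{[u, v]} w`, evaluated on constant
coordinate fields (for which the bracket vanishes). -/
def curvature (G : E → E →L[ℝ] E →L[ℝ] ℝ) (x u v w : E) : E :=
  covDeriv G id (fun y => covDeriv G id (fun _ => w) y v) x u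
    - covDeriv G id (fun y => covDeriv G id (fun _ => w) y u) x v

/-- The sectional curvature of the plane spanned by `u` and `v`. -/
def sectionalCurvature (G : E → E →L[ℝ] E →L[ℝ] ℝ) (x u v : E) : ℝ :=
  G x (curvature G x u v v) u / (G x u u * G x v v - G x u v ^ 2)

/-- The gradient of a function. -/
def gradient (G : E → E →L[ℝ] E →L[ℝ] ℝ) (f : E → ℝ) (x : E) : E :=
  sharp G x (fderiv ℝ f x)

/-- The second fundamental form `B(u, v) = (∇dψ)(u, v) = ∇_u(dψ v) - dψ(∇_u v)` of a map `ψ`. For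
an isometric immersion this is the normal-valued form in the Gauss formula. -/
def secondFundamentalForm (g : E → E →L[ℝ] E →L[ℝ] ℝ) (G : F → F →L[ℝ] F →L[ℝ] ℝ) (ψ : E → F)
    (x u v : E) : F :=
  covDeriv G ψ (fun y => fderiv ℝ ψ y v) x u - fderiv ℝ ψ x (christoffel g x u v)

/-- The second covariant derivative `∇_u ∇_v V - ∇_{∇_u v} V` of a vector field `V` along `ψ`. -/
def secondCovDeriv (g : E → E →L[ℝ] E →L[ℝ] ℝ) (G : F → F →L[ℝ] F →L[ℝ] ℝ) (ψ V : E → F)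
    (x u v : E) : F :=
  covDeriv G ψ (fun y => covDeriv G ψ V y v) x u - covDeriv G ψ V x (christoffel g x u v)

/-- `dη(X, Y) = ½ (X η(Y) - Y η(X) - η([X, Y]))`. -/
def extDeriv (η : E → E →L[ℝ] ℝ) (X Y : E → E) (x : E) : ℝ :=
  (1 / 2 : ℝ) * (fderiv ℝ (fun y => η y (Y y)) x (X x) - fderiv ℝ (fun y => η y (X y)) x (Y x)
    - η x (VectorField.lieBracket ℝ X Y x))

/-- The Nijenhuis tensor
`N_φ(X, Y) = [φX, φY] - φ[φX, Y] - φ[X, φY] + φ²[X, Y]`. -/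
def nijenhuis (φ : E → E →L[ℝ] E) (X Y : E → E) (x : E) : E :=
  VectorField.lieBracket ℝ (fun y => φ y (X y)) (fun y => φ y (Y y)) x
    - φ x (VectorField.lieBracket ℝ (fun y => φ y (X y)) Y x)
    - φ x (VectorField.lieBracket ℝ X (fun y => φ y (Y y)) x)
    + φ x (φ x (VectorField.lieBracket ℝ X Y x))

end Coordinates

section Traces

variable {d : ℕ} {F : Type*} [NormedAddCommGroup F] [NormedSpace ℝ F]

/-- The trace `∑_{i,j} g^{ij} b(∂_i, ∂_j)` at `x` of a bilinear map `b` with respect to `g`; this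
is `∑_i b(e_i, e_i)` for every `g_x`-orthonormal basis `e_i`. -/
def metricTrace {W : Type*} [AddCommMonoid W]
    (g : EuclideanSpace ℝ (Fin d) → EuclideanSpace ℝ (Fin d) →L[ℝ] EuclideanSpace ℝ (Fin d) →L[ℝ] ℝ)
    (x : EuclideanSpace ℝ (Fin d))
    (b : EuclideanSpace ℝ (Fin d) → EuclideanSpace ℝ (Fin d) → W) : W :=
  ∑ i : Fin d, b (sharp g x (EuclideanSpace.proj i)) (EuclideanSpace.single i 1)

variable
  (g : EuclideanSpace ℝ (Fin d) → EuclideanSpace ℝ (Fin d) →L[ℝ] EuclideanSpace ℝ (Fin d) →L[ℝ] ℝ)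
  (G : F → F →L[ℝ] F →L[ℝ] ℝ) (ψ : EuclideanSpace ℝ (Fin d) → F) (x : EuclideanSpace ℝ (Fin d))

/-- The tension field `τ(ψ) = trace ∇dψ`. -/
def tension : F :=
  metricTrace g x (secondFundamentalForm g G ψ x)

/-- The bitension field `τ₂(ψ) = trace ∇²τ(ψ) - trace R(dψ(·), τ(ψ)) dψ(·)`. -/
def bitension : F :=
  metricTrace g x (secondCovDeriv g G ψ (tension g G ψ) x)
    - metricTrace g x (fun u v =>
        curvature G (ψ x) (fderiv ℝ ψ x u) (tension g G ψ x) (fderiv ℝ ψ x v))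

/-- The mean curvature vector `H = (1 / d) trace B`. -/
def meanCurvature : F :=
  (1 / (d : ℝ)) • metricTrace g x (secondFundamentalForm g G ψ x)

/-- The squared norm `|B|² = ∑_{i,j} |B(e_i, e_j)|²` of the second fundamental form. -/
def normSqSecondFundamentalForm : ℝ :=
  metricTrace g x (fun u u' => metricTrace g x (fun v v' =>
    G (ψ x) (secondFundamentalForm g G ψ x u v) (secondFundamentalForm g G ψ x u' v')))

end Traces

/-! ### Coordinate representations of objects on manifolds

For a point `p₀`, all representations are in the charts `extChartAt I p₀`. A tensorial notion on a
manifold is imposed in each of these charts, at each point of its domain. -/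

section Charts

variable {E : Type*} [NormedAddCommGroup E] [NormedSpace ℝ E]
  {H : Type*} [TopologicalSpace H] (I : ModelWithCorners ℝ E H)
  {M : Type*} [TopologicalSpace M] [ChartedSpace H M]

/-- The differential of the inverse chart at the coordinate point `x`. -/
def fromCoord (p₀ : M) (x : E) :
    E →L[ℝ] TangentSpace I ((extChartAt I p₀).symm x) :=
  mfderivWithin 𝓘(ℝ, E) I (extChartAt I p₀).symm (range I) x

/-- The differential of the chart at the point with coordinates `x`. -/
def toCoord (p₀ : M) (x : E) :
    TangentSpace I ((extChartAt I p₀).symm x) →L[ℝ] E :=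
  mfderiv I 𝓘(ℝ, E) (extChartAt I p₀) ((extChartAt I p₀).symm x)

/-- A bilinear form on the tangent bundle, in coordinates. -/
def localMetric (g : ∀ p : M, TangentSpace I p →L[ℝ] TangentSpace I p →L[ℝ] ℝ) (p₀ : M) (x : E) :
    E →L[ℝ] E →L[ℝ] ℝ :=
  ((fromCoord I p₀ x).precomp ℝ).comp ((g ((extChartAt I p₀).symm x)).comp (fromCoord I p₀ x))

/-- A vector field in coordinates. -/
def localVec (ξ : ∀ p : M, TangentSpace I p) (p₀ : M) (x : E) : E :=
  toCoord I p₀ x (ξ ((extChartAt I p₀).symm x))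

/-- A one-form in coordinates. -/
def localForm (η : ∀ p : M, TangentSpace I p →L[ℝ] ℝ) (p₀ : M) (x : E) : E →L[ℝ] ℝ :=
  (η ((extChartAt I p₀).symm x)).comp (fromCoord I p₀ x)

/-- A field of endomorphisms of the tangent spaces in coordinates. -/
def localEnd (φ : ∀ p : M, TangentSpace I p →L[ℝ] TangentSpace I p) (p₀ : M) (x : E) :
    E →L[ℝ] E :=
  (toCoord I p₀ x).comp ((φ ((extChartAt I p₀).symm x)).comp (fromCoord I p₀ x))

variable {E' : Type*} [NormedAddCommGroup E'] [NormedSpace ℝ E']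
  {H' : Type*} [TopologicalSpace H'] (I' : ModelWithCorners ℝ E' H')
  {N : Type*} [TopologicalSpace N] [ChartedSpace H' N]

/-- The set of coordinates `x` in the chart at `p₀` of points `p` for which `ψ p` lies in the domain
of the chart at `ψ p₀`. On it `writtenInExtChartAt I I' p₀ ψ` represents `ψ`. -/
def localDomain (ψ : M → N) (p₀ : M) : Set E :=
  (extChartAt I p₀).target ∩ (extChartAt I p₀).symm ⁻¹' (ψ ⁻¹' (extChartAt I' (ψ p₀)).source)

end Charts

/-! ### Sasakian space forms and complex space forms -/

section SpaceForms

variable {d : ℕ} {M : Type*} [TopologicalSpace M] [ChartedSpace (EuclideanSpace ℝ (Fin d)) M]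
  [IsManifold (𝓡 d) ∞ M]

/-- `(φ, ξ, η, g)` is a Sasakian structure: an almost contact metric structure which is contact,
`g(X, φY) = dη(X, Y)`, and normal, `N_φ + 2 dη ⊗ ξ = 0`. Here `dη` carries the factor `½`. -/
structure IsSasakian
    (g : ContMDiffRiemannianMetric (𝓡 d) ∞ (EuclideanSpace ℝ (Fin d))
      (fun p : M => TangentSpace (𝓡 d) p))
    (φ : ∀ p : M, TangentSpace (𝓡 d) p →L[ℝ] TangentSpace (𝓡 d) p)
    (ξ : ∀ p : M, TangentSpace (𝓡 d) p)
    (η : ∀ p : M, TangentSpace (𝓡 d) p →L[ℝ] ℝ) : Prop where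
  smooth_φ : ContMDiff (𝓡 d)
    ((𝓡 d).prod 𝓘(ℝ, EuclideanSpace ℝ (Fin d) →L[ℝ] EuclideanSpace ℝ (Fin d))) ∞
    (fun p => TotalSpace.mk' (EuclideanSpace ℝ (Fin d) →L[ℝ] EuclideanSpace ℝ (Fin d)) p (φ p))
  smooth_ξ : ContMDiff (𝓡 d) ((𝓡 d).prod 𝓘(ℝ, EuclideanSpace ℝ (Fin d))) ∞
    (fun p => TotalSpace.mk' (EuclideanSpace ℝ (Fin d)) p (ξ p))
  smooth_η : ContMDiff (𝓡 d) ((𝓡 d).prod 𝓘(ℝ, EuclideanSpace ℝ (Fin d) →L[ℝ] ℝ)) ∞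
    (fun p => TotalSpace.mk' (EuclideanSpace ℝ (Fin d) →L[ℝ] ℝ) p (η p))
  φ_sq : ∀ p (u : TangentSpace (𝓡 d) p), φ p (φ p u) = -u + η p u • ξ p
  η_ξ : ∀ p, η p (ξ p) = 1
  η_φ : ∀ p (u : TangentSpace (𝓡 d) p), η p (φ p u) = 0
  η_eq : ∀ p (u : TangentSpace (𝓡 d) p), η p u = g.inner p (ξ p) u
  compatible : ∀ p (u v : TangentSpace (𝓡 d) p),
    g.inner p (φ p u) (φ p v) = g.inner p u v - η p u * η p v
  contact : ∀ (p₀ : M), ∀ x ∈ (extChartAt (𝓡 d) p₀).target,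
    ∀ X Y : EuclideanSpace ℝ (Fin d) → EuclideanSpace ℝ (Fin d), ContDiff ℝ ∞ X → ContDiff ℝ ∞ Y →
      localMetric (𝓡 d) g.inner p₀ x (X x) (localEnd (𝓡 d) φ p₀ x (Y x))
        = extDeriv (localForm (𝓡 d) η p₀) X Y x
  normal : ∀ (p₀ : M), ∀ x ∈ (extChartAt (𝓡 d) p₀).target,
    ∀ X Y : EuclideanSpace ℝ (Fin d) → EuclideanSpace ℝ (Fin d), ContDiff ℝ ∞ X → ContDiff ℝ ∞ Y →
      nijenhuis (localEnd (𝓡 d) φ p₀) X Y x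
        + (2 * extDeriv (localForm (𝓡 d) η p₀) X Y x) • localVec (𝓡 d) ξ p₀ x = 0

/-- A Sasakian manifold of constant `φ`-sectional curvature `c`: the sectional curvature of the
plane spanned by `u` and `φu` is `c` for every nonzero `u` orthogonal to `ξ`. -/
structure IsSasakianSpaceForm
    (g : ContMDiffRiemannianMetric (𝓡 d) ∞ (EuclideanSpace ℝ (Fin d))
      (fun p : M => TangentSpace (𝓡 d) p))
    (φ : ∀ p : M, TangentSpace (𝓡 d) p →L[ℝ] TangentSpace (𝓡 d) p)
    (ξ : ∀ p : M, TangentSpace (𝓡 d) p)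
    (η : ∀ p : M, TangentSpace (𝓡 d) p →L[ℝ] ℝ) (c : ℝ) : Prop extends
    IsSasakian g φ ξ η where
  φ_sectional : ∀ (p₀ : M), ∀ x ∈ (extChartAt (𝓡 d) p₀).target, ∀ u : EuclideanSpace ℝ (Fin d),
    u ≠ 0 → localForm (𝓡 d) η p₀ x u = 0 →
      sectionalCurvature (localMetric (𝓡 d) g.inner p₀) x u (localEnd (𝓡 d) φ p₀ x u) = c

/-- A complex space form: a Kähler manifold `(g, J)`, with `J² = -1`, `g(Ju, Jv) = g(u, v)` and
`∇J = 0`, whose curvature tensor is that of constant holomorphic sectional curvature `4k`. -/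
structure IsComplexSpaceForm
    (g : ContMDiffRiemannianMetric (𝓡 d) ∞ (EuclideanSpace ℝ (Fin d))
      (fun p : M => TangentSpace (𝓡 d) p))
    (J : ∀ p : M, TangentSpace (𝓡 d) p →L[ℝ] TangentSpace (𝓡 d) p) (k : ℝ) : Prop where
  smooth_J : ContMDiff (𝓡 d)
    ((𝓡 d).prod 𝓘(ℝ, EuclideanSpace ℝ (Fin d) →L[ℝ] EuclideanSpace ℝ (Fin d))) ∞
    (fun p => TotalSpace.mk' (EuclideanSpace ℝ (Fin d) →L[ℝ] EuclideanSpace ℝ (Fin d)) p (J p))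
  J_sq : ∀ p (u : TangentSpace (𝓡 d) p), J p (J p u) = -u
  hermitian : ∀ p (u v : TangentSpace (𝓡 d) p), g.inner p (J p u) (J p v) = g.inner p u v
  parallel : ∀ (p₀ : M), ∀ x ∈ (extChartAt (𝓡 d) p₀).target, ∀ u v : EuclideanSpace ℝ (Fin d),
    covDeriv (localMetric (𝓡 d) g.inner p₀) id (fun y => localEnd (𝓡 d) J p₀ y v) x u
      = localEnd (𝓡 d) J p₀ x (covDeriv (localMetric (𝓡 d) g.inner p₀) id (fun _ => v) x u)
  curvature_eq : ∀ (p₀ : M), ∀ x ∈ (extChartAt (𝓡 d) p₀).target,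
    ∀ u v w : EuclideanSpace ℝ (Fin d),
      curvature (localMetric (𝓡 d) g.inner p₀) x u v w =
        let G := localMetric (𝓡 d) g.inner p₀ x
        let j := localEnd (𝓡 d) J p₀ x
        k • (G v w • u - G u w • v + G (j v) w • j u - G (j u) w • j v - (2 * G (j u) v) • j w)

end SpaceForms

/-! ### Warped products and their hypersurfaces -/

section Warped

variable {E₁ : Type*} [NormedAddCommGroup E₁] [NormedSpace ℝ E₁]
  {H₁ : Type*} [TopologicalSpace H₁] (I₁ : ModelWithCorners ℝ E₁ H₁)
  {M₁ : Type*} [TopologicalSpace M₁] [ChartedSpace H₁ M₁]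
  {E₂ : Type*} [NormedAddCommGroup E₂] [NormedSpace ℝ E₂]
  {H₂ : Type*} [TopologicalSpace H₂] (I₂ : ModelWithCorners ℝ E₂ H₂)
  {M₂ : Type*} [TopologicalSpace M₂] [ChartedSpace H₂ M₂]

/-- The warped product metric `π^* g₁ + f² σ^* g₂` on `M₁ × M₂`. -/
def warpedMetric (g₁ : ∀ p : M₁, TangentSpace I₁ p →L[ℝ] TangentSpace I₁ p →L[ℝ] ℝ)
    (g₂ : ∀ p : M₂, TangentSpace I₂ p →L[ℝ] TangentSpace I₂ p →L[ℝ] ℝ) (f : M₁ → ℝ)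
    (z : M₁ × M₂) :
    TangentSpace (I₁.prod I₂) z →L[ℝ] TangentSpace (I₁.prod I₂) z →L[ℝ] ℝ :=
  let dπ := mfderiv (I₁.prod I₂) I₁ (Prod.fst : M₁ × M₂ → M₁) z
  let dσ := mfderiv (I₁.prod I₂) I₂ (Prod.snd : M₁ × M₂ → M₂) z
  (dπ.precomp ℝ).comp ((g₁ z.1).comp dπ) + (f z.1) ^ 2 • (dσ.precomp ℝ).comp ((g₂ z.2).comp dσ)

end Warped

section Maps

variable {d : ℕ} {M : Type*} [TopologicalSpace M] [ChartedSpace (EuclideanSpace ℝ (Fin d)) M]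
  {E' : Type*} [NormedAddCommGroup E'] [NormedSpace ℝ E']
  {H' : Type*} [TopologicalSpace H'] (I' : ModelWithCorners ℝ E' H')
  {N : Type*} [TopologicalSpace N] [ChartedSpace H' N]
  (g : ∀ p : M, TangentSpace (𝓡 d) p →L[ℝ] TangentSpace (𝓡 d) p →L[ℝ] ℝ)
  (G : ∀ q : N, TangentSpace I' q →L[ℝ] TangentSpace I' q →L[ℝ] ℝ) (ψ : M → N)

/-- `ψ` is a smooth isometric immersion: `ψ^* G = g`. -/
structure IsIsometricImmersion : Prop where
  smooth : ContMDiff (𝓡 d) I' ∞ ψ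
  isometric : ∀ (p : M) (u v : TangentSpace (𝓡 d) p),
    G (ψ p) (mfderiv (𝓡 d) I' ψ p u) (mfderiv (𝓡 d) I' ψ p v) = g p u v

/-- The mean curvature vector of `ψ` at the point with coordinates `x`, in the charts at `p₀` and
`ψ p₀`. -/
def meanCurvatureAt (p₀ : M) (x : EuclideanSpace ℝ (Fin d)) : E' :=
  meanCurvature (localMetric (𝓡 d) g p₀) (localMetric I' G (ψ p₀))
    (writtenInExtChartAt (𝓡 d) I' p₀ ψ) x

/-- `|B|²` at the point with coordinates `x` in the chart at `p₀`. -/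
def normSqBAt (p₀ : M) (x : EuclideanSpace ℝ (Fin d)) : ℝ :=
  normSqSecondFundamentalForm (localMetric (𝓡 d) g p₀) (localMetric I' G (ψ p₀))
    (writtenInExtChartAt (𝓡 d) I' p₀ ψ) x

/-- The length `|H|` of the mean curvature vector is everywhere equal to `h`. -/
def HasConstantMeanCurvature (h : ℝ) : Prop :=
  ∀ p₀, ∀ x ∈ localDomain (𝓡 d) I' ψ p₀,
    √(localMetric I' G (ψ p₀) (writtenInExtChartAt (𝓡 d) I' p₀ ψ x)
      (meanCurvatureAt I' g G ψ p₀ x) (meanCurvatureAt I' g G ψ p₀ x)) = h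

/-- `ψ` is harmonic: its tension field vanishes. -/
def IsHarmonic : Prop :=
  ∀ p₀, ∀ x ∈ localDomain (𝓡 d) I' ψ p₀,
    tension (localMetric (𝓡 d) g p₀) (localMetric I' G (ψ p₀))
      (writtenInExtChartAt (𝓡 d) I' p₀ ψ) x = 0

/-- `ψ` is biharmonic: its bitension field vanishes. -/
def IsBiharmonic : Prop :=
  ∀ p₀, ∀ x ∈ localDomain (𝓡 d) I' ψ p₀,
    bitension (localMetric (𝓡 d) g p₀) (localMetric I' G (ψ p₀))
      (writtenInExtChartAt (𝓡 d) I' p₀ ψ) x = 0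

/-- `ψ` is proper biharmonic: biharmonic and not harmonic. -/
def IsProperBiharmonic : Prop :=
  IsBiharmonic I' g G ψ ∧ ¬ IsHarmonic I' g G ψ

/-- `∇_H ∇f` at the point with coordinates `x`, where `f` is a function on the target, `∇f` is its
gradient and `H` is the mean curvature vector of `ψ`. -/
def covDerivGradAlongH (f : N → ℝ) (p₀ : M) (x : EuclideanSpace ℝ (Fin d)) : E' :=
  covDeriv (localMetric I' G (ψ p₀)) id
    (gradient (localMetric I' G (ψ p₀)) (fun y => f ((extChartAt I' (ψ p₀)).symm y)))
    (writtenInExtChartAt (𝓡 d) I' p₀ ψ x) (meanCurvatureAt I' g G ψ p₀ x)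

end Maps

section Hypersurface

variable {d d₁ d₂ : ℕ}
  {M : Type*} [TopologicalSpace M] [ChartedSpace (EuclideanSpace ℝ (Fin d)) M]
  {M₁ : Type*} [TopologicalSpace M₁] [ChartedSpace (EuclideanSpace ℝ (Fin d₁)) M₁]
  {M₂ : Type*} [TopologicalSpace M₂] [ChartedSpace (EuclideanSpace ℝ (Fin d₂)) M₂]

/-- The mean curvature vector is horizontal, i.e. tangent to the factor `M₁`: its component in the
factor `M₂` vanishes (the charts of `M₁ × M₂` are products of charts). -/
def HasHorizontalMeanCurvature
    (g : ∀ p : M, TangentSpace (𝓡 d) p →L[ℝ] TangentSpace (𝓡 d) p →L[ℝ] ℝ)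
    (G : ∀ z : M₁ × M₂, TangentSpace ((𝓡 d₁).prod (𝓡 d₂)) z →L[ℝ]
      TangentSpace ((𝓡 d₁).prod (𝓡 d₂)) z →L[ℝ] ℝ) (ψ : M → M₁ × M₂) : Prop :=
  ∀ p₀, ∀ x ∈ localDomain (𝓡 d) ((𝓡 d₁).prod (𝓡 d₂)) ψ p₀,
    (meanCurvatureAt ((𝓡 d₁).prod (𝓡 d₂)) g G ψ p₀ x).2 = 0

/-- The horizontal lift `(ξ, 0)` of the vector field `ξ` on `M₁` is tangent to the hypersurface. -/
def IsTangentTo (ξ : ∀ p : M₁, TangentSpace (𝓡 d₁) p) (ψ : M → M₁ × M₂) : Prop :=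
  ∀ p : M, ∃ u : TangentSpace (𝓡 d) p,
    mfderiv ((𝓡 d₁).prod (𝓡 d₂)) (𝓡 d₁) (Prod.fst : M₁ × M₂ → M₁) (ψ p)
        (mfderiv (𝓡 d) ((𝓡 d₁).prod (𝓡 d₂)) ψ p u) = ξ (ψ p).1 ∧
      mfderiv ((𝓡 d₁).prod (𝓡 d₂)) (𝓡 d₂) (Prod.snd : M₁ × M₂ → M₂) (ψ p)
        (mfderiv (𝓡 d) ((𝓡 d₁).prod (𝓡 d₂)) ψ p u) = 0

end Hypersurface

end WarpedBiharmonic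

end

/-!
For a hypersurface `ψ` whose mean curvature vector `H` has constant length `h ≠ 0`, `H / h` is a
unit normal field. By the Codazzi equation, and because `|H|` is constant, the tangential part of
`τ₂(ψ)` is a multiple of the tangential part of `Ric(H)`, while its normal part is a multiple of
`Ric(H, H) - |B|² h²`. As tangent and normal vectors span, `τ₂(ψ) = 0` amounts to
`Ric(Z, H) = |B|² ⟨H, Z⟩` for all vectors `Z` of the target.

In the warped product, `Ric(Z, H) = Ric₁(Z, H) - (dim M₂ / f) Hess f (Z, H)` for horizontal `H`.
Since `ξ` is tangent, `H` is orthogonal to `ξ`, and on such vectors the Ricci tensor of a Sasakian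
space form is `(c (m + 1) + 3 m - 1) / 2` times the metric: subtracting from the curvature of `M₁` a
model with the same `φ`-sectional curvature leaves a tensor with the symmetries of a Kähler
curvature tensor (modulo `ξ`) and zero holomorphic sectional curvature, which therefore vanishes.
-/

noncomputable section

namespace WarpedBiharmonic

set_option maxSynthPendingDepth 3

section Calculus

variable {𝕜 E F F' W : Type*} [NontriviallyNormedField 𝕜] [NormedAddCommGroup E] [NormedSpace 𝕜 E]
  [NormedAddCommGroup F] [NormedSpace 𝕜 F] [NormedAddCommGroup F'] [NormedSpace 𝕜 F']
  [NormedAddCommGroup W] [NormedSpace 𝕜 W]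

lemma fderiv_clm_apply_apply {A : E → F →L[𝕜] W} {a : E → F} {x : E}
    (hA : DifferentiableAt 𝕜 A x) (ha : DifferentiableAt 𝕜 a x) (u : E) :
    fderiv 𝕜 (fun y => A y (a y)) x u = fderiv 𝕜 A x u (a x) + A x (fderiv 𝕜 a x u) := by
  simp [fderiv_clm_apply hA ha, add_comm]

lemma fderiv_clm_apply₂_apply {A : E → F →L[𝕜] F' →L[𝕜] W} {a : E → F} {b : E → F'} {x : E}
    (hA : DifferentiableAt 𝕜 A x) (ha : DifferentiableAt 𝕜 a x) (hb : DifferentiableAt 𝕜 b x)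
    (u : E) : fderiv 𝕜 (fun y => A y (a y) (b y)) x u =
      fderiv 𝕜 A x u (a x) (b x) + A x (fderiv 𝕜 a x u) (b x) + A x (a x) (fderiv 𝕜 b x u) := by
  simp [fderiv_clm_apply_apply (hA.clm_apply ha) hb, fderiv_clm_apply_apply hA ha]

lemma fderiv_clm_apply_const {A : E → F →L[𝕜] W} {x : E} (hA : DifferentiableAt 𝕜 A x) (u : E)
    (v : F) : fderiv 𝕜 (fun y => A y v) x u = fderiv 𝕜 A x u v := by
  simp [fderiv_clm_apply_apply hA (differentiableAt_const v)]

lemma fderiv_clm_apply₂_const {A : E → F →L[𝕜] F' →L[𝕜] W} {x : E} (hA : DifferentiableAt 𝕜 A x)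
    (u : E) (v : F) (w : F') : fderiv 𝕜 (fun y => A y v w) x u = fderiv 𝕜 A x u v w := by
  simp [fderiv_clm_apply₂_apply hA (differentiableAt_const v) (differentiableAt_const w)]

lemma fderiv_clm_comm {A : E → F →L[𝕜] F →L[𝕜] W} {x : E} (hA : DifferentiableAt 𝕜 A x)
    (hsymm : ∀ᶠ y in nhds x, ∀ v w, A y v w = A y w v) (u : E) (v w : F) :
    fderiv 𝕜 A x u v w = fderiv 𝕜 A x u w v := by
  rw [← fderiv_clm_apply₂_const hA u v w, ← fderiv_clm_apply₂_const hA u w v]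
  exact DFunLike.congr_fun (Filter.EventuallyEq.fderiv_eq (hsymm.mono fun y hy => hy v w)) u

lemma contDiffAt_infty_fderiv {f : E → F} {x : E} (hf : ContDiffAt 𝕜 ∞ f x) :
    ContDiffAt 𝕜 ∞ (fderiv 𝕜 f) x :=
  hf.fderiv_right le_rfl

lemma differentiableAt_of_contDiffAt_infty {f : E → F} {x : E} (hf : ContDiffAt 𝕜 ∞ f x) :
    DifferentiableAt 𝕜 f x :=
  hf.differentiableAt (by simp)

lemma fderiv_fderiv_comm {E F : Type*} [NormedAddCommGroup E] [NormedSpace ℝ E]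
    [NormedAddCommGroup F] [NormedSpace ℝ F] {f : E → F} {x : E} (hf : ContDiffAt ℝ ∞ f x)
    (u v : E) : fderiv ℝ (fderiv ℝ f) x u v = fderiv ℝ (fderiv ℝ f) x v u :=
  hf.isSymmSndFDerivAt
    (by simpa using WithTop.coe_le_coe.2 (le_top : (2 : ℕ∞) ≤ ⊤)) u v

end Calculus

section Metric

variable {F : Type*} [NormedAddCommGroup F] [NormedSpace ℝ F]

/-- `G` is a smooth Riemannian metric, in coordinates, on the open set `V`. -/
structure IsMetricOn (G : F → F →L[ℝ] F →L[ℝ] ℝ) (V : Set F) : Prop where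
  isOpen : IsOpen V
  smooth : ∀ x ∈ V, ContDiffAt ℝ ∞ G x
  symm : ∀ x ∈ V, ∀ u v, G x u v = G x v u
  pos : ∀ x ∈ V, ∀ u, u ≠ 0 → 0 < G x u u

lemma koszul_apply (G : F → F →L[ℝ] F →L[ℝ] ℝ) (x u v w : F) : koszul G x u v w
    = (fderiv ℝ G x u v w + fderiv ℝ G x v u w - fderiv ℝ G x w u v) / 2 := by
  simp only [koszul, _root_.smul_apply, _root_.sub_apply, _root_.add_apply,
    ContinuousLinearMap.flip_apply, smul_eq_mul]
  ring

/-- `koszul` as a continuous bilinear map. -/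
def koszulCLM (G : F → F →L[ℝ] F →L[ℝ] ℝ) (x : F) : F →L[ℝ] F →L[ℝ] F →L[ℝ] ℝ :=
  (1 / 2 : ℝ) • (fderiv ℝ G x + (fderiv ℝ G x).flip
    - ((ContinuousLinearMap.flipₗᵢ ℝ F F ℝ).toContinuousLinearEquiv :
        (F →L[ℝ] F →L[ℝ] ℝ) →L[ℝ] (F →L[ℝ] F →L[ℝ] ℝ)).comp (fderiv ℝ G x).flip)

lemma koszulCLM_apply (G : F → F →L[ℝ] F →L[ℝ] ℝ) (x u v : F) :
    koszulCLM G x u v = koszul G x u v := by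
  ext w
  simp [koszulCLM, koszul]

/-- The Christoffel symbols as a continuous bilinear map. -/
def christoffelCLM (G : F → F →L[ℝ] F →L[ℝ] ℝ) (x : F) : F →L[ℝ] F →L[ℝ] F :=
  (ContinuousLinearMap.compL ℝ F (F →L[ℝ] ℝ) F (sharp G x)).comp (koszulCLM G x)

lemma christoffelCLM_apply (G : F → F →L[ℝ] F →L[ℝ] ℝ) (x u v : F) :
    christoffelCLM G x u v = christoffel G x u v := by
  simp [christoffelCLM, christoffel, koszulCLM_apply]

namespace IsMetricOn

variable {G : F → F →L[ℝ] F →L[ℝ] ℝ} {V : Set F} (hG : IsMetricOn G V) {x : F} (hx : x ∈ V)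

include hG hx

lemma differentiableAt : DifferentiableAt ℝ G x :=
  differentiableAt_of_contDiffAt_infty (hG.smooth x hx)

lemma fderiv_symm (u v w : F) : fderiv ℝ G x u v w = fderiv ℝ G x u w v :=
  fderiv_clm_comm (hG.differentiableAt hx)
    (Filter.eventually_of_mem (hG.isOpen.mem_nhds hx) hG.symm) u v w

lemma christoffel_symm (u v : F) : christoffel G x u v = christoffel G x v u := by
  refine congrArg (sharp G x) (ContinuousLinearMap.ext fun w => ?_)
  rw [koszul_apply, koszul_apply, hG.fderiv_symm hx w u v]
  ring

lemma christoffelCLM_symm (u v : F) : christoffelCLM G x u v = christoffelCLM G x v u := by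
  simp only [christoffelCLM_apply, hG.christoffel_symm hx u v]

lemma eq_zero_of_inner_self {u : F} (h : G x u u = 0) : u = 0 :=
  by_contra fun hne => (hG.pos x hx u hne).ne' h

lemma nonneg (u : F) : 0 ≤ G x u u := by
  rcases eq_or_ne u 0 with rfl | hu
  · simp
  · exact (hG.pos x hx u hu).le

lemma eq_of_forall_inner {u v : F} (h : ∀ w, G x u w = G x v w) : u = v :=
  sub_eq_zero.1 <| hG.eq_zero_of_inner_self hx <| by
    have := h (u - v)
    simp only [map_sub, _root_.sub_apply] at this ⊢
    linarith

set_option synthInstance.maxHeartbeats 100000 in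
-- Instance search on the iterated spaces of continuous linear maps is slow.
lemma contDiffAt_koszulCLM : ContDiffAt ℝ ∞ (koszulCLM G) x := by
  have hdG := contDiffAt_infty_fderiv (hG.smooth x hx)
  have hflip : ContDiffAt ℝ ∞ (fun y => (fderiv ℝ G y).flip) x :=
    (ContinuousLinearMap.flipₗᵢ ℝ F F (F →L[ℝ] ℝ)).contDiff.contDiffAt.comp x hdG
  exact ((hdG.add hflip).sub (contDiffAt_const.clm_comp hflip)).const_smul _

variable [FiniteDimensional ℝ F]

lemma isInvertible : (G x).IsInvertible := by
  have hinj : Function.Injective (G x : F →ₗ[ℝ] F →L[ℝ] ℝ) := fun u v huv =>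
    hG.eq_of_forall_inner hx fun w => DFunLike.congr_fun huv w
  have hrank : Module.finrank ℝ F = Module.finrank ℝ (F →L[ℝ] ℝ) :=
    Subspace.dual_finrank_eq.symm.trans
      (LinearMap.toContinuousLinearMap (𝕜 := ℝ) (E := F) (F' := ℝ)).finrank_eq
  exact ⟨(LinearEquiv.ofInjectiveOfFinrankEq (G x : F →ₗ[ℝ] F →L[ℝ] ℝ) hinj
    hrank).toContinuousLinearEquiv, rfl⟩

lemma inner_sharp (α : F →L[ℝ] ℝ) (w : F) : G x (sharp G x α) w = α w := by
  rw [sharp, (hG.isInvertible hx).self_apply_inverse]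

lemma inner_christoffel (u v w : F) : G x (christoffel G x u v) w = koszul G x u v w :=
  hG.inner_sharp hx _ w

lemma contDiffAt_sharp : ContDiffAt ℝ ∞ (sharp G) x :=
  ((hG.isInvertible hx).contDiffAt_map_inverse).comp x (hG.smooth x hx)

lemma contDiffAt_christoffelCLM : ContDiffAt ℝ ∞ (christoffelCLM G) x :=
  ((ContinuousLinearMap.contDiff _).contDiffAt.comp x (hG.contDiffAt_sharp hx)).clm_comp
    (hG.contDiffAt_koszulCLM hx)

lemma differentiableAt_christoffelCLM : DifferentiableAt ℝ (christoffelCLM G) x :=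
  differentiableAt_of_contDiffAt_infty (hG.contDiffAt_christoffelCLM hx)

lemma fderiv_eq_christoffel (u v w : F) :
    fderiv ℝ G x u v w = G x (christoffel G x u v) w + G x v (christoffel G x u w) := by
  rw [hG.symm x hx v, hG.inner_christoffel hx, hG.inner_christoffel hx, koszul_apply,
    koszul_apply, hG.fderiv_symm hx u w v]
  ring

end IsMetricOn

end Metric

section CovariantDerivative

variable {E F : Type*} [NormedAddCommGroup E] [NormedSpace ℝ E]
  [NormedAddCommGroup F] [NormedSpace ℝ F]

/-- The total covariant derivative `u ↦ ∇_u X` of a vector field `X` along `ψ`, as a continuous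
linear map. -/
def covDerivCLM (G : F → F →L[ℝ] F →L[ℝ] ℝ) (ψ X : E → F) (x : E) : E →L[ℝ] F :=
  fderiv ℝ X x + ((christoffelCLM G (ψ x)).flip (X x)).comp (fderiv ℝ ψ x)

lemma covDerivCLM_apply (G : F → F →L[ℝ] F →L[ℝ] ℝ) (ψ X : E → F) (x u : E) :
    covDerivCLM G ψ X x u = covDeriv G ψ X x u := by
  simp [covDerivCLM, covDeriv, christoffelCLM_apply]

/-- The covariant derivative `(∇_u T)(v) = ∇_u (T v) - T (∇_u v)` of a field `T` of linear maps
`E → F` along `ψ : E → F`, for the metrics `g` of the source and `G` of the target. The second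
fundamental form, the second covariant derivative of a field along `ψ` and the covariant derivative
of a field of endomorphisms are all of this form. -/
def covDerivHom (g : E → E →L[ℝ] E →L[ℝ] ℝ) (G : F → F →L[ℝ] F →L[ℝ] ℝ) (ψ : E → F)
    (T : E → E →L[ℝ] F) (x : E) : E →L[ℝ] E →L[ℝ] F :=
  fderiv ℝ T x
    + ((ContinuousLinearMap.compL ℝ E F F).flip (T x)).comp
        ((christoffelCLM G (ψ x)).comp (fderiv ℝ ψ x))
    - (ContinuousLinearMap.compL ℝ E E F (T x)).comp (christoffelCLM g x)

variable {g : E → E →L[ℝ] E →L[ℝ] ℝ} {G : F → F →L[ℝ] F →L[ℝ] ℝ} {U : Set E} {V : Set F}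
  {ψ X Y : E → F} {T : E → E →L[ℝ] F} {x : E}

lemma covDeriv_congr (h : X =ᶠ[nhds x] Y) (u : E) : covDeriv G ψ X x u = covDeriv G ψ Y x u := by
  simp only [covDeriv, h.fderiv_eq, h.eq_of_nhds]

lemma covDeriv_const_smul (a : ℝ) (hX : DifferentiableAt ℝ X x) (u : E) :
    covDeriv G ψ (fun y => a • X y) x u = a • covDeriv G ψ X x u := by
  simp [covDeriv, ← christoffelCLM_apply, fderiv_fun_const_smul hX]

lemma covDerivHom_apply (hT : DifferentiableAt ℝ T x) (u v : E) : covDerivHom g G ψ T x u v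
    = covDeriv G ψ (fun y => T y v) x u - T x (christoffel g x u v) := by
  simp [covDerivHom, covDeriv, christoffelCLM_apply, fderiv_clm_apply_const hT]

lemma covDeriv_clm_apply {Z : E → E} (hT : DifferentiableAt ℝ T x) (hZ : DifferentiableAt ℝ Z x)
    (u : E) : covDeriv G ψ (fun y => T y (Z y)) x u
      = covDerivHom g G ψ T x u (Z x) + T x (covDeriv g id Z x u) := by
  simp only [covDerivHom_apply hT, covDeriv, fderiv_clm_apply_apply hT hZ,
    fderiv_clm_apply_const hT, fderiv_id, ContinuousLinearMap.id_apply, id, map_add]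
  abel

lemma covDerivHom_fderiv (hψ : ContDiffAt ℝ ∞ ψ x) (u v : E) :
    covDerivHom g G ψ (fderiv ℝ ψ) x u v = secondFundamentalForm g G ψ x u v :=
  covDerivHom_apply (differentiableAt_of_contDiffAt_infty (contDiffAt_infty_fderiv hψ)) u v

namespace IsMetricOn

lemma covDerivHom_fderiv_symm (hg : IsMetricOn g U) (hx : x ∈ U) (hG : IsMetricOn G V)
    (hψx : ψ x ∈ V) (hψ : ContDiffAt ℝ ∞ ψ x) (u v : E) :
    covDerivHom g G ψ (fderiv ℝ ψ) x u v = covDerivHom g G ψ (fderiv ℝ ψ) x v u := by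
  simp [covDerivHom, fderiv_fderiv_comm hψ u v, hg.christoffelCLM_symm hx u v,
    hG.christoffelCLM_symm hψx (fderiv ℝ ψ x u)]

variable [FiniteDimensional ℝ F]

lemma contDiffAt_covDerivCLM (hG : IsMetricOn G V) (hx : ψ x ∈ V) (hψ : ContDiffAt ℝ ∞ ψ x)
    (hX : ContDiffAt ℝ ∞ X x) : ContDiffAt ℝ ∞ (covDerivCLM G ψ X) x := by
  have hΓ : ContDiffAt ℝ ∞ (fun y => (christoffelCLM G (ψ y)).flip) x :=
    (ContinuousLinearMap.flipₗᵢ ℝ F F F).contDiff.contDiffAt.comp x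
      ((hG.contDiffAt_christoffelCLM hx).comp x hψ)
  exact (contDiffAt_infty_fderiv hX).add ((hΓ.clm_apply hX).clm_comp (contDiffAt_infty_fderiv hψ))

lemma contDiffAt_covDeriv (hG : IsMetricOn G V) (hx : ψ x ∈ V) (hψ : ContDiffAt ℝ ∞ ψ x)
    (hX : ContDiffAt ℝ ∞ X x) (u : E) : ContDiffAt ℝ ∞ (fun y => covDeriv G ψ X y u) x := by
  simp only [← covDerivCLM_apply]
  exact (hG.contDiffAt_covDerivCLM hx hψ hX).clm_apply contDiffAt_const

lemma contDiffAt_covDerivHom [FiniteDimensional ℝ E] (hg : IsMetricOn g U) (hx : x ∈ U)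
    (hG : IsMetricOn G V) (hψx : ψ x ∈ V) (hψ : ContDiffAt ℝ ∞ ψ x) (hT : ContDiffAt ℝ ∞ T x) :
    ContDiffAt ℝ ∞ (covDerivHom g G ψ T) x := by
  have hΓ : ContDiffAt ℝ ∞ (fun y => (christoffelCLM G (ψ y)).comp (fderiv ℝ ψ y)) x :=
    ((hG.contDiffAt_christoffelCLM hψx).comp x hψ).clm_comp (contDiffAt_infty_fderiv hψ)
  have hcompT : ContDiffAt ℝ ∞ (fun y => (ContinuousLinearMap.compL ℝ E F F).flip (T y)) x :=
    (ContinuousLinearMap.contDiff _).contDiffAt.comp x hT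
  have hTcomp : ContDiffAt ℝ ∞ (fun y => ContinuousLinearMap.compL ℝ E E F (T y)) x :=
    (ContinuousLinearMap.contDiff _).contDiffAt.comp x hT
  exact ((contDiffAt_infty_fderiv hT).add (hcompT.clm_comp hΓ)).sub
    (hTcomp.clm_comp (hg.contDiffAt_christoffelCLM hx))

lemma covDerivHom_covDerivCLM (hG : IsMetricOn G V) (hx : ψ x ∈ V) (hψ : ContDiffAt ℝ ∞ ψ x)
    (hX : ContDiffAt ℝ ∞ X x) (u v : E) :
    covDerivHom g G ψ (covDerivCLM G ψ X) x u v = secondCovDeriv g G ψ X x u v := by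
  rw [covDerivHom_apply
    (differentiableAt_of_contDiffAt_infty (hG.contDiffAt_covDerivCLM hx hψ hX))]
  simp only [covDerivCLM_apply, secondCovDeriv]

lemma fderiv_inner_along (hG : IsMetricOn G V) (hx : ψ x ∈ V) (hψ : DifferentiableAt ℝ ψ x)
    (hX : DifferentiableAt ℝ X x) (hY : DifferentiableAt ℝ Y x) (u : E) :
    fderiv ℝ (fun y => G (ψ y) (X y) (Y y)) x u
      = G (ψ x) (covDeriv G ψ X x u) (Y x) + G (ψ x) (X x) (covDeriv G ψ Y x u) := by
  have hGx := hG.differentiableAt hx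
  rw [fderiv_clm_apply₂_apply (A := fun y => G (ψ y)) (hGx.comp x hψ) hX hY,
    show (fun y => G (ψ y)) = G ∘ ψ from rfl, fderiv_comp x hGx hψ]
  simp only [ContinuousLinearMap.comp_apply, covDeriv, map_add, _root_.add_apply,
    hG.fderiv_eq_christoffel hx]
  ring

lemma secondCovDeriv_const_smul (hG : IsMetricOn G V) (hx : ψ x ∈ V) (hψ : ContDiffAt ℝ ∞ ψ x)
    (hX : ContDiffAt ℝ ∞ X x) (a : ℝ) (u v : E) :
    secondCovDeriv g G ψ (fun y => a • X y) x u v = a • secondCovDeriv g G ψ X x u v := by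
  have h : (fun y => covDeriv G ψ (fun y => a • X y) y v)
      =ᶠ[nhds x] fun y => a • covDeriv G ψ X y v := by
    filter_upwards [(hX.of_le (by simp : (1 : WithTop ℕ∞) ≤ ∞)).eventually (by simp)] with y hy
      using covDeriv_const_smul a (hy.differentiableAt one_ne_zero) v
  have hX' := differentiableAt_of_contDiffAt_infty hX
  have hdX := differentiableAt_of_contDiffAt_infty (hG.contDiffAt_covDeriv hx hψ hX v)
  rw [secondCovDeriv, covDeriv_congr h, covDeriv_const_smul a hX', covDeriv_const_smul a hdX,
    secondCovDeriv, smul_sub]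

end IsMetricOn

end CovariantDerivative

section CurvatureLike

variable {E : Type*} [AddCommGroup E]

/-- `D` is an algebraic curvature tensor (with all four arguments lowered); only additivity is
required. -/
structure IsCurvatureLike (D : E → E → E → E → ℝ) : Prop where
  add : ∀ X X' Y Z W, D (X + X') Y Z W = D X Y Z W + D X' Y Z W
  swap : ∀ X Y Z W, D X Y Z W = -D Y X Z W
  skew : ∀ X Y Z W, D X Y Z W = -D X Y W Z
  bianchi : ∀ X Y Z W, D X Y Z W + D Y Z X W + D Z X Y W = 0

namespace IsCurvatureLike

variable {D D' : E → E → E → E → ℝ} (hD : IsCurvatureLike D)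

include hD

lemma sub (hD' : IsCurvatureLike D') :
    IsCurvatureLike fun X Y Z W => D X Y Z W - D' X Y Z W where
  add X X' Y Z W := by rw [hD.add, hD'.add]; ring
  swap X Y Z W := by rw [hD.swap, hD'.swap]; ring
  skew X Y Z W := by rw [hD.skew, hD'.skew]; ring
  bianchi X Y Z W := by linear_combination hD.bianchi X Y Z W - hD'.bianchi X Y Z W

lemma pair (X Y Z W : E) : D X Y Z W = D Z W X Y := by
  linarith [hD.bianchi X Y Z W, hD.bianchi Y Z W X, hD.bianchi Z W X Y, hD.bianchi W X Y Z,
    hD.skew X Y Z W, hD.skew Y Z W X, hD.skew Z W X Y, hD.skew W X Y Z, hD.skew Z X Y W,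
    hD.skew W Y Z X, hD.swap X Z W Y, hD.swap Y W X Z]

lemma add₂ (X Y Y' Z W : E) : D X (Y + Y') Z W = D X Y Z W + D X Y' Z W := by
  rw [hD.swap, hD.add, hD.swap X Y, hD.swap X Y']
  ring

lemma add₃ (X Y Z Z' W : E) : D X Y (Z + Z') W = D X Y Z W + D X Y Z' W := by
  rw [hD.pair, hD.add, hD.pair Z, hD.pair Z']

lemma add₄ (X Y Z W W' : E) : D X Y Z (W + W') = D X Y Z W + D X Y Z W' := by
  rw [hD.skew, hD.add₃, hD.skew X Y Z W, hD.skew X Y Z W']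
  ring

lemma neg (X Y Z W : E) : D (-X) Y Z W = -D X Y Z W := by
  have h₀ := hD.add 0 0 Y Z W
  have h := hD.add X (-X) Y Z W
  rw [add_zero] at h₀
  rw [add_neg_cancel] at h
  linarith

lemma neg₂ (X Y Z W : E) : D X (-Y) Z W = -D X Y Z W := by
  rw [hD.swap, hD.neg, hD.swap X Y]

lemma neg₃ (X Y Z W : E) : D X Y (-Z) W = -D X Y Z W := by
  rw [hD.pair, hD.neg, hD.pair Z]

lemma neg₄ (X Y Z W : E) : D X Y Z (-W) = -D X Y Z W := by
  rw [hD.skew, hD.neg₃, hD.skew X Y Z W]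

lemma swap_mid (X Y Z : E) : D X Y Z X = D X Z Y X := by
  rw [hD.pair, hD.swap, hD.skew, neg_neg]

lemma eq_zero_of_sectional_eq_zero (h : ∀ X Y, D X Y Y X = 0) (X Y Z W : E) : D X Y Z W = 0 := by
  have hXX : ∀ X Y Z, D X Y Z X = 0 := fun X Y Z => by
    have hsum := h X (Y + Z)
    simp only [hD.add₂, hD.add₃, h] at hsum
    linarith [hD.swap_mid X Y Z]
  have hanti : ∀ X Y Z W, D X Y Z W = -D W Y Z X := fun X Y Z W => by
    have hsum := hXX (X + W) Y Z
    simp only [hD.add, hD.add₄, hXX] at hsum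
    linarith
  linarith [hD.bianchi X Y Z W, hanti Y Z X W, hanti Z X Y W, hanti X Y Z W, hD.swap X Y Z W,
    hD.swap Y Z X W, hD.swap Z X Y W, hD.pair W Y Z X, hD.pair W Z X Y, hD.pair W X Y Z,
    hD.skew X Y Z W, hD.skew Y Z X W, hD.skew Z X Y W, hD.pair X Y Z W, hD.pair Y Z X W,
    hD.pair Z X Y W, hD.swap W Y Z X, hD.swap W X Y Z, hD.swap W Z X Y,
    hD.skew W Y Z X, hD.skew W X Y Z, hD.skew W Z X Y]

end IsCurvatureLike

end CurvatureLike

section Curvature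

variable {E F : Type*} [NormedAddCommGroup E] [NormedSpace ℝ E]
  [NormedAddCommGroup F] [NormedSpace ℝ F] [FiniteDimensional ℝ F]
  {g : E → E →L[ℝ] E →L[ℝ] ℝ} {G : F → F →L[ℝ] F →L[ℝ] ℝ} {U : Set E} {V : Set F}
  {ψ X : E → F} {x : E}

/-- The curvature tensor `(u, v, w) ↦ R(u, v)w` as a continuous trilinear map: the commutator of the
connection `∂ + Γ`. -/
def curvatureCLM (G : F → F →L[ℝ] F →L[ℝ] ℝ) (x : F) : F →L[ℝ] F →L[ℝ] F →L[ℝ] F :=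
  let A := fderiv ℝ (christoffelCLM G) x
    + (ContinuousLinearMap.compL ℝ F F F).bilinearComp (christoffelCLM G x) (christoffelCLM G x)
  A - A.flip

namespace IsMetricOn

lemma covDeriv_covDeriv (hG : IsMetricOn G V) (hx : ψ x ∈ V) (hψ : ContDiffAt ℝ ∞ ψ x)
    (hX : ContDiffAt ℝ ∞ X x) (u v : E) : covDeriv G ψ (fun y => covDeriv G ψ X y v) x u
      = fderiv ℝ (fderiv ℝ X) x u v
        + fderiv ℝ (christoffelCLM G) (ψ x) (fderiv ℝ ψ x u) (fderiv ℝ ψ x v) (X x)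
        + christoffelCLM G (ψ x) (fderiv ℝ (fderiv ℝ ψ) x u v) (X x)
        + christoffelCLM G (ψ x) (fderiv ℝ ψ x v) (fderiv ℝ X x u)
        + christoffelCLM G (ψ x) (fderiv ℝ ψ x u) (fderiv ℝ X x v)
        + christoffelCLM G (ψ x) (fderiv ℝ ψ x u)
            (christoffelCLM G (ψ x) (fderiv ℝ ψ x v) (X x)) := by
  have hΓ := hG.differentiableAt_christoffelCLM hx
  have hψ' := differentiableAt_of_contDiffAt_infty hψ
  have hX' := differentiableAt_of_contDiffAt_infty hX
  have hdψ := differentiableAt_of_contDiffAt_infty (contDiffAt_infty_fderiv hψ)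
  have hdX := differentiableAt_of_contDiffAt_infty (contDiffAt_infty_fderiv hX)
  have hdψv := hdψ.clm_apply (differentiableAt_const v)
  have hΓψ : DifferentiableAt ℝ (fun y => christoffelCLM G (ψ y)) x := hΓ.comp x hψ'
  simp only [covDeriv, ← christoffelCLM_apply]
  rw [fderiv_fun_add (hdX.clm_apply (differentiableAt_const v))
      ((hΓψ.clm_apply hdψv).clm_apply hX'), _root_.add_apply,
    fderiv_clm_apply₂_apply hΓψ hdψv hX', fderiv_clm_apply_const hdX, fderiv_clm_apply_const hdψ,
    show (fun y => christoffelCLM G (ψ y)) = christoffelCLM G ∘ ψ from rfl, fderiv_comp x hΓ hψ']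
  simp only [ContinuousLinearMap.comp_apply, map_add]
  abel

lemma curvatureCLM_apply (hG : IsMetricOn G V) {x : F} (hx : x ∈ V) (u v w : F) :
    curvatureCLM G x u v w = curvature G x u v w := by
  rw [curvature,
    hG.covDeriv_covDeriv (ψ := id) (X := fun _ => w) hx contDiffAt_id contDiffAt_const,
    hG.covDeriv_covDeriv (ψ := id) (X := fun _ => w) hx contDiffAt_id contDiffAt_const]
  have hid : fderiv ℝ (id : F → F) = fun _ => ContinuousLinearMap.id ℝ F := by ext; simp
  simp [curvatureCLM, hid, fderiv_fun_const]

lemma covDeriv_commutator (hG : IsMetricOn G V) (hx : ψ x ∈ V) (hψ : ContDiffAt ℝ ∞ ψ x)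
    (hX : ContDiffAt ℝ ∞ X x) (u v : E) :
    covDeriv G ψ (fun y => covDeriv G ψ X y v) x u - covDeriv G ψ (fun y => covDeriv G ψ X y u) x v
      = curvature G (ψ x) (fderiv ℝ ψ x u) (fderiv ℝ ψ x v) (X x) := by
  rw [hG.covDeriv_covDeriv hx hψ hX, hG.covDeriv_covDeriv hx hψ hX, ← hG.curvatureCLM_apply hx,
    fderiv_fderiv_comm hψ v u, fderiv_fderiv_comm hX v u]
  simp [curvatureCLM]
  abel

lemma secondCovDeriv_sub_secondCovDeriv (hg : IsMetricOn g U) (hxU : x ∈ U) (hG : IsMetricOn G V)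
    (hx : ψ x ∈ V) (hψ : ContDiffAt ℝ ∞ ψ x) (hX : ContDiffAt ℝ ∞ X x) (u v : E) :
    secondCovDeriv g G ψ X x u v - secondCovDeriv g G ψ X x v u
      = curvature G (ψ x) (fderiv ℝ ψ x u) (fderiv ℝ ψ x v) (X x) := by
  rw [secondCovDeriv, secondCovDeriv, hg.christoffel_symm hxU v u, sub_sub_sub_cancel_right,
    hG.covDeriv_commutator hx hψ hX]

variable (hG : IsMetricOn G V) {x : F} (hx : x ∈ V)

include hG hx

lemma curvature_bianchi (u v w : F) :
    curvature G x u v w + curvature G x v w u + curvature G x w u v = 0 := by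
  have hdΓ := fderiv_clm_comm (hG.differentiableAt_christoffelCLM hx)
    (Filter.eventually_of_mem (hG.isOpen.mem_nhds hx) fun y hy => hG.christoffelCLM_symm hy)
  have hΓ := hG.christoffelCLM_symm hx
  simp only [← hG.curvatureCLM_apply hx]
  simp [curvatureCLM, hdΓ u v w, hdΓ v w u, hdΓ w u v, hΓ v w, hΓ u w, hΓ u v]

lemma fderiv_fderiv_inner_self (u v w : F) :
    fderiv ℝ (fderiv ℝ (fun y => G y w w)) x u v
      = 2 * (G x (covDeriv G id (fun y => covDeriv G id (fun _ => w) y v) x u) w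
        + G x (covDeriv G id (fun _ => w) x v) (covDeriv G id (fun _ => w) x u)) := by
  have hdiff : ∀ y ∈ V, DifferentiableAt ℝ (fun y => covDeriv G id (fun _ => w) y v) y :=
    fun y hy => differentiableAt_of_contDiffAt_infty
      (hG.contDiffAt_covDeriv (ψ := id) hy contDiffAt_id contDiffAt_const v)
  have hw := differentiableAt_const (𝕜 := ℝ) (x := x) w
  have hfirst : (fun y => fderiv ℝ (fun y => G y w w) y v)
      =ᶠ[nhds x] fun y => 2 * G y (covDeriv G id (fun _ => w) y v) w := by
    filter_upwards [hG.isOpen.mem_nhds hx] with y hy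
    have := hG.fderiv_inner_along (ψ := id) (X := fun _ => w) (Y := fun _ => w) hy
      differentiableAt_id (differentiableAt_const w) (differentiableAt_const w) v
    simp only [id] at this
    rw [this, hG.symm y hy w]
    ring
  have hsmooth : ContDiffAt ℝ ∞ (fun y => G y w w) x :=
    ((hG.smooth x hx).clm_apply contDiffAt_const).clm_apply contDiffAt_const
  rw [← fderiv_clm_apply_const
      (differentiableAt_of_contDiffAt_infty (contDiffAt_infty_fderiv hsmooth)), hfirst.fderiv_eq,
    fderiv_const_mul (((hG.differentiableAt hx).clm_apply (hdiff x hx)).clm_apply hw),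
    _root_.smul_apply, smul_eq_mul]
  exact congrArg (2 * ·)
    (hG.fderiv_inner_along (ψ := id) hx differentiableAt_id (hdiff x hx) hw u)

lemma inner_curvature_self (u v w : F) : G x (curvature G x u v w) w = 0 := by
  have hcomm := fderiv_fderiv_comm (f := fun y => G y w w)
    (((hG.smooth x hx).clm_apply contDiffAt_const).clm_apply contDiffAt_const) u v
  rw [hG.fderiv_fderiv_inner_self hx, hG.fderiv_fderiv_inner_self hx,
    hG.symm x hx (covDeriv G id (fun _ => w) x v)] at hcomm
  simp only [curvature, map_sub, _root_.sub_apply]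
  linarith

lemma isCurvatureLike : IsCurvatureLike fun u v w z => G x (curvature G x u v w) z where
  add u u' v w z := by simp [← hG.curvatureCLM_apply hx]
  swap u v w z := by simp [curvature]
  skew u v w z := by
    have hsum := hG.inner_curvature_self hx u v (w + z)
    have hw := hG.inner_curvature_self hx u v w
    have hz := hG.inner_curvature_self hx u v z
    simp only [← hG.curvatureCLM_apply hx, map_add, _root_.add_apply] at hsum hw hz ⊢
    linarith
  bianchi u v w z := by
    simpa using congrArg (fun t => G x t z) (hG.curvature_bianchi hx u v w)

end IsMetricOn

end Curvature

section OrthonormalBases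

variable {F : Type*} [NormedAddCommGroup F] [NormedSpace ℝ F]

/-- The vectors `e i` are orthonormal for the bilinear form `B`. -/
def IsOrthonormalFor {ι : Type*} [DecidableEq ι] (B : F →L[ℝ] F →L[ℝ] ℝ) (e : ι → F) : Prop :=
  ∀ i j, B (e i) (e j) = if i = j then 1 else 0

lemma IsMetricOn.exists_orthonormal [FiniteDimensional ℝ F] {G : F → F →L[ℝ] F →L[ℝ] ℝ}
    {V : Set F} (hG : IsMetricOn G V) {x : F} (hx : x ∈ V) :
    ∃ e : Module.Basis (Fin (Module.finrank ℝ F)) ℝ F, IsOrthonormalFor (G x) e := by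
  let B : LinearMap.BilinForm ℝ F := (G x).toLinearMap₁₂
  have hB : LinearMap.IsSymm B := ⟨fun u v => hG.symm x hx u v⟩
  obtain ⟨v, hv⟩ := LinearMap.BilinForm.exists_orthogonal_basis (B := B) hB
  have hpos : ∀ i, 0 < √(G x (v i) (v i)) := fun i =>
    Real.sqrt_pos.2 (hG.pos x hx _ (v.ne_zero i))
  refine ⟨v.isUnitSMul fun i => (inv_ne_zero (hpos i).ne').isUnit, fun i j => ?_⟩
  simp only [Module.Basis.isUnitSMul_apply, map_smul, _root_.smul_apply, smul_eq_mul]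
  split_ifs with h
  · subst h
    have hsq := Real.mul_self_sqrt (hG.nonneg hx (v i))
    have hne := (hpos i).ne'
    field_simp
    rw [sq, hsq]
  · have hij : G x (v i) (v j) = 0 := hv h
    simp [hij]

namespace IsOrthonormalFor

variable {ι : Type*} [DecidableEq ι] {B : F →L[ℝ] F →L[ℝ] ℝ} {e : Module.Basis ι ℝ F}
  (he : IsOrthonormalFor B e)

include he

lemma repr_eq (u : F) (i : ι) : e.repr u i = B u (e i) := by
  have hcoord : e.coord i = (B.flip (e i) : F →ₗ[ℝ] ℝ) :=
    e.ext fun j => by simp [he j i, Finsupp.single_apply]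
  exact DFunLike.congr_fun hcoord u

variable [Fintype ι]

lemma sum_inner_smul (u : F) : ∑ i, B u (e i) • e i = u := by
  simp only [← he.repr_eq, e.sum_repr]

lemma sum_inner_mul_inner (u v : F) : ∑ i, B u (e i) * B (e i) v = B u v := by
  conv_rhs => rw [← he.sum_inner_smul u]
  simp

lemma trace_eq (A : F →ₗ[ℝ] F) : LinearMap.trace ℝ F A = ∑ i, B (A (e i)) (e i) := by
  simp [LinearMap.trace_eq_matrix_trace ℝ e, Matrix.trace, LinearMap.toMatrix_apply, he.repr_eq]

end IsOrthonormalFor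

end OrthonormalBases

section MetricTrace

variable {d : ℕ} {g : EuclideanSpace ℝ (Fin d) →
    EuclideanSpace ℝ (Fin d) →L[ℝ] EuclideanSpace ℝ (Fin d) →L[ℝ] ℝ}
  {U : Set (EuclideanSpace ℝ (Fin d))} {x : EuclideanSpace ℝ (Fin d)}

/-- The covariant derivative `∇_w β` of a field `β` of bilinear forms. -/
def covDerivForm {E : Type*} [NormedAddCommGroup E] [NormedSpace ℝ E]
    (g β : E → E →L[ℝ] E →L[ℝ] ℝ) (x w : E) : E →L[ℝ] E →L[ℝ] ℝ :=
  fderiv ℝ β x w - (β x).bilinearComp (christoffelCLM g x w) (ContinuousLinearMap.id ℝ E)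
    - (β x).bilinearComp (ContinuousLinearMap.id ℝ E) (christoffelCLM g x w)

namespace IsMetricOn

variable (hg : IsMetricOn g U) (hx : x ∈ U)

include hg hx

lemma metricTrace_eq_sum {W : Type*} [NormedAddCommGroup W] [NormedSpace ℝ W] {ι : Type*}
    [Fintype ι] [DecidableEq ι] {e : Module.Basis ι ℝ (EuclideanSpace ℝ (Fin d))}
    (he : IsOrthonormalFor (g x) e)
    (b : EuclideanSpace ℝ (Fin d) →L[ℝ] EuclideanSpace ℝ (Fin d) →L[ℝ] W) :
    metricTrace g x (fun u v => b u v) = ∑ j, b (e j) (e j) := by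
  have hsharp : ∀ i, sharp g x (EuclideanSpace.proj i) = ∑ j, e j i • e j := fun i => by
    rw [← he.sum_inner_smul (sharp g x _)]
    simp [hg.inner_sharp hx]
  have hcoord : ∀ u : EuclideanSpace ℝ (Fin d), ∑ i, u i • EuclideanSpace.single i (1 : ℝ) = u :=
    fun u => by ext; simp [Pi.single_apply]
  simp only [metricTrace, hsharp, map_sum, map_smul, _root_.sum_apply, _root_.smul_apply]
  rw [Finset.sum_comm]
  simp only [← map_smul, ← map_sum, hcoord]

lemma metricTrace_eq_trace
    (b : EuclideanSpace ℝ (Fin d) →L[ℝ] EuclideanSpace ℝ (Fin d) →L[ℝ] ℝ) :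
    metricTrace g x (fun u v => b u v)
      = LinearMap.trace ℝ (EuclideanSpace ℝ (Fin d)) ((sharp g x).comp b) := by
  obtain ⟨e, he⟩ := hg.exists_orthonormal hx
  simp [hg.metricTrace_eq_sum hx he, he.trace_eq, hg.inner_sharp hx]

lemma fderiv_sharp_comp {β : EuclideanSpace ℝ (Fin d) →
      EuclideanSpace ℝ (Fin d) →L[ℝ] EuclideanSpace ℝ (Fin d) →L[ℝ] ℝ}
    (hβ : DifferentiableAt ℝ β x) (w : EuclideanSpace ℝ (Fin d)) :
    fderiv ℝ (fun y => (sharp g y).comp (β y)) x w = (sharp g x).comp (covDerivForm g β x w)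
      + (((sharp g x).comp (β x)).comp (christoffelCLM g x w)
        - (christoffelCLM g x w).comp ((sharp g x).comp (β x))) := by
  have hA : DifferentiableAt ℝ (fun y => (sharp g y).comp (β y)) x :=
    (differentiableAt_of_contDiffAt_infty (hg.contDiffAt_sharp hx)).clm_comp hβ
  ext1 u
  refine hg.eq_of_forall_inner hx fun v => ?_
  have hβA : (fun y => g y (((sharp g y).comp (β y)) u) v) =ᶠ[nhds x] fun y => β y u v := by
    filter_upwards [hg.isOpen.mem_nhds hx] with y hy using hg.inner_sharp hy _ v
  have hderiv := DFunLike.congr_fun (hβA.fderiv_eq (𝕜 := ℝ)) w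
  rw [fderiv_clm_apply₂_const hβ w u v, fderiv_clm_apply₂_apply (hg.differentiableAt hx)
    (hA.clm_apply (differentiableAt_const u)) (differentiableAt_const v),
    fderiv_clm_apply_const hA] at hderiv
  simp [covDerivForm, hg.inner_sharp hx, christoffelCLM_apply, hg.fderiv_eq_christoffel hx]
    at hderiv ⊢
  linarith

lemma fderiv_metricTrace {β : EuclideanSpace ℝ (Fin d) →
      EuclideanSpace ℝ (Fin d) →L[ℝ] EuclideanSpace ℝ (Fin d) →L[ℝ] ℝ}
    (hβ : DifferentiableAt ℝ β x) (w : EuclideanSpace ℝ (Fin d)) :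
    fderiv ℝ (fun y => metricTrace g y (fun u v => β y u v)) x w
      = metricTrace g x (fun u v => covDerivForm g β x w u v) := by
  let tr : (EuclideanSpace ℝ (Fin d) →L[ℝ] EuclideanSpace ℝ (Fin d)) →L[ℝ] ℝ :=
    LinearMap.toContinuousLinearMap
      (LinearMap.trace ℝ (EuclideanSpace ℝ (Fin d)) ∘ₗ ContinuousLinearMap.coeLM ℝ)
  have htrace : (fun y => metricTrace g y (fun u v => β y u v))
      =ᶠ[nhds x] fun y => tr ((sharp g y).comp (β y)) := by
    filter_upwards [hg.isOpen.mem_nhds hx] with y hy using hg.metricTrace_eq_trace hy (β y)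
  have hcomm : ∀ A B : EuclideanSpace ℝ (Fin d) →L[ℝ] EuclideanSpace ℝ (Fin d),
      tr (A.comp B) = tr (B.comp A) := fun A B =>
    LinearMap.trace_mul_comm ℝ (A : EuclideanSpace ℝ (Fin d) →ₗ[ℝ] EuclideanSpace ℝ (Fin d)) B
  rw [htrace.fderiv_eq, show (fun y => tr ((sharp g y).comp (β y)))
      = tr ∘ fun y => (sharp g y).comp (β y) from rfl,
    fderiv_comp x tr.differentiableAt
      ((differentiableAt_of_contDiffAt_infty (hg.contDiffAt_sharp hx)).clm_comp hβ),
    tr.fderiv, ContinuousLinearMap.comp_apply, hg.fderiv_sharp_comp hx hβ, map_add, map_sub,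
    hcomm _ (christoffelCLM g x w), sub_self, add_zero, hg.metricTrace_eq_trace hx]
  rfl

end IsMetricOn

end MetricTrace

section Ricci

variable {F : Type*} [NormedAddCommGroup F] [NormedSpace ℝ F]
  {G : F → F →L[ℝ] F →L[ℝ] ℝ} {V : Set F} {x : F}

/-- The Ricci tensor `Ric(v, w) = trace (u ↦ R(u, v)w)`. -/
def ricci (G : F → F →L[ℝ] F →L[ℝ] ℝ) (x v w : F) : ℝ :=
  LinearMap.trace ℝ F (((curvatureCLM G x).flip v).flip w)

lemma ricci_add_left (G : F → F →L[ℝ] F →L[ℝ] ℝ) (x v v' w : F) :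
    ricci G x (v + v') w = ricci G x v w + ricci G x v' w := by
  simp only [ricci, map_add, ContinuousLinearMap.flip_add, ContinuousLinearMap.toLinearMap_add,
    _root_.add_apply]

lemma ricci_smul_left (G : F → F →L[ℝ] F →L[ℝ] ℝ) (x : F) (c : ℝ) (v w : F) :
    ricci G x (c • v) w = c * ricci G x v w := by
  simp only [ricci, map_smul, ContinuousLinearMap.flip_smul, ContinuousLinearMap.toLinearMap_smul,
    _root_.smul_apply, smul_eq_mul]

namespace IsMetricOn

variable [FiniteDimensional ℝ F] (hG : IsMetricOn G V) (hx : x ∈ V)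

include hG hx

lemma ricci_eq_sum {ι : Type*} [Fintype ι] [DecidableEq ι] {e : Module.Basis ι ℝ F}
    (he : IsOrthonormalFor (G x) e) (v w : F) :
    ricci G x v w = ∑ i, G x (curvature G x (e i) v w) (e i) := by
  simp [ricci, he.trace_eq, hG.curvatureCLM_apply hx]

end IsMetricOn

end Ricci

section IsometricImmersion

variable {E F : Type*} [NormedAddCommGroup E] [NormedSpace ℝ E] [NormedAddCommGroup F]
  [NormedSpace ℝ F] {g : E → E →L[ℝ] E →L[ℝ] ℝ} {G : F → F →L[ℝ] F →L[ℝ] ℝ} {U : Set E}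
  {V : Set F} {ψ H : E → F} {x : E} {h : ℝ}

/-- In coordinates, `ψ` is an isometric immersion from `(U, g)` to `(V, G)`. -/
structure IsIsometricOn (g : E → E →L[ℝ] E →L[ℝ] ℝ) (G : F → F →L[ℝ] F →L[ℝ] ℝ) (ψ : E → F)
    (U : Set E) (V : Set F) : Prop where
  source : IsMetricOn g U
  target : IsMetricOn G V
  smooth : ∀ x ∈ U, ContDiffAt ℝ ∞ ψ x
  mapsTo : ∀ x ∈ U, ψ x ∈ V
  isometric : ∀ x ∈ U, ∀ u v, G (ψ x) (fderiv ℝ ψ x u) (fderiv ℝ ψ x v) = g x u v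

/-- `H` is a smooth normal field of constant nonzero length `h` along the hypersurface `ψ`. -/
structure IsNormalFieldOn (G : F → F →L[ℝ] F →L[ℝ] ℝ) (ψ H : E → F) (h : ℝ) (U : Set E) :
    Prop where
  codim_one : Module.finrank ℝ F = Module.finrank ℝ E + 1
  ne_zero : h ≠ 0
  smooth : ∀ x ∈ U, ContDiffAt ℝ ∞ H x
  normal : ∀ x ∈ U, ∀ w, G (ψ x) (H x) (fderiv ℝ ψ x w) = 0
  norm_sq : ∀ x ∈ U, G (ψ x) (H x) (H x) = h ^ 2

/-- The scalar second fundamental form `G(B, H)` in the direction of a normal field `H`. -/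
def shapeForm (g : E → E →L[ℝ] E →L[ℝ] ℝ) (G : F → F →L[ℝ] F →L[ℝ] ℝ) (ψ H : E → F) (x : E) :
    E →L[ℝ] E →L[ℝ] ℝ :=
  (ContinuousLinearMap.compL ℝ E F ℝ (G (ψ x) (H x))).comp (covDerivHom g G ψ (fderiv ℝ ψ) x)

lemma shapeForm_apply (hψ : ContDiffAt ℝ ∞ ψ x) (u v : E) :
    shapeForm g G ψ H x u v = G (ψ x) (H x) (secondFundamentalForm g G ψ x u v) := by
  rw [← covDerivHom_fderiv hψ]
  rfl

lemma covDeriv_fderiv_apply (u v : E) :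
    covDeriv G ψ (fun y => fderiv ℝ ψ y v) x u
      = secondFundamentalForm g G ψ x u v + fderiv ℝ ψ x (christoffel g x u v) :=
  (sub_add_cancel _ _).symm

namespace IsIsometricOn

variable (hψ : IsIsometricOn g G ψ U V) (hx : x ∈ U)

include hψ hx

lemma differentiableAt : DifferentiableAt ℝ ψ x :=
  differentiableAt_of_contDiffAt_infty (hψ.smooth x hx)

lemma differentiableAt_fderiv_apply (v : E) : DifferentiableAt ℝ (fun y => fderiv ℝ ψ y v) x :=
  (differentiableAt_of_contDiffAt_infty
    (contDiffAt_infty_fderiv (hψ.smooth x hx))).clm_apply (differentiableAt_const v)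

lemma shapeForm_symm (u v : E) : shapeForm g G ψ H x u v = shapeForm g G ψ H x v u :=
  congrArg (G (ψ x) (H x)) <|
    hψ.source.covDerivHom_fderiv_symm hx hψ.target (hψ.mapsTo x hx) (hψ.smooth x hx) u v

/-- The trilinear form `G(B(u, v), dψ w)` is symmetric in `u, v`, and antisymmetric in `v, w` by
differentiating `G(dψ v, dψ w) = g(v, w)`. -/
lemma inner_secondFundamentalForm_tangent [FiniteDimensional ℝ E] [FiniteDimensional ℝ F]
    (u v w : E) : G (ψ x) (secondFundamentalForm g G ψ x u v) (fderiv ℝ ψ x w) = 0 := by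
  have hψx := hψ.mapsTo x hx
  have hsymm : ∀ u v w, G (ψ x) (secondFundamentalForm g G ψ x u v) (fderiv ℝ ψ x w)
      = G (ψ x) (secondFundamentalForm g G ψ x v u) (fderiv ℝ ψ x w) := fun u v w => by
    rw [← covDerivHom_fderiv (hψ.smooth x hx), ← covDerivHom_fderiv (hψ.smooth x hx),
      hψ.source.covDerivHom_fderiv_symm hx hψ.target hψx (hψ.smooth x hx)]
  have hanti : ∀ u v w, G (ψ x) (secondFundamentalForm g G ψ x u v) (fderiv ℝ ψ x w)
      = -G (ψ x) (secondFundamentalForm g G ψ x u w) (fderiv ℝ ψ x v) := fun u v w => by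
    have hiso : (fun y => G (ψ y) (fderiv ℝ ψ y v) (fderiv ℝ ψ y w))
        =ᶠ[nhds x] fun y => g y v w := by
      filter_upwards [hψ.source.isOpen.mem_nhds hx] with y hy using hψ.isometric y hy v w
    have hderiv := hψ.target.fderiv_inner_along hψx (hψ.differentiableAt hx)
      (hψ.differentiableAt_fderiv_apply hx v) (hψ.differentiableAt_fderiv_apply hx w) u
    rw [hiso.fderiv_eq, fderiv_clm_apply₂_const (hψ.source.differentiableAt hx) u v w,
      hψ.source.fderiv_eq_christoffel hx, covDeriv_fderiv_apply (g := g),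
      covDeriv_fderiv_apply (g := g), map_add, map_add, _root_.add_apply,
      hψ.isometric x hx, hψ.isometric x hx,
      hψ.target.symm _ hψx (fderiv ℝ ψ x v) (secondFundamentalForm _ _ _ _ _ _)] at hderiv
    linarith
  linarith [hanti u v w, hsymm u w v, hanti w u v, hsymm w v u, hanti v w u, hsymm v u w]

end IsIsometricOn

namespace IsNormalFieldOn

variable (hH : IsNormalFieldOn G ψ H h U) (hψ : IsIsometricOn g G ψ U V) (hx : x ∈ U)

include hH hψ hx

lemma exists_basis {ι : Type*} [Finite ι] [DecidableEq ι] {e : Module.Basis ι ℝ E}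
    (he : IsOrthonormalFor (g x) e) :
    ∃ f : Module.Basis (Option ι) ℝ F, IsOrthonormalFor (G (ψ x)) f ∧
      (∀ i, f (some i) = fderiv ℝ ψ x (e i)) ∧ f none = h⁻¹ • H x := by
  have := Fintype.ofFinite ι
  let f : Option ι → F := fun o => o.elim (h⁻¹ • H x) fun i => fderiv ℝ ψ x (e i)
  have hh := hH.ne_zero
  have hf : IsOrthonormalFor (G (ψ x)) f := by
    rintro (_ | i) (_ | j)
    · simp only [f, Option.elim, map_smul, _root_.smul_apply, hH.norm_sq x hx, smul_eq_mul,
        if_true]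
      field_simp
    · simp [f, hH.normal x hx]
    · simp [f, hψ.target.symm _ (hψ.mapsTo x hx) _ (H x), hH.normal x hx]
    · simp [f, hψ.isometric x hx, he i j]
  have hli : LinearIndependent ℝ f := by
    rw [Fintype.linearIndependent_iff]
    intro c hc i
    simpa only [map_sum, map_smul, _root_.sum_apply, _root_.smul_apply, hf _ i, smul_eq_mul,
      mul_ite, mul_one, mul_zero, Finset.sum_ite_eq', Finset.mem_univ, if_true, map_zero,
      _root_.zero_apply] using congrArg (fun t => G (ψ x) t (f i)) hc
  refine ⟨basisOfLinearIndependentOfCardEqFinrank hli ?_, ?_, fun i => ?_, ?_⟩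
  · rw [Fintype.card_option, hH.codim_one, Module.finrank_eq_card_basis e]
  all_goals rw [coe_basisOfLinearIndependentOfCardEqFinrank]
  · exact hf
  · rfl
  · rfl

lemma inner_eq_sum {ι : Type*} [Fintype ι] [DecidableEq ι] {e : Module.Basis ι ℝ E}
    (he : IsOrthonormalFor (g x) e) (Y Z : F) :
    G (ψ x) Y Z = (h ^ 2)⁻¹ * (G (ψ x) Y (H x) * G (ψ x) (H x) Z)
      + ∑ i, G (ψ x) Y (fderiv ℝ ψ x (e i)) * G (ψ x) (fderiv ℝ ψ x (e i)) Z := by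
  obtain ⟨f, hf, hsome, hnone⟩ := hH.exists_basis hψ hx he
  rw [← hf.sum_inner_mul_inner, Fintype.sum_option]
  simp only [hsome, hnone, map_smul, _root_.smul_apply, smul_eq_mul]
  ring

variable [FiniteDimensional ℝ E]

lemma exists_eq_tangent_add_normal (Z : F) : ∃ (w : E) (a : ℝ), Z = fderiv ℝ ψ x w + a • H x := by
  obtain ⟨e, he⟩ := hψ.source.exists_orthonormal hx
  obtain ⟨f, -, hsome, hnone⟩ := hH.exists_basis hψ hx he
  refine ⟨∑ i, f.repr Z (some i) • e i, f.repr Z none * h⁻¹, ?_⟩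
  conv_lhs => rw [← f.sum_repr Z, Fintype.sum_option]
  simp only [hsome, hnone, map_sum, map_smul, smul_smul]
  rw [add_comm]

lemma inner_of_tangent_of_normal {Y Z : F} (hY : G (ψ x) Y (H x) = 0)
    (hZ : ∀ w, G (ψ x) Z (fderiv ℝ ψ x w) = 0) : G (ψ x) Y Z = 0 := by
  obtain ⟨e, he⟩ := hψ.source.exists_orthonormal hx
  rw [hH.inner_eq_sum hψ hx he, hY]
  simp [hψ.target.symm _ (hψ.mapsTo x hx) _ Z, hZ]

omit [FiniteDimensional ℝ E]

variable [FiniteDimensional ℝ F]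

lemma differentiableAt_covDeriv (v : E) : DifferentiableAt ℝ (fun y => covDeriv G ψ H y v) x :=
  differentiableAt_of_contDiffAt_infty
    (hψ.target.contDiffAt_covDeriv (hψ.mapsTo x hx) (hψ.smooth x hx) (hH.smooth x hx) v)

lemma inner_covDeriv_self (v : E) : G (ψ x) (covDeriv G ψ H x v) (H x) = 0 := by
  have hconst : (fun y => G (ψ y) (H y) (H y)) =ᶠ[nhds x] fun _ => h ^ 2 := by
    filter_upwards [hψ.source.isOpen.mem_nhds hx] with y hy using hH.norm_sq y hy
  have hdH := differentiableAt_of_contDiffAt_infty (hH.smooth x hx)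
  have hderiv := hψ.target.fderiv_inner_along (hψ.mapsTo x hx) (hψ.differentiableAt hx) hdH hdH v
  rw [hconst.fderiv_eq, fderiv_const_apply, _root_.zero_apply,
    hψ.target.symm _ (hψ.mapsTo x hx) (H x)] at hderiv
  linarith

lemma inner_covDeriv_tangent (v w : E) :
    G (ψ x) (covDeriv G ψ H x v) (fderiv ℝ ψ x w) = -shapeForm g G ψ H x v w := by
  have hconst : (fun y => G (ψ y) (H y) (fderiv ℝ ψ y w)) =ᶠ[nhds x] fun _ => 0 := by
    filter_upwards [hψ.source.isOpen.mem_nhds hx] with y hy using hH.normal y hy w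
  have hderiv := hψ.target.fderiv_inner_along (hψ.mapsTo x hx) (hψ.differentiableAt hx)
    (differentiableAt_of_contDiffAt_infty (hH.smooth x hx))
    (hψ.differentiableAt_fderiv_apply hx w) v
  rw [hconst.fderiv_eq, fderiv_const_apply, _root_.zero_apply,
    covDeriv_fderiv_apply (g := g), map_add, hH.normal x hx, add_zero,
    ← shapeForm_apply (hψ.smooth x hx)] at hderiv
  linarith

lemma inner_secondCovDeriv_self (v w : E) : G (ψ x) (secondCovDeriv g G ψ H x v w) (H x)
    = -G (ψ x) (covDeriv G ψ H x w) (covDeriv G ψ H x v) := by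
  have hconst : (fun y => G (ψ y) (covDeriv G ψ H y w) (H y)) =ᶠ[nhds x] fun _ => 0 := by
    filter_upwards [hψ.source.isOpen.mem_nhds hx] with y hy using hH.inner_covDeriv_self hψ hy w
  have hderiv := hψ.target.fderiv_inner_along (hψ.mapsTo x hx) (hψ.differentiableAt hx)
    (hH.differentiableAt_covDeriv hψ hx w)
    (differentiableAt_of_contDiffAt_infty (hH.smooth x hx)) v
  rw [hconst.fderiv_eq, fderiv_const_apply, _root_.zero_apply] at hderiv
  rw [secondCovDeriv, map_sub, _root_.sub_apply, hH.inner_covDeriv_self hψ hx]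
  linarith

variable [FiniteDimensional ℝ E]

lemma differentiableAt_shapeForm : DifferentiableAt ℝ (shapeForm g G ψ H) x := by
  have hGH : ContDiffAt ℝ ∞ (fun y => G (ψ y) (H y)) x :=
    ((hψ.target.smooth _ (hψ.mapsTo x hx)).comp x (hψ.smooth x hx)).clm_apply (hH.smooth x hx)
  have hcomp : ContDiffAt ℝ ∞ (fun y => ContinuousLinearMap.compL ℝ E F ℝ (G (ψ y) (H y))) x :=
    (ContinuousLinearMap.contDiff _).contDiffAt.comp x hGH
  exact differentiableAt_of_contDiffAt_infty (hcomp.clm_comp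
    (hψ.source.contDiffAt_covDerivHom hx hψ.target (hψ.mapsTo x hx) (hψ.smooth x hx)
      (contDiffAt_infty_fderiv (hψ.smooth x hx))))

lemma inner_secondCovDeriv_tangent (u v w : E) :
    G (ψ x) (secondCovDeriv g G ψ H x u v) (fderiv ℝ ψ x w)
      = -covDerivForm g (shapeForm g G ψ H) x u v w := by
  have hβ := hH.differentiableAt_shapeForm hψ hx
  have hweingarten : (fun y => G (ψ y) (covDeriv G ψ H y v) (fderiv ℝ ψ y w))
      =ᶠ[nhds x] fun y => -shapeForm g G ψ H y v w := by
    filter_upwards [hψ.source.isOpen.mem_nhds hx] with y hy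
      using hH.inner_covDeriv_tangent hψ hy v w
  have hderiv := hψ.target.fderiv_inner_along (hψ.mapsTo x hx) (hψ.differentiableAt hx)
    (hH.differentiableAt_covDeriv hψ hx v) (hψ.differentiableAt_fderiv_apply hx w) u
  rw [hweingarten.fderiv_eq, fderiv_fun_neg, _root_.neg_apply, fderiv_clm_apply₂_const hβ u v w,
    covDeriv_fderiv_apply (g := g), map_add,
    hH.inner_of_tangent_of_normal hψ hx (hH.inner_covDeriv_self hψ hx v)
      (hψ.inner_secondFundamentalForm_tangent hx u w),
    hH.inner_covDeriv_tangent hψ hx] at hderiv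
  rw [secondCovDeriv, map_sub, _root_.sub_apply, hH.inner_covDeriv_tangent hψ hx]
  simp only [covDerivForm, _root_.sub_apply, ContinuousLinearMap.bilinearComp_apply,
    ContinuousLinearMap.id_apply, christoffelCLM_apply]
  linarith

lemma inner_secondCovDeriv_tangent_symm (u v w : E) :
    G (ψ x) (secondCovDeriv g G ψ H x u v) (fderiv ℝ ψ x w)
      = G (ψ x) (secondCovDeriv g G ψ H x u w) (fderiv ℝ ψ x v) := by
  have hsymm := fderiv_clm_comm (hH.differentiableAt_shapeForm hψ hx)
    (Filter.eventually_of_mem (hψ.source.isOpen.mem_nhds hx) fun y hy => hψ.shapeForm_symm hy)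
    u v w
  rw [hH.inner_secondCovDeriv_tangent hψ hx, hH.inner_secondCovDeriv_tangent hψ hx]
  simp only [covDerivForm, _root_.sub_apply, ContinuousLinearMap.bilinearComp_apply,
    ContinuousLinearMap.id_apply, hsymm, hψ.shapeForm_symm hx v, hψ.shapeForm_symm hx w]
  ring

end IsNormalFieldOn

end IsometricImmersion

section Bitension

variable {d : ℕ} {F : Type*} [NormedAddCommGroup F] [NormedSpace ℝ F] [FiniteDimensional ℝ F]
  {g : EuclideanSpace ℝ (Fin d) →
    EuclideanSpace ℝ (Fin d) →L[ℝ] EuclideanSpace ℝ (Fin d) →L[ℝ] ℝ}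
  {G : F → F →L[ℝ] F →L[ℝ] ℝ} {U : Set (EuclideanSpace ℝ (Fin d))} {V : Set F}
  {ψ H : EuclideanSpace ℝ (Fin d) → F} {h : ℝ} {x : EuclideanSpace ℝ (Fin d)}
  {ι : Type*} [Fintype ι] [DecidableEq ι] {e : Module.Basis ι ℝ (EuclideanSpace ℝ (Fin d))}

omit [FiniteDimensional ℝ F] in
lemma tension_eq_smul_meanCurvature (hd : d ≠ 0) :
    tension g G ψ = fun y => (d : ℝ) • meanCurvature g G ψ y := by
  ext1 y
  rw [meanCurvature, smul_smul, mul_one_div_cancel (Nat.cast_ne_zero.2 hd), one_smul, tension]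

namespace IsIsometricOn

variable (hψ : IsIsometricOn g G ψ U V)

include hψ

lemma contDiffAt_meanCurvature (hx : x ∈ U) : ContDiffAt ℝ ∞ (meanCurvature g G ψ) x := by
  have hB := hψ.source.contDiffAt_covDerivHom hx hψ.target (hψ.mapsTo x hx) (hψ.smooth x hx)
    (contDiffAt_infty_fderiv (hψ.smooth x hx))
  have hcoord : meanCurvature g G ψ =ᶠ[nhds x] fun y => (1 / (d : ℝ)) • ∑ i : Fin d,
      covDerivHom g G ψ (fderiv ℝ ψ) y (sharp g y (EuclideanSpace.proj i))
        (EuclideanSpace.single i 1) := by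
    filter_upwards [hψ.source.isOpen.mem_nhds hx] with y hy
    simp only [meanCurvature, metricTrace, covDerivHom_fderiv (hψ.smooth y hy)]
  refine ContDiffAt.congr_of_eventuallyEq (.const_smul _ (.sum fun i _ => ?_)) hcoord
  exact (hB.clm_apply ((hψ.source.contDiffAt_sharp hx).clm_apply contDiffAt_const)).clm_apply
    contDiffAt_const

lemma meanCurvature_normal (hx : x ∈ U) (w : EuclideanSpace ℝ (Fin d)) :
    G (ψ x) (meanCurvature g G ψ x) (fderiv ℝ ψ x w) = 0 := by
  simp [meanCurvature, metricTrace, hψ.inner_secondFundamentalForm_tangent hx]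

lemma isNormalFieldOn_meanCurvature (hdim : Module.finrank ℝ F = d + 1) (hh : h ≠ 0)
    (hnorm : ∀ x ∈ U, G (ψ x) (meanCurvature g G ψ x) (meanCurvature g G ψ x) = h ^ 2) :
    IsNormalFieldOn G ψ (meanCurvature g G ψ) h U where
  codim_one := by simpa using hdim
  ne_zero := hh
  smooth _ hy := hψ.contDiffAt_meanCurvature hy
  normal _ hy := hψ.meanCurvature_normal hy
  norm_sq := hnorm

omit [FiniteDimensional ℝ F] in
lemma metricTrace_shapeForm (hd : d ≠ 0) (hx : x ∈ U) :
    metricTrace g x (fun u v => shapeForm g G ψ H x u v)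
      = d * G (ψ x) (H x) (meanCurvature g G ψ x) := by
  rw [← smul_eq_mul, ← map_smul, ← congrFun (tension_eq_smul_meanCurvature hd) x]
  simp only [shapeForm_apply (hψ.smooth x hx), metricTrace, tension, map_sum]

omit [FiniteDimensional ℝ F] in
lemma normSqSecondFundamentalForm_eq_sum (hx : x ∈ U) (he : IsOrthonormalFor (g x) e) :
    normSqSecondFundamentalForm g G ψ x = ∑ i, ∑ j,
      G (ψ x) (secondFundamentalForm g G ψ x (e i) (e j))
        (secondFundamentalForm g G ψ x (e i) (e j)) := by
  let B := covDerivHom g G ψ (fderiv ℝ ψ) x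
  have hinner : ∀ u u', metricTrace g x (fun v v' => G (ψ x) (B u v) (B u' v'))
      = ∑ j, G (ψ x) (B u (e j)) (B u' (e j)) := fun u u' =>
    hψ.source.metricTrace_eq_sum hx he ((G (ψ x)).bilinearComp (B u) (B u'))
  have houter : metricTrace g x (fun u u' => ∑ j, G (ψ x) (B u (e j)) (B u' (e j)))
      = ∑ i, ∑ j, G (ψ x) (B (e i) (e j)) (B (e i) (e j)) := by
    simpa using hψ.source.metricTrace_eq_sum hx he
      (∑ j, (G (ψ x)).bilinearComp (B.flip (e j)) (B.flip (e j)))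
  simp only [normSqSecondFundamentalForm, ← covDerivHom_fderiv (hψ.smooth x hx)]
  simp only [B] at hinner houter
  simp only [hinner, houter]

end IsIsometricOn

namespace IsNormalFieldOn

variable (hH : IsNormalFieldOn G ψ H h U) (hψ : IsIsometricOn g G ψ U V) (hx : x ∈ U)

include hH hψ hx

lemma normSqSecondFundamentalForm_mul_sq (he : IsOrthonormalFor (g x) e) :
    normSqSecondFundamentalForm g G ψ x * h ^ 2
      = ∑ i, G (ψ x) (covDeriv G ψ H x (e i)) (covDeriv G ψ H x (e i)) := by
  have hh := hH.ne_zero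
  have hsymm := hψ.target.symm _ (hψ.mapsTo x hx)
  have hnormal : ∀ u v, G (ψ x) (secondFundamentalForm g G ψ x u v)
      (secondFundamentalForm g G ψ x u v) * h ^ 2 = shapeForm g G ψ H x u v ^ 2 := fun u v => by
    rw [hH.inner_eq_sum hψ hx he, hsymm _ (H x), ← shapeForm_apply (hψ.smooth x hx)]
    simp only [hψ.inner_secondFundamentalForm_tangent hx, zero_mul, Finset.sum_const_zero,
      add_zero]
    field_simp
  have htangent : ∀ v, G (ψ x) (covDeriv G ψ H x v) (covDeriv G ψ H x v)
      = ∑ j, shapeForm g G ψ H x v (e j) ^ 2 := fun v => by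
    rw [hH.inner_eq_sum hψ hx he, hH.inner_covDeriv_self hψ hx]
    simp only [hsymm (fderiv ℝ ψ x _), hH.inner_covDeriv_tangent hψ hx, zero_mul, mul_zero,
      zero_add, neg_mul_neg, sq]
  simp only [hψ.normSqSecondFundamentalForm_eq_sum hx he, Finset.sum_mul, hnormal, htangent]

lemma ricci_eq_sum_tangent (he : IsOrthonormalFor (g x) e) (Z : F) : ricci G (ψ x) Z (H x)
      = ∑ i, G (ψ x) (curvature G (ψ x) (fderiv ℝ ψ x (e i)) Z (H x)) (fderiv ℝ ψ x (e i)) := by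
  have hV := hψ.mapsTo x hx
  have hD := hψ.target.isCurvatureLike hV
  obtain ⟨f, hf, hsome, hnone⟩ := hH.exists_basis hψ hx he
  have hself : G (ψ x) (curvature G (ψ x) (h⁻¹ • H x) Z (H x)) (H x) = 0 := by
    linarith [hD.skew (h⁻¹ • H x) Z (H x) (H x)]
  rw [hψ.target.ricci_eq_sum hV hf, Fintype.sum_option, hnone, map_smul, hself, smul_zero, zero_add]
  simp only [hsome]

/-- By Codazzi, the tangential part of the rough Laplacian of `H` is the divergence of its shape
form, which differs from the derivative of the (constant) trace by a Ricci curvature. -/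
lemma sum_inner_secondCovDeriv_tangent (he : IsOrthonormalFor (g x) e) {τ : ℝ}
    (htrace : ∀ y ∈ U, metricTrace g y (fun u v => shapeForm g G ψ H y u v) = τ)
    (w : EuclideanSpace ℝ (Fin d)) :
    ∑ i, G (ψ x) (secondCovDeriv g G ψ H x (e i) (e i)) (fderiv ℝ ψ x w)
      = ricci G (ψ x) (fderiv ℝ ψ x w) (H x) := by
  have hV := hψ.mapsTo x hx
  have hconst : ∑ i, G (ψ x) (secondCovDeriv g G ψ H x w (e i)) (fderiv ℝ ψ x (e i)) = 0 := by
    have hev : (fun y => metricTrace g y (fun u v => shapeForm g G ψ H y u v))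
        =ᶠ[nhds x] fun _ => τ := by
      filter_upwards [hψ.source.isOpen.mem_nhds hx] with y hy using htrace y hy
    have hderiv := hψ.source.fderiv_metricTrace hx (hH.differentiableAt_shapeForm hψ hx) w
    rw [hev.fderiv_eq, fderiv_const_apply, _root_.zero_apply,
      hψ.source.metricTrace_eq_sum hx he] at hderiv
    simp only [hH.inner_secondCovDeriv_tangent hψ hx, Finset.sum_neg_distrib, ← hderiv, neg_zero]
  rw [hH.ricci_eq_sum_tangent hψ hx he, ← sub_zero (∑ i, _), ← hconst, ← Finset.sum_sub_distrib]
  refine Finset.sum_congr rfl fun i _ => ?_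
  rw [hH.inner_secondCovDeriv_tangent_symm hψ hx, ← hψ.source.secondCovDeriv_sub_secondCovDeriv hx
    hψ.target hV (hψ.smooth x hx) (hH.smooth x hx), map_sub, _root_.sub_apply]

end IsNormalFieldOn

namespace IsIsometricOn

variable (hψ : IsIsometricOn g G ψ U V) (hd : d ≠ 0) (hx : x ∈ U)
  (hH : IsNormalFieldOn G ψ (meanCurvature g G ψ) h U)

include hψ hd hx hH

lemma inner_bitension (he : IsOrthonormalFor (g x) e) (Z : F) :
    G (ψ x) (bitension g G ψ x) Z
      = d * (∑ i, G (ψ x) (secondCovDeriv g G ψ (meanCurvature g G ψ) x (e i) (e i)) Z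
        + ricci G (ψ x) Z (meanCurvature g G ψ x)) := by
  have hV := hψ.mapsTo x hx
  have hD := hψ.target.isCurvatureLike hV
  set H := meanCurvature g G ψ
  have hlaplacian : metricTrace g x (secondCovDeriv g G ψ (fun y => (d : ℝ) • H y) x)
      = (d : ℝ) • ∑ i, secondCovDeriv g G ψ H x (e i) (e i) := by
    have htrace := hψ.source.metricTrace_eq_sum hx he
      ((d : ℝ) • covDerivHom g G ψ (covDerivCLM G ψ H) x)
    simp only [_root_.smul_apply, hψ.target.covDerivHom_covDerivCLM hV (hψ.smooth x hx)
      (hH.smooth x hx), ← hψ.target.secondCovDeriv_const_smul hV (hψ.smooth x hx)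
      (hH.smooth x hx)] at htrace
    simp only [Finset.smul_sum, ← hψ.target.secondCovDeriv_const_smul hV (hψ.smooth x hx)
      (hH.smooth x hx)]
    exact htrace
  have hcurvature : metricTrace g x (fun u v =>
        curvature G (ψ x) (fderiv ℝ ψ x u) ((d : ℝ) • H x) (fderiv ℝ ψ x v))
      = (d : ℝ) • ∑ i, curvature G (ψ x) (fderiv ℝ ψ x (e i)) (H x) (fderiv ℝ ψ x (e i)) := by
    have htrace := hψ.source.metricTrace_eq_sum hx he (((curvatureCLM G (ψ x)).flip
      ((d : ℝ) • H x)).bilinearComp (fderiv ℝ ψ x) (fderiv ℝ ψ x))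
    simp only [ContinuousLinearMap.bilinearComp_apply, ContinuousLinearMap.flip_apply,
      hψ.target.curvatureCLM_apply hV] at htrace
    rw [htrace]
    simp [← hψ.target.curvatureCLM_apply hV, Finset.smul_sum]
  rw [bitension, tension_eq_smul_meanCurvature hd, hlaplacian, hcurvature, ← smul_sub,
    ← Finset.sum_sub_distrib, hH.ricci_eq_sum_tangent hψ hx he]
  simp only [map_smul, map_sub, map_sum, _root_.smul_apply, _root_.sub_apply, _root_.sum_apply,
    smul_eq_mul, ← Finset.sum_add_distrib]
  refine congrArg _ (Finset.sum_congr rfl fun i _ => ?_)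
  linarith [hD.skew (fderiv ℝ ψ x (e i)) (H x) (fderiv ℝ ψ x (e i)) Z,
    hD.swap_mid (fderiv ℝ ψ x (e i)) (H x) Z]

lemma inner_bitension_tangent (w : EuclideanSpace ℝ (Fin d)) :
    G (ψ x) (bitension g G ψ x) (fderiv ℝ ψ x w)
      = d * (2 * ricci G (ψ x) (fderiv ℝ ψ x w) (meanCurvature g G ψ x)) := by
  obtain ⟨e, he⟩ := hψ.source.exists_orthonormal hx
  have htrace : ∀ y ∈ U, metricTrace g y
      (fun u v => shapeForm g G ψ (meanCurvature g G ψ) y u v) = d * h ^ 2 := fun y hy => by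
    rw [hψ.metricTrace_shapeForm hd hy, hH.norm_sq y hy]
  rw [hψ.inner_bitension hd hx hH he, hH.sum_inner_secondCovDeriv_tangent hψ hx he htrace]
  ring

lemma inner_bitension_meanCurvature :
    G (ψ x) (bitension g G ψ x) (meanCurvature g G ψ x)
      = d * (ricci G (ψ x) (meanCurvature g G ψ x) (meanCurvature g G ψ x)
        - normSqSecondFundamentalForm g G ψ x * h ^ 2) := by
  obtain ⟨e, he⟩ := hψ.source.exists_orthonormal hx
  rw [hψ.inner_bitension hd hx hH he, hH.normSqSecondFundamentalForm_mul_sq hψ hx he]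
  simp only [hH.inner_secondCovDeriv_self hψ hx, Finset.sum_neg_distrib]
  ring

theorem bitension_eq_zero_iff : bitension g G ψ x = 0 ↔
    ∀ Z, ricci G (ψ x) Z (meanCurvature g G ψ x)
      = normSqSecondFundamentalForm g G ψ x * G (ψ x) (meanCurvature g G ψ x) Z := by
  have hd' : (d : ℝ) ≠ 0 := Nat.cast_ne_zero.2 hd
  have htan := hψ.inner_bitension_tangent hd hx hH
  have hnor := hψ.inner_bitension_meanCurvature hd hx hH
  constructor
  · intro hzero Z
    obtain ⟨w, a, rfl⟩ := hH.exists_eq_tangent_add_normal hψ hx Z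
    have hric := htan w
    simp only [hzero, map_zero, _root_.zero_apply, zero_eq_mul, hd', false_or, mul_eq_zero,
      OfNat.ofNat_ne_zero, sub_eq_zero] at hric hnor
    rw [ricci_add_left, ricci_smul_left, hric, hnor, map_add, map_smul, hH.normal x hx,
      hH.norm_sq x hx, smul_eq_mul]
    ring
  · intro hric
    refine hψ.target.eq_of_forall_inner (hψ.mapsTo x hx) fun Z => ?_
    obtain ⟨w, a, rfl⟩ := hH.exists_eq_tangent_add_normal hψ hx Z
    simp [htan, hnor, hric, hH.normal x hx, hH.norm_sq x hx]

end IsIsometricOn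

end Bitension

section Hessian

variable {F : Type*} [NormedAddCommGroup F] [NormedSpace ℝ F] {G : F → F →L[ℝ] F →L[ℝ] ℝ}
  {f : F → ℝ} {V : Set F} {x : F}

/-- The covariant Hessian `D²f(u, v) - df(Γ(u, v))` of a function. -/
def hessian (G : F → F →L[ℝ] F →L[ℝ] ℝ) (f : F → ℝ) (x u v : F) : ℝ :=
  fderiv ℝ (fderiv ℝ f) x u v - fderiv ℝ f x (christoffel G x u v)

namespace IsMetricOn

variable (hG : IsMetricOn G V) (hx : x ∈ V)

include hG hx

lemma hessian_symm (hf : ContDiffAt ℝ ∞ f x) (u v : F) :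
    hessian G f x u v = hessian G f x v u := by
  rw [hessian, hessian, hG.christoffel_symm hx, fderiv_fderiv_comm hf]

variable [FiniteDimensional ℝ F]

lemma inner_gradient (v : F) : G x (gradient G f x) v = fderiv ℝ f x v :=
  hG.inner_sharp hx _ v

lemma inner_covDeriv_gradient (hf : ContDiffAt ℝ ∞ f x) (u v : F) :
    G x (covDeriv G id (gradient G f) x u) v = hessian G f x u v := by
  have hgrad : DifferentiableAt ℝ (gradient G f) x := differentiableAt_of_contDiffAt_infty
    ((hG.contDiffAt_sharp hx).clm_apply (contDiffAt_infty_fderiv hf))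
  have hpair : (fun y => G (id y) (gradient G f y) v) =ᶠ[nhds x] fun y => fderiv ℝ f y v := by
    filter_upwards [hG.isOpen.mem_nhds hx] with y hy using hG.inner_gradient hy v
  have hleibniz := hG.fderiv_inner_along (ψ := id) hx differentiableAt_id hgrad
    (differentiableAt_const v) u
  have hconst : covDeriv G id (fun _ => v) x u = christoffel G x u v := by simp [covDeriv]
  rw [hpair.fderiv_eq, hconst, id_eq x, hG.inner_gradient hx,
    fderiv_clm_apply_const (differentiableAt_of_contDiffAt_infty (contDiffAt_infty_fderiv hf))]
    at hleibniz
  rw [hessian]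
  linarith

end IsMetricOn

end Hessian

section Warped

lemma contDiffAt_of_apply {E F W : Type*} [NormedAddCommGroup E] [NormedSpace ℝ E]
    [NormedAddCommGroup F] [NormedSpace ℝ F] [FiniteDimensional ℝ F]
    [NormedAddCommGroup W] [NormedSpace ℝ W] {V : Set E} (hV : IsOpen V) {A : E → F →L[ℝ] W}
    (h : ∀ u, ∀ x ∈ V, ContDiffAt ℝ ∞ (fun y => A y u) x) {x : E} (hx : x ∈ V) :
    ContDiffAt ℝ ∞ A x := by
  have : ContDiffOn ℝ ∞ A V :=
    contDiffOn_clm_apply.mpr fun u y hy => (h u y hy).contDiffWithinAt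
  exact this.contDiffAt (hV.mem_nhds hx)

lemma trace_prod_eq {𝕜 V W : Type*} [Field 𝕜] [AddCommGroup V] [Module 𝕜 V] [AddCommGroup W]
    [Module 𝕜 W] [FiniteDimensional 𝕜 V] [FiniteDimensional 𝕜 W] (A : V × W →ₗ[𝕜] V × W) :
    LinearMap.trace 𝕜 (V × W) A
      = LinearMap.trace 𝕜 V (LinearMap.fst 𝕜 V W ∘ₗ A ∘ₗ LinearMap.inl 𝕜 V W)
        + LinearMap.trace 𝕜 W (LinearMap.snd 𝕜 V W ∘ₗ A ∘ₗ LinearMap.inr 𝕜 V W) := by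
  have hsplit : A = (A ∘ₗ LinearMap.inl 𝕜 V W) ∘ₗ LinearMap.fst 𝕜 V W
      + (A ∘ₗ LinearMap.inr 𝕜 V W) ∘ₗ LinearMap.snd 𝕜 V W := by
    ext1 <;> ext u : 1 <;> simp [← Prod.zero_eq_mk]
  conv_lhs => rw [hsplit]
  rw [map_add, LinearMap.trace_comp_comm' (LinearMap.fst 𝕜 V W),
    LinearMap.trace_comp_comm' (LinearMap.snd 𝕜 V W)]

variable {E₁ E₂ : Type*} [NormedAddCommGroup E₁] [NormedSpace ℝ E₁]
  [NormedAddCommGroup E₂] [NormedSpace ℝ E₂]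
  {G₁ : E₁ → E₁ →L[ℝ] E₁ →L[ℝ] ℝ} {G₂ : E₂ → E₂ →L[ℝ] E₂ →L[ℝ] ℝ} {f : E₁ → ℝ}
  {G : E₁ × E₂ → (E₁ × E₂) →L[ℝ] (E₁ × E₂) →L[ℝ] ℝ} {V₁ : Set E₁} {V₂ : Set E₂}

/-- In coordinates, `G` is the warped product metric `G₁ + f² G₂` on `V₁ × V₂`. -/
structure IsWarpedOn (G : E₁ × E₂ → (E₁ × E₂) →L[ℝ] (E₁ × E₂) →L[ℝ] ℝ)
    (G₁ : E₁ → E₁ →L[ℝ] E₁ →L[ℝ] ℝ) (G₂ : E₂ → E₂ →L[ℝ] E₂ →L[ℝ] ℝ) (f : E₁ → ℝ)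
    (V₁ : Set E₁) (V₂ : Set E₂) : Prop where
  metric₁ : IsMetricOn G₁ V₁
  metric₂ : IsMetricOn G₂ V₂
  smooth : ∀ x ∈ V₁, ContDiffAt ℝ ∞ f x
  pos : ∀ x ∈ V₁, 0 < f x
  apply : ∀ z ∈ V₁ ×ˢ V₂, ∀ u v, G z u v = G₁ z.1 u.1 v.1 + f z.1 ^ 2 * G₂ z.2 u.2 v.2

namespace IsWarpedOn

variable (hw : IsWarpedOn G G₁ G₂ f V₁ V₂)

include hw

lemma isOpen : IsOpen (V₁ ×ˢ V₂) :=
  hw.metric₁.isOpen.prod hw.metric₂.isOpen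

variable {z : E₁ × E₂} (hz : z ∈ V₁ ×ˢ V₂)

include hz

lemma eventuallyEq_apply (u v : E₁ × E₂) : (fun y => G y u v) =ᶠ[nhds z]
    fun y => G₁ y.1 u.1 v.1 + f y.1 ^ 2 * G₂ y.2 u.2 v.2 := by
  filter_upwards [hw.isOpen.mem_nhds hz] with y hy using hw.apply y hy u v

lemma contDiffAt_comp_fst : ContDiffAt ℝ ∞ (fun y : E₁ × E₂ => f y.1) z :=
  (hw.smooth z.1 hz.1).comp z contDiffAt_fst

lemma hasFDerivAt_comp_fst : HasFDerivAt (fun y : E₁ × E₂ => f y.1)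
    ((fderiv ℝ f z.1).comp (ContinuousLinearMap.fst ℝ E₁ E₂)) z :=
  (differentiableAt_of_contDiffAt_infty (hw.smooth z.1 hz.1)).hasFDerivAt.comp z hasFDerivAt_fst

lemma contDiffAt_apply (u v : E₁ × E₂) : ContDiffAt ℝ ∞ (fun y => G y u v) z := by
  refine ContDiffAt.congr_of_eventuallyEq ?_ (hw.eventuallyEq_apply hz u v)
  have h₁ : ContDiffAt ℝ ∞ (fun y : E₁ × E₂ => G₁ y.1) z :=
    (hw.metric₁.smooth z.1 hz.1).comp z contDiffAt_fst
  have h₂ : ContDiffAt ℝ ∞ (fun y : E₁ × E₂ => G₂ y.2) z :=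
    (hw.metric₂.smooth z.2 hz.2).comp z contDiffAt_snd
  exact ((h₁.clm_apply contDiffAt_const).clm_apply contDiffAt_const).add
    (((hw.contDiffAt_comp_fst hz).pow 2).mul
      ((h₂.clm_apply contDiffAt_const).clm_apply contDiffAt_const))

lemma pos_apply_self {u : E₁ × E₂} (hu : u ≠ 0) : 0 < G z u u := by
  have hf := pow_pos (hw.pos z.1 hz.1) 2
  rw [hw.apply z hz]
  by_cases h₁ : u.1 = 0
  · have h₂ : u.2 ≠ 0 := fun h₂ => hu (Prod.ext h₁ h₂)
    simpa [h₁] using mul_pos hf (hw.metric₂.pos z.2 hz.2 _ h₂)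
  · exact add_pos_of_pos_of_nonneg (hw.metric₁.pos z.1 hz.1 _ h₁)
      (mul_nonneg hf.le (hw.metric₂.nonneg hz.2 _))

omit hz in
lemma isMetricOn [FiniteDimensional ℝ E₁] [FiniteDimensional ℝ E₂] : IsMetricOn G (V₁ ×ˢ V₂) where
  isOpen := hw.isOpen
  smooth _ hz := contDiffAt_of_apply hw.isOpen (fun u _ hy => contDiffAt_of_apply hw.isOpen
    (fun v _ hy' => hw.contDiffAt_apply hy' u v) hy) hz
  symm z hz u v := by
    rw [hw.apply z hz, hw.apply z hz, hw.metric₁.symm _ hz.1, hw.metric₂.symm _ hz.2]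
  pos _ hz _ hu := hw.pos_apply_self hz hu

/-- The logarithmic derivative of `f` is the coefficient of the mixed Christoffel symbols; its own
derivative produces the Hessian in the curvature. -/
lemma hasFDerivAt_fderiv_div (X : E₁) : HasFDerivAt (fun x => fderiv ℝ f x X / f x)
    ((1 / f z.1) • ((fderiv ℝ (fderiv ℝ f) z.1).flip X
      - (fderiv ℝ f z.1 X / f z.1) • fderiv ℝ f z.1)) z.1 := by
  have hf := hw.smooth z.1 hz.1
  have hne := (hw.pos z.1 hz.1).ne'
  have hnum := (differentiableAt_of_contDiffAt_infty (contDiffAt_infty_fderiv hf)).hasFDerivAt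
    |>.clm_apply (hasFDerivAt_const X z.1)
  have hinv := (hasDerivAt_inv hne).comp_hasFDerivAt z.1
    (differentiableAt_of_contDiffAt_infty hf).hasFDerivAt
  refine ((hnum.mul hinv).congr_fderiv ?_).congr_of_eventuallyEq (.of_forall fun _ => ?_)
  · ext a
    simp
    field_simp
    ring
  · exact div_eq_mul_inv _ _

variable [FiniteDimensional ℝ E₁] [FiniteDimensional ℝ E₂]

lemma fderiv_apply (u v w : E₁ × E₂) : fderiv ℝ G z u v w
    = fderiv ℝ G₁ z.1 u.1 v.1 w.1 + 2 * f z.1 * fderiv ℝ f z.1 u.1 * G₂ z.2 v.2 w.2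
      + f z.1 ^ 2 * fderiv ℝ G₂ z.2 u.2 v.2 w.2 := by
  have h₁ := (hw.metric₁.differentiableAt hz.1).hasFDerivAt.comp z hasFDerivAt_fst
  have h₂ := (hw.metric₂.differentiableAt hz.2).hasFDerivAt.comp z hasFDerivAt_snd
  have hderiv := ((h₁.clm_apply (hasFDerivAt_const v.1 z)).clm_apply
    (hasFDerivAt_const w.1 z)).add (((hw.hasFDerivAt_comp_fst hz).pow 2).mul
      ((h₂.clm_apply (hasFDerivAt_const v.2 z)).clm_apply (hasFDerivAt_const w.2 z)))
  rw [← fderiv_clm_apply₂_const (hw.isMetricOn.differentiableAt hz),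
    (hw.eventuallyEq_apply hz v w).fderiv_eq]
  refine (congrArg (fun L : E₁ × E₂ →L[ℝ] ℝ => L u) hderiv.fderiv).trans ?_
  simp
  ring

lemma christoffel_eq (u v : E₁ × E₂) : christoffel G z u v
    = (christoffel G₁ z.1 u.1 v.1 - (f z.1 * G₂ z.2 u.2 v.2) • gradient G₁ f z.1,
        christoffel G₂ z.2 u.2 v.2 + (fderiv ℝ f z.1 u.1 / f z.1) • v.2
          + (fderiv ℝ f z.1 v.1 / f z.1) • u.2) := by
  refine hw.isMetricOn.eq_of_forall_inner hz fun w => ?_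
  have hf := (hw.pos z.1 hz.1).ne'
  rw [hw.isMetricOn.inner_christoffel hz, hw.apply z hz]
  simp only [map_sub, map_add, map_smul, _root_.sub_apply, _root_.add_apply,
    _root_.smul_apply, hw.metric₁.inner_christoffel hz.1, hw.metric₂.inner_christoffel hz.2,
    hw.metric₁.inner_gradient hz.1, koszul_apply, smul_eq_mul, hw.fderiv_apply hz]
  field_simp
  ring

lemma covDeriv_horizontal (v : E₁ × E₂) (X : E₁) :
    covDeriv G id (fun _ => (X, 0)) z v
      = (christoffelCLM G₁ z.1 v.1 X, (fderiv ℝ f z.1 X / f z.1) • v.2) := by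
  simp only [covDeriv, fderiv_fun_const, fderiv_id, Pi.zero_apply, _root_.zero_apply, id,
    ContinuousLinearMap.id_apply, zero_add]
  rw [hw.christoffel_eq hz]
  simp [← christoffelCLM_apply]

lemma covDeriv_covDeriv_horizontal (u v : E₁ × E₂) (X : E₁) :
    covDeriv G id (fun y => covDeriv G id (fun _ => (X, 0)) y v) z u
      = (covDeriv G₁ id (fun y => covDeriv G₁ id (fun _ => X) y v.1) z.1 u.1
          - (fderiv ℝ f z.1 X * G₂ z.2 u.2 v.2) • gradient G₁ f z.1,
        (fderiv ℝ f z.1 X / f z.1) • christoffel G₂ z.2 u.2 v.2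
          + (1 / f z.1) • (fderiv ℝ (fderiv ℝ f) z.1 u.1 X • v.2
            + fderiv ℝ f z.1 (christoffel G₁ z.1 v.1 X) • u.2)) := by
  have hne := (hw.pos z.1 hz.1).ne'
  have hinner : (fun y => covDeriv G id (fun _ => (X, 0)) y v) =ᶠ[nhds z]
      fun y => (christoffelCLM G₁ y.1 v.1 X, (fderiv ℝ f y.1 X / f y.1) • v.2) := by
    filter_upwards [hw.isOpen.mem_nhds hz] with y hy using hw.covDeriv_horizontal hy v X
  have hΓ : DifferentiableAt ℝ (fun x => christoffelCLM G₁ x v.1 X) z.1 :=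
    ((hw.metric₁.differentiableAt_christoffelCLM hz.1).clm_apply
      (differentiableAt_const _)).clm_apply (differentiableAt_const _)
  have hbase : HasFDerivAt (fun y : E₁ × E₂ => christoffelCLM G₁ y.1 v.1 X)
      ((fderiv ℝ (fun x => christoffelCLM G₁ x v.1 X) z.1).comp
        (ContinuousLinearMap.fst ℝ E₁ E₂)) z := hΓ.hasFDerivAt.comp z hasFDerivAt_fst
  have hfibre : HasFDerivAt (fun y : E₁ × E₂ => (fderiv ℝ f y.1 X / f y.1) • v.2) _ z :=
    ((hw.hasFDerivAt_fderiv_div hz X).comp z hasFDerivAt_fst).smul_const v.2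
  rw [covDeriv_congr hinner, covDeriv, (hbase.prodMk hfibre).fderiv, id_eq z, hw.christoffel_eq hz]
  simp only [covDeriv, fderiv_fun_const, fderiv_id, Pi.zero_apply, _root_.zero_apply, id,
    ContinuousLinearMap.id_apply, zero_add, christoffelCLM_apply]
  ext1
  · simp [← christoffelCLM_apply, smul_smul]
    field_simp
    abel
  · simp [← christoffelCLM_apply]
    module

lemma curvature_horizontal (u v : E₁ × E₂) (X : E₁) : curvature G z u v (X, 0)
    = (curvature G₁ z.1 u.1 v.1 X, (1 / f z.1) • (hessian G₁ f z.1 u.1 X • v.2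
        - hessian G₁ f z.1 v.1 X • u.2)) := by
  rw [curvature, hw.covDeriv_covDeriv_horizontal hz, hw.covDeriv_covDeriv_horizontal hz, curvature,
    hw.metric₂.symm _ hz.2 v.2 u.2, hw.metric₂.christoffel_symm hz.2 v.2 u.2,
    hw.metric₁.christoffel_symm hz.1 v.1 X, hw.metric₁.christoffel_symm hz.1 u.1 X]
  ext1
  · simp
  · simp only [Prod.snd_sub, hessian, hw.metric₁.christoffel_symm hz.1 X]
    module

lemma ricci_horizontal (Z : E₁ × E₂) (X : E₁) : ricci G z Z (X, 0)
    = ricci G₁ z.1 Z.1 X - (Module.finrank ℝ E₂ / f z.1) * hessian G₁ f z.1 Z.1 X := by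
  set A : (E₁ × E₂) →ₗ[ℝ] (E₁ × E₂) :=
    ↑(((curvatureCLM G z).flip Z).flip (X, 0)) with hA
  have hA' : ∀ u, A u = curvature G z u Z (X, 0) := fun u => by
    simp [hA, hw.isMetricOn.curvatureCLM_apply hz]
  have hbase : LinearMap.fst ℝ E₁ E₂ ∘ₗ A ∘ₗ LinearMap.inl ℝ E₁ E₂
      = ((curvatureCLM G₁ z.1).flip Z.1).flip X := by
    ext u
    simp [hA', hw.curvature_horizontal hz, hw.metric₁.curvatureCLM_apply hz.1]
  have hfibre : LinearMap.snd ℝ E₁ E₂ ∘ₗ A ∘ₗ LinearMap.inr ℝ E₁ E₂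
      = (-(hessian G₁ f z.1 Z.1 X / f z.1)) • LinearMap.id := by
    have hzero : hessian G₁ f z.1 0 X = 0 := by simp [hessian, ← christoffelCLM_apply]
    ext u
    simp only [LinearMap.comp_apply, LinearMap.inr_apply, LinearMap.snd_apply, hA',
      hw.curvature_horizontal hz, LinearMap.smul_apply, LinearMap.id_apply, hzero]
    module
  rw [ricci, ← hA, trace_prod_eq, hbase, hfibre, map_smul, LinearMap.trace_id, smul_eq_mul, ricci]
  ring

lemma hessian_comp_fst (u : E₁) (v : E₁ × E₂) :
    hessian G (fun y => f y.1) z (u, 0) v = hessian G₁ f z.1 u v.1 := by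
  have hf := contDiffAt_infty_fderiv (hw.contDiffAt_comp_fst hz)
  have hfst : (fun y : E₁ × E₂ => fderiv ℝ (fun y : E₁ × E₂ => f y.1) y v) =ᶠ[nhds z]
      fun y => fderiv ℝ f y.1 v.1 := by
    filter_upwards [hw.isOpen.mem_nhds hz] with y hy
    rw [(hw.hasFDerivAt_comp_fst hy).fderiv]
    rfl
  have hsecond : HasFDerivAt (fun y : E₁ × E₂ => fderiv ℝ f y.1 v.1) _ z :=
    ((differentiableAt_of_contDiffAt_infty (contDiffAt_infty_fderiv
    (hw.smooth z.1 hz.1))).hasFDerivAt.clm_apply (hasFDerivAt_const v.1 z.1)).comp z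
      hasFDerivAt_fst
  rw [hessian, ← fderiv_clm_apply_const (differentiableAt_of_contDiffAt_infty hf),
    hfst.fderiv_eq, (hw.hasFDerivAt_comp_fst hz).fderiv, hw.christoffel_eq hz,
    hsecond.fderiv]
  simp [hessian]

end IsWarpedOn

end Warped

section CovDeriv

variable {E F : Type*} [NormedAddCommGroup E] [NormedSpace ℝ E]
  [NormedAddCommGroup F] [NormedSpace ℝ F] {g : E → E →L[ℝ] E →L[ℝ] ℝ}
  {G : F → F →L[ℝ] F →L[ℝ] ℝ} {ψ X Y : E → F} {x : E}

lemma covDeriv_add (hX : DifferentiableAt ℝ X x) (hY : DifferentiableAt ℝ Y x) (u : E) :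
    covDeriv G ψ (fun y => X y + Y y) x u = covDeriv G ψ X x u + covDeriv G ψ Y x u := by
  simp only [covDeriv, ← christoffelCLM_apply, fderiv_fun_add hX hY, map_add, _root_.add_apply]
  abel

lemma covDeriv_sub (hX : DifferentiableAt ℝ X x) (hY : DifferentiableAt ℝ Y x) (u : E) :
    covDeriv G ψ (fun y => X y - Y y) x u = covDeriv G ψ X x u - covDeriv G ψ Y x u := by
  simp only [covDeriv, ← christoffelCLM_apply, fderiv_fun_sub hX hY, map_sub, _root_.sub_apply]
  abel

lemma covDeriv_smul {a : E → ℝ} (ha : DifferentiableAt ℝ a x) (hX : DifferentiableAt ℝ X x)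
    (u : E) : covDeriv G ψ (fun y => a y • X y) x u
      = fderiv ℝ a x u • X x + a x • covDeriv G ψ X x u := by
  simp only [covDeriv, ← christoffelCLM_apply, fderiv_fun_smul ha hX, map_smul, _root_.add_apply,
    _root_.smul_apply, ContinuousLinearMap.smulRight_apply, smul_add]
  abel

lemma covDeriv_id_const (g : E → E →L[ℝ] E →L[ℝ] ℝ) (x u v : E) :
    covDeriv g id (fun _ => v) x u = christoffelCLM g x u v := by
  simp [covDeriv, christoffelCLM_apply]

end CovDeriv

section Sasakian

variable {E : Type*} [NormedAddCommGroup E] [NormedSpace ℝ E]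
  {g : E → E →L[ℝ] E →L[ℝ] ℝ} {φ : E → E →L[ℝ] E} {ξ : E → E} {η : E → E →L[ℝ] ℝ} {U : Set E}

/-- A Sasakian structure, in coordinates, on the set `U`. -/
structure IsSasakianOn (g : E → E →L[ℝ] E →L[ℝ] ℝ) (φ : E → E →L[ℝ] E) (ξ : E → E)
    (η : E → E →L[ℝ] ℝ) (U : Set E) : Prop where
  metric : IsMetricOn g U
  smooth_φ : ∀ x ∈ U, ContDiffAt ℝ ∞ φ x
  smooth_ξ : ∀ x ∈ U, ContDiffAt ℝ ∞ ξ x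
  smooth_η : ∀ x ∈ U, ContDiffAt ℝ ∞ η x
  φ_sq : ∀ x ∈ U, ∀ u, φ x (φ x u) = -u + η x u • ξ x
  η_ξ : ∀ x ∈ U, η x (ξ x) = 1
  η_φ : ∀ x ∈ U, ∀ u, η x (φ x u) = 0
  η_eq : ∀ x ∈ U, ∀ u, η x u = g x (ξ x) u
  compatible : ∀ x ∈ U, ∀ u v, g x (φ x u) (φ x v) = g x u v - η x u * η x v
  contact : ∀ x ∈ U, ∀ X Y : E → E, ContDiff ℝ ∞ X → ContDiff ℝ ∞ Y →
    g x (X x) (φ x (Y x)) = extDeriv η X Y x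
  normal : ∀ x ∈ U, ∀ X Y : E → E, ContDiff ℝ ∞ X → ContDiff ℝ ∞ Y →
    nijenhuis φ X Y x + (2 * extDeriv η X Y x) • ξ x = 0

namespace IsSasakianOn

variable (hS : IsSasakianOn g φ ξ η U) {x : E} (hx : x ∈ U)

include hS hx

lemma differentiableAt_φ : DifferentiableAt ℝ φ x :=
  differentiableAt_of_contDiffAt_infty (hS.smooth_φ x hx)

lemma differentiableAt_ξ : DifferentiableAt ℝ ξ x :=
  differentiableAt_of_contDiffAt_infty (hS.smooth_ξ x hx)

lemma differentiableAt_η : DifferentiableAt ℝ η x :=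
  differentiableAt_of_contDiffAt_infty (hS.smooth_η x hx)

lemma inner_φ_left (u v : E) : g x (φ x u) v = -g x u (φ x v) := by
  have h := hS.compatible x hx (φ x u) v
  rw [hS.φ_sq x hx, hS.η_φ x hx] at h
  simp only [map_add, map_neg, map_smul, _root_.add_apply, _root_.neg_apply, _root_.smul_apply,
    ← hS.η_eq x hx, hS.η_φ x hx, smul_eq_mul] at h
  linarith

lemma inner_φ_swap (u v : E) : g x u (φ x v) = -g x v (φ x u) := by
  rw [hS.metric.symm x hx u, hS.inner_φ_left hx]

lemma inner_φ_self (u : E) : g x u (φ x u) = 0 := by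
  linarith [hS.inner_φ_swap hx u u]

lemma inner_φ_φ (u v : E) : g x u (φ x (φ x v)) = -g x u v + η x u * η x v := by
  linarith [hS.inner_φ_left hx u (φ x v), hS.compatible x hx u v]

lemma φ_ξ : φ x (ξ x) = 0 := by
  refine hS.metric.eq_zero_of_inner_self hx ?_
  rw [hS.compatible x hx, ← hS.η_eq x hx, hS.η_ξ x hx]
  ring

lemma fderiv_η_sub (u v : E) : fderiv ℝ η x u v - fderiv ℝ η x v u = 2 * g x u (φ x v) := by
  have h := hS.contact x hx (fun _ => u) (fun _ => v) contDiff_const contDiff_const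
  rw [extDeriv, fderiv_clm_apply_const (hS.differentiableAt_η hx),
    fderiv_clm_apply_const (hS.differentiableAt_η hx)] at h
  simp [VectorField.lieBracket] at h
  linarith

lemma fderiv_φ_normal (u v : E) :
    fderiv ℝ φ x (φ x u) v - fderiv ℝ φ x (φ x v) u + φ x (fderiv ℝ φ x v u)
      - φ x (fderiv ℝ φ x u v) + (2 * g x u (φ x v)) • ξ x = 0 := by
  have h := hS.normal x hx (fun _ => u) (fun _ => v) contDiff_const contDiff_const
  rw [← hS.contact x hx (fun _ => u) (fun _ => v) contDiff_const contDiff_const] at h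
  simpa [nijenhuis, VectorField.lieBracket, fderiv_clm_apply_const (hS.differentiableAt_φ hx)]
    using h

lemma covDerivHom_φ_normal (u v : E) :
    covDerivHom g g id φ x (φ x u) v - covDerivHom g g id φ x (φ x v) u
      + φ x (covDerivHom g g id φ x v u) - φ x (covDerivHom g g id φ x u v)
      + (2 * g x u (φ x v)) • ξ x = 0 := by
  rw [← hS.fderiv_φ_normal hx u v]
  simp only [covDerivHom_apply (hS.differentiableAt_φ hx), covDeriv,
    fderiv_clm_apply_const (hS.differentiableAt_φ hx), fderiv_id, id, ContinuousLinearMap.id_apply,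
    map_add, map_sub]
  rw [hS.metric.christoffel_symm hx (φ x v) (φ x u), hS.metric.christoffel_symm hx (φ x v) u,
    hS.metric.christoffel_symm hx v (φ x u), hS.metric.christoffel_symm hx v u]
  abel

lemma covDerivHom_φ_ξ (u : E) :
    covDerivHom g g id φ x u (ξ x) = -φ x (covDerivCLM g id ξ x u) := by
  have hφξ : (fun y => φ y (ξ y)) =ᶠ[nhds x] fun _ => 0 := by
    filter_upwards [hS.metric.isOpen.mem_nhds hx] with y hy using hS.φ_ξ hy
  have h := covDeriv_clm_apply (g := g) (G := g) (ψ := id) (hS.differentiableAt_φ hx)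
    (hS.differentiableAt_ξ hx) u
  rw [covDeriv_congr hφξ, covDeriv_id_const, map_zero, ← covDerivCLM_apply] at h
  exact eq_neg_of_add_eq_zero_left h.symm

variable [FiniteDimensional ℝ E]

lemma fderiv_η (u v : E) : fderiv ℝ η x u v
    = g x (covDerivCLM g id ξ x u) v + η x (christoffelCLM g x u v) := by
  have hηv : (fun y => g (id y) (ξ y) v) =ᶠ[nhds x] fun y => η y v := by
    filter_upwards [hS.metric.isOpen.mem_nhds hx] with y hy using (hS.η_eq y hy v).symm
  have h := hS.metric.fderiv_inner_along (ψ := id) hx differentiableAt_id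
    (hS.differentiableAt_ξ hx) (differentiableAt_const v) u
  rwa [hηv.fderiv_eq, fderiv_clm_apply_const (hS.differentiableAt_η hx), covDeriv_id_const, id,
    ← hS.η_eq x hx, ← covDerivCLM_apply] at h

lemma inner_covDeriv_ξ_ξ (u : E) : g x (covDerivCLM g id ξ x u) (ξ x) = 0 := by
  have hnorm : (fun y => g (id y) (ξ y) (ξ y)) =ᶠ[nhds x] fun _ => 1 := by
    filter_upwards [hS.metric.isOpen.mem_nhds hx] with y hy
    rw [id, ← hS.η_eq y hy, hS.η_ξ y hy]
  have h := hS.metric.fderiv_inner_along (ψ := id) hx differentiableAt_id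
    (hS.differentiableAt_ξ hx) (hS.differentiableAt_ξ hx) u
  rw [hnorm.fderiv_eq, id, hS.metric.symm x hx (ξ x), fderiv_fun_const, ← covDerivCLM_apply] at h
  simp only [Pi.zero_apply, _root_.zero_apply] at h
  linarith

lemma inner_covDeriv_ξ_sub (u v : E) :
    g x (covDerivCLM g id ξ x u) v - g x (covDerivCLM g id ξ x v) u = 2 * g x u (φ x v) := by
  rw [← hS.fderiv_η_sub hx, hS.fderiv_η hx, hS.fderiv_η hx, hS.metric.christoffelCLM_symm hx v u]
  ring

lemma covDeriv_ξ_ξ : covDerivCLM g id ξ x (ξ x) = 0 := by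
  refine hS.metric.eq_of_forall_inner hx fun v => ?_
  have h := hS.inner_covDeriv_ξ_sub hx (ξ x) v
  rw [hS.inner_covDeriv_ξ_ξ hx, hS.inner_φ_swap hx, hS.φ_ξ hx, map_zero] at h
  simpa using h

lemma inner_covDerivHom_φ_swap (u v w : E) :
    g x (covDerivHom g g id φ x u v) w = -g x (covDerivHom g g id φ x u w) v := by
  have hφ := hS.differentiableAt_φ hx
  have hskew : (fun y => g (id y) (φ y v) w) =ᶠ[nhds x] fun y => -g (id y) (φ y w) v := by
    filter_upwards [hS.metric.isOpen.mem_nhds hx] with y hy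
    rw [id, hS.inner_φ_left hy, hS.metric.symm y hy v]
  have hleibniz : ∀ v w, fderiv ℝ (fun y => g (id y) (φ y v) w) x u
      = g x (covDerivHom g g id φ x u v) w + g x (φ x (christoffelCLM g x u v)) w
        + g x (φ x v) (christoffelCLM g x u w) := fun v w => by
    rw [hS.metric.fderiv_inner_along (ψ := id) hx differentiableAt_id
      (hφ.clm_apply (differentiableAt_const v)) (differentiableAt_const w),
      covDeriv_clm_apply (g := g) hφ (differentiableAt_const v), covDeriv_id_const,
      covDeriv_id_const, id, map_add, _root_.add_apply]
  have h := hleibniz v w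
  rw [hskew.fderiv_eq, fderiv_fun_neg, _root_.neg_apply, hleibniz] at h
  linarith [hS.inner_φ_left hx (christoffelCLM g x u v) w,
    hS.inner_φ_left hx (christoffelCLM g x u w) v,
    hS.metric.symm x hx (christoffelCLM g x u v) (φ x w),
    hS.metric.symm x hx (christoffelCLM g x u w) (φ x v)]

lemma covDerivHom_φ_φ (u v : E) :
    covDerivHom g g id φ x u (φ x v) + φ x (covDerivHom g g id φ x u v)
      = g x (covDerivCLM g id ξ x u) v • ξ x + η x v • covDerivCLM g id ξ x u := by
  have hφ := hS.differentiableAt_φ hx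
  have hφv : DifferentiableAt ℝ (fun y => φ y v) x := hφ.clm_apply (differentiableAt_const v)
  have hηv : DifferentiableAt ℝ (fun y => η y v) x :=
    (hS.differentiableAt_η hx).clm_apply (differentiableAt_const v)
  have hsq : (fun y => φ y (φ y v)) =ᶠ[nhds x] fun y => -v + η y v • ξ y := by
    filter_upwards [hS.metric.isOpen.mem_nhds hx] with y hy using hS.φ_sq y hy v
  have h := covDeriv_clm_apply (g := g) (G := g) (ψ := id) hφ hφv u
  rw [covDeriv_congr hsq, covDeriv_clm_apply (g := g) hφ (differentiableAt_const v),
    covDeriv_add (differentiableAt_const _) (hηv.fun_smul (hS.differentiableAt_ξ hx)),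
    covDeriv_smul hηv (hS.differentiableAt_ξ hx), covDeriv_id_const, covDeriv_id_const,
    fderiv_clm_apply_const (hS.differentiableAt_η hx), hS.fderiv_η hx, ← covDerivCLM_apply,
    map_add, hS.φ_sq x hx, map_neg] at h
  rw [← sub_eq_zero] at h ⊢
  rw [← neg_eq_zero, ← h]
  module

lemma fderiv_fderiv_η_sub (u v w : E) :
    fderiv ℝ (fderiv ℝ η) x u v w - fderiv ℝ (fderiv ℝ η) x u w v
      = 2 * (g x (christoffelCLM g x u v) (φ x w) + g x (covDerivHom g g id φ x u w) v
        - g x (christoffelCLM g x u w) (φ x v)) := by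
  have hφ := hS.differentiableAt_φ hx
  have hdη := differentiableAt_of_contDiffAt_infty (contDiffAt_infty_fderiv (hS.smooth_η x hx))
  have hφw : DifferentiableAt ℝ (fun y => φ y w) x := hφ.clm_apply (differentiableAt_const w)
  have hdηa : ∀ a b, DifferentiableAt ℝ (fun y => fderiv ℝ η y a b) x := fun a b =>
    (hdη.clm_apply (differentiableAt_const a)).clm_apply (differentiableAt_const b)
  have hpair : DifferentiableAt ℝ (fun y => g (id y) v (φ y w)) x :=
    ((hS.metric.differentiableAt hx).clm_apply (differentiableAt_const v)).clm_apply hφw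
  have hcontact : (fun y => fderiv ℝ η y v w - fderiv ℝ η y w v)
      =ᶠ[nhds x] fun y => 2 * g (id y) v (φ y w) := by
    filter_upwards [hS.metric.isOpen.mem_nhds hx] with y hy using hS.fderiv_η_sub hy v w
  have h := DFunLike.congr_fun (hcontact.fderiv_eq (𝕜 := ℝ)) u
  simp only [fderiv_fun_sub (hdηa v w) (hdηa w v), fderiv_const_mul hpair, _root_.sub_apply,
    _root_.smul_apply, fderiv_clm_apply₂_const hdη, smul_eq_mul] at h
  rw [h, hS.metric.fderiv_inner_along (ψ := id) hx differentiableAt_id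
    (differentiableAt_const v) hφw u, covDeriv_clm_apply (g := g) hφ (differentiableAt_const w),
    covDeriv_id_const, covDeriv_id_const]
  simp only [id, map_add]
  rw [hS.metric.symm x hx v, hS.metric.symm x hx v, hS.inner_φ_left hx]
  ring

/-- The fundamental form `g(u, φv)` is exact, being `dη`, hence closed. -/
lemma inner_covDerivHom_φ_cyclic (u v w : E) :
    g x (covDerivHom g g id φ x u v) w + g x (covDerivHom g g id φ x v w) u
      + g x (covDerivHom g g id φ x w u) v = 0 := by
  have hη := hS.smooth_η x hx
  have hΓ := hS.metric.christoffelCLM_symm hx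
  have hu := hS.fderiv_fderiv_η_sub hx u v w
  have hv := hS.fderiv_fderiv_η_sub hx v w u
  have hw := hS.fderiv_fderiv_η_sub hx w u v
  rw [fderiv_fderiv_comm hη v u, hΓ v u] at hv
  rw [fderiv_fderiv_comm hη w u, fderiv_fderiv_comm hη w v, hΓ w u, hΓ w v] at hw
  linarith [hS.inner_covDerivHom_φ_swap hx u v w, hS.inner_covDerivHom_φ_swap hx v w u,
    hS.inner_covDerivHom_φ_swap hx w u v]

lemma inner_covDerivHom_φ_ξ (u v : E) : g x (covDerivHom g g id φ x u v) (ξ x)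
    = -g x (covDerivCLM g id ξ x u) (φ x v) := by
  rw [hS.inner_covDerivHom_φ_swap hx, hS.covDerivHom_φ_ξ hx, map_neg, _root_.neg_apply,
    hS.inner_φ_left hx, neg_neg]

lemma inner_covDeriv_ξ_φ_φ (u v : E) :
    g x (covDerivCLM g id ξ x u) (φ x (φ x v)) = -g x (covDerivCLM g id ξ x u) v := by
  simp [hS.φ_sq x hx, hS.inner_covDeriv_ξ_ξ hx]

lemma covDeriv_ξ_φ_φ (u : E) :
    covDerivCLM g id ξ x (φ x (φ x u)) = -covDerivCLM g id ξ x u := by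
  simp [hS.φ_sq x hx, hS.covDeriv_ξ_ξ hx]

lemma inner_covDeriv_ξ_φ_swap (u v : E) :
    g x (covDerivCLM g id ξ x (φ x u)) (φ x v)
      = -g x (covDerivCLM g id ξ x (φ x v)) (φ x u) := by
  have hnormal := congrArg (fun t => g x t v) (hS.covDerivHom_φ_normal hx u (ξ x))
  simp only [hS.φ_ξ hx, map_add, map_sub, map_neg, map_zero, _root_.add_apply,
    _root_.sub_apply, _root_.neg_apply, _root_.zero_apply,
    hS.covDerivHom_φ_ξ hx, hS.inner_φ_left hx, mul_zero, zero_smul] at hnormal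
  have hcyclic := hS.inner_covDerivHom_φ_cyclic hx (ξ x) u (φ x v)
  have hswap := hS.inner_covDerivHom_φ_swap hx (φ x v) (ξ x) u
  rw [hS.inner_covDerivHom_φ_ξ hx] at hcyclic hswap
  linarith [hS.inner_covDeriv_ξ_φ_φ hx u v]

lemma covDeriv_ξ (u : E) : covDerivCLM g id ξ x u = -φ x u := by
  refine hS.metric.eq_of_forall_inner hx fun v => ?_
  have hskew := hS.inner_covDeriv_ξ_φ_swap hx (φ x u) (φ x v)
  rw [hS.covDeriv_ξ_φ_φ hx, hS.covDeriv_ξ_φ_φ hx, map_neg, map_neg, _root_.neg_apply,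
    _root_.neg_apply, hS.inner_covDeriv_ξ_φ_φ hx, hS.inner_covDeriv_ξ_φ_φ hx] at hskew
  rw [map_neg, _root_.neg_apply, hS.inner_φ_left hx]
  linarith [hS.inner_covDeriv_ξ_sub hx u v]

end IsSasakianOn

end Sasakian

namespace IsSasakianOn

variable {E : Type*} [NormedAddCommGroup E] [NormedSpace ℝ E]
  {g : E → E →L[ℝ] E →L[ℝ] ℝ} {φ : E → E →L[ℝ] E} {ξ : E → E} {η : E → E →L[ℝ] ℝ} {U : Set E}
  (hS : IsSasakianOn g φ ξ η U) {x : E} (hx : x ∈ U)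

include hS hx

lemma inner_covDerivHom_φ_normal (u v w : E) :
    g x (covDerivHom g g id φ x (φ x u) v) w - g x (covDerivHom g g id φ x (φ x v) u) w
      - g x (covDerivHom g g id φ x v u) (φ x w) + g x (covDerivHom g g id φ x u v) (φ x w)
      + 2 * g x u (φ x v) * η x w = 0 := by
  have h := congrArg (fun t => g x t w) (hS.covDerivHom_φ_normal hx u v)
  simp only [map_add, map_sub, map_smul, _root_.add_apply, _root_.sub_apply, _root_.smul_apply,
    hS.inner_φ_left hx, ← hS.η_eq x hx, smul_eq_mul, map_zero, _root_.zero_apply] at h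
  linarith

variable [FiniteDimensional ℝ E]

lemma inner_covDerivHom_φ_φ_right (u v w : E) :
    g x (covDerivHom g g id φ x u v) (φ x (φ x w))
      = -g x (covDerivHom g g id φ x u v) w + η x w * (g x u v - η x u * η x v) := by
  rw [hS.φ_sq x hx, map_add, map_neg, map_smul, hS.inner_covDerivHom_φ_ξ hx, hS.covDeriv_ξ hx,
    map_neg, _root_.neg_apply, neg_neg, hS.compatible x hx, smul_eq_mul]

lemma inner_covDerivHom_φ_φ_sub (u v w : E) :
    g x (covDerivHom g g id φ x u (φ x v)) w - g x (covDerivHom g g id φ x u v) (φ x w)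
      = g x u (φ x v) * η x w + η x v * g x u (φ x w) := by
  have h := congrArg (fun t => g x t w) (hS.covDerivHom_φ_φ hx u v)
  simp only [map_add, map_smul, map_neg, _root_.add_apply, _root_.smul_apply, _root_.neg_apply,
    hS.inner_φ_left hx, hS.covDeriv_ξ hx, ← hS.η_eq x hx, smul_eq_mul] at h
  linarith

lemma covDerivHom_φ (u v : E) :
    covDerivHom g g id φ x u v = g x u v • ξ x - η x v • u := by
  refine hS.metric.eq_of_forall_inner hx fun w => ?_
  have hnormal := hS.inner_covDerivHom_φ_normal hx v w (φ x u)
  rw [hS.inner_covDerivHom_φ_φ_right hx, hS.inner_covDerivHom_φ_φ_right hx, hS.η_φ x hx] at hnormal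
  have hvw := hS.inner_covDerivHom_φ_φ_sub hx (φ x v) w u
  have hwv := hS.inner_covDerivHom_φ_φ_sub hx (φ x w) v u
  have huv := hS.inner_covDerivHom_φ_φ_sub hx u v (φ x w)
  rw [hS.inner_covDerivHom_φ_φ_right hx, hS.η_φ x hx, hS.inner_φ_φ hx] at huv
  simp only [hS.compatible x hx] at hvw hwv
  have hsymm := hS.metric.symm x hx
  rw [hsymm w v] at hnormal hwv
  rw [hsymm v u] at hvw
  rw [hsymm w u] at hwv
  simp only [map_sub, map_smul, _root_.sub_apply, _root_.smul_apply, smul_eq_mul, ← hS.η_eq x hx]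
  linarith [hS.inner_covDerivHom_φ_cyclic hx u (φ x v) (φ x w),
    hS.inner_covDerivHom_φ_cyclic hx u v w, hS.inner_covDerivHom_φ_swap hx w u v,
    hS.inner_covDerivHom_φ_swap hx (φ x w) u (φ x v)]

lemma covDeriv_φ_apply {Z : E → E} (hZ : DifferentiableAt ℝ Z x) (u : E) :
    covDeriv g id (fun y => φ y (Z y)) x u
      = g x u (Z x) • ξ x - η x (Z x) • u + φ x (covDeriv g id Z x u) := by
  rw [covDeriv_clm_apply (hS.differentiableAt_φ hx) hZ, hS.covDerivHom_φ hx]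

lemma curvature_ξ (u v : E) : curvature g x u v (ξ x) = η x v • u - η x u • v := by
  have h := hS.metric.covDeriv_commutator (ψ := id) hx contDiffAt_id (hS.smooth_ξ x hx) u v
  have hξ : ∀ v, (fun y => covDeriv g id ξ y v) =ᶠ[nhds x] fun y => -φ y v := fun v => by
    filter_upwards [hS.metric.isOpen.mem_nhds hx] with y hy
    rw [← covDerivCLM_apply, hS.covDeriv_ξ hy]
  have hφ : ∀ u v, covDeriv g id (fun y => -φ y v) x u
      = -(g x u v • ξ x - η x v • u + φ x (christoffelCLM g x u v)) := fun u v => by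
    rw [← covDeriv_id_const, ← hS.covDeriv_φ_apply hx (differentiableAt_const v)]
    simpa using covDeriv_const_smul (G := g) (ψ := id) (-1)
      ((hS.differentiableAt_φ hx).clm_apply (differentiableAt_const v)) u
  rw [covDeriv_congr (hξ v), covDeriv_congr (hξ u), hφ, hφ, hS.metric.christoffelCLM_symm hx v u,
    hS.metric.symm x hx v u] at h
  simp only [fderiv_id, id, ContinuousLinearMap.id_apply] at h
  rw [← h]
  abel

lemma fderiv_η_apply (u w : E) :
    fderiv ℝ (fun y => η y w) x u = g x u (φ x w) + η x (christoffelCLM g x u w) := by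
  rw [fderiv_clm_apply_const (hS.differentiableAt_η hx), hS.fderiv_η hx, hS.covDeriv_ξ hx,
    map_neg, _root_.neg_apply, hS.inner_φ_left hx, neg_neg]

lemma covDeriv_covDeriv_φ (u v w : E) :
    covDeriv g id (fun y => covDeriv g id (fun y => φ y w) y v) x u
      = (g x (christoffelCLM g x u v) w + g x v (christoffelCLM g x u w)) • ξ x - g x v w • φ x u
        - ((g x u (φ x w) + η x (christoffelCLM g x u w)) • v + η x w • christoffelCLM g x u v)
        + (g x u (christoffelCLM g x v w) • ξ x - η x (christoffelCLM g x v w) • u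
          + φ x (covDeriv g id (fun y => covDeriv g id (fun _ => w) y v) x u)) := by
  have hφw : (fun y => covDeriv g id (fun y => φ y w) y v)
      =ᶠ[nhds x] fun y => g y v w • ξ y - η y w • v + φ y (covDeriv g id (fun _ => w) y v) := by
    filter_upwards [hS.metric.isOpen.mem_nhds hx] with y hy
      using hS.covDeriv_φ_apply hy (differentiableAt_const w) v
  have hgvw : DifferentiableAt ℝ (fun y => g y v w) x :=
    ((hS.metric.differentiableAt hx).clm_apply (differentiableAt_const v)).clm_apply
      (differentiableAt_const w)
  have hηw : DifferentiableAt ℝ (fun y => η y w) x :=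
    (hS.differentiableAt_η hx).clm_apply (differentiableAt_const w)
  have hw : DifferentiableAt ℝ (fun y => covDeriv g id (fun _ => w) y v) x :=
    differentiableAt_of_contDiffAt_infty
      (hS.metric.contDiffAt_covDeriv (ψ := id) hx contDiffAt_id contDiffAt_const v)
  have hξ := hS.differentiableAt_ξ hx
  rw [covDeriv_congr hφw, covDeriv_add ((hgvw.fun_smul hξ).fun_sub (hηw.smul_const v))
      ((hS.differentiableAt_φ hx).clm_apply hw),
    covDeriv_sub (hgvw.fun_smul hξ) (hηw.smul_const v), covDeriv_smul hgvw hξ,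
    covDeriv_smul hηw (differentiableAt_const v), hS.covDeriv_φ_apply hx hw,
    fderiv_clm_apply₂_const (hS.metric.differentiableAt hx),
    hS.metric.fderiv_eq_christoffel hx, ← christoffelCLM_apply, ← christoffelCLM_apply,
    hS.fderiv_η_apply hx, ← covDerivCLM_apply, hS.covDeriv_ξ hx,
    covDeriv_id_const, covDeriv_id_const]
  module

lemma curvature_φ (u v w : E) : curvature g x u v (φ x w) = φ x (curvature g x u v w)
    - g x v w • φ x u + g x u w • φ x v - g x u (φ x w) • v + g x v (φ x w) • u := by
  have hφw : ContDiffAt ℝ ∞ (fun y => φ y w) x := (hS.smooth_φ x hx).clm_apply contDiffAt_const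
  have h := hS.metric.covDeriv_commutator (ψ := id) hx contDiffAt_id hφw u v
  rw [hS.covDeriv_covDeriv_φ hx, hS.covDeriv_covDeriv_φ hx] at h
  simp only [fderiv_id, id, ContinuousLinearMap.id_apply] at h
  rw [← h, curvature, map_sub, hS.metric.christoffelCLM_symm hx v u]
  module

end IsSasakianOn

section KaehlerLike

variable {E : Type*} [AddCommGroup E] {D : E → E → E → E → ℝ} {J : E →+ E}

/-- A curvature-like form which commutes with an almost complex operator `J`, for which `J² = -1`
modulo the kernel of the form. -/
structure IsKaehlerLike (D : E → E → E → E → ℝ) (J : E →+ E) : Prop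
    extends IsCurvatureLike D where
  comm : ∀ X Y Z W, D X Y (J Z) W = -D X Y Z (J W)
  sq : ∀ X Y Z W, D X Y (J (J Z)) W = -D X Y Z W

namespace IsKaehlerLike

variable (hD : IsKaehlerLike D J)

include hD

lemma apply_J_J (X Y Z W : E) : D X Y (J Z) (J W) = D X Y Z W := by
  linarith [hD.comm X Y (J Z) W, hD.sq X Y Z W]

lemma J_J_apply (X Y Z W : E) : D (J X) (J Y) Z W = D X Y Z W := by
  rw [hD.pair, hD.apply_J_J, hD.pair]

lemma sq₂ (X Y Z W : E) : D X (J (J Y)) Z W = -D X Y Z W := by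
  rw [hD.pair, hD.skew, hD.sq, hD.skew, hD.pair]
  ring

/-- Polarization of the holomorphic sectional curvature at `X + Y` and `X - Y`. -/
lemma sectional_add_three_mul (hol : ∀ X, D X (J X) (J X) X = 0) (X Y : E) :
    D X Y Y X + 3 * D X (J Y) (J Y) X = 0 := by
  have hadd := hol (X + Y)
  have hsub := hol (X + -Y)
  simp only [map_add, map_neg, hD.add, hD.add₂, hD.add₃, hD.add₄, hD.neg, hD.neg₂, hD.neg₃,
    hD.neg₄, hol] at hadd hsub
  have hYYXX : D Y (J Y) (J X) X = D X (J X) (J Y) Y := by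
    rw [hD.pair, hD.swap, hD.skew, neg_neg]
  have hYXYX : D Y (J X) (J Y) X = D X (J Y) (J X) Y := by
    rw [hD.pair, hD.swap, hD.skew, neg_neg]
  have hXYXY : D X (J Y) (J X) Y = D X (J Y) (J Y) X := by
    rw [hD.comm, hD.skew, neg_neg]
  have hYXXY : D Y (J X) (J X) Y = D X (J Y) (J Y) X := by
    rw [← hD.J_J_apply, hD.sq₂, hD.swap, neg_neg, hXYXY]
  have hJJ : D (J X) (J Y) X Y = -D X Y Y X := by rw [hD.J_J_apply, hD.skew]
  linarith [hD.bianchi X (J X) (J Y) Y, hD.swap (J Y) X (J X) Y]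

lemma eq_zero_of_holomorphic (hol : ∀ X, D X (J X) (J X) X = 0) (X Y Z W : E) :
    D X Y Z W = 0 := by
  refine hD.eq_zero_of_sectional_eq_zero (fun X Y => ?_) X Y Z W
  have h := hD.sectional_add_three_mul hol X (J Y)
  rw [hD.sq, hD.sq₂, neg_neg] at h
  linarith [hD.sectional_add_three_mul hol X Y]

end IsKaehlerLike

end KaehlerLike

section SasakianSpaceForm

variable {E : Type*} [NormedAddCommGroup E] [NormedSpace ℝ E]
  {g : E → E →L[ℝ] E →L[ℝ] ℝ} {φ : E → E →L[ℝ] E} {ξ : E → E} {η : E → E →L[ℝ] ℝ} {U : Set E}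

/-- The curvature form `(X, Y, Z, W) ↦ ⟨R(X, Y)Z, W⟩` at a point of a Sasakian space form of
`φ`-sectional curvature `c`, in terms of the values `B`, `J` and `θ` of the metric, `φ` and `η`. -/
def sasakianModel (B : E →L[ℝ] E →L[ℝ] ℝ) (J : E →L[ℝ] E) (θ : E →L[ℝ] ℝ) (c : ℝ)
    (X Y Z W : E) : ℝ :=
  (c + 3) / 4 * (B Y Z * B X W - B X Z * B Y W)
    + (c - 1) / 4 * (θ X * θ Z * B Y W - θ Y * θ Z * B X W + B X Z * θ Y * θ W
      - B Y Z * θ X * θ W + B Z (J Y) * B (J X) W - B Z (J X) * B (J Y) W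
      + 2 * B X (J Y) * B (J Z) W)

namespace IsSasakianOn

variable (hS : IsSasakianOn g φ ξ η U) {x : E} (hx : x ∈ U) {c : ℝ}

include hS hx

lemma isCurvatureLike_sasakianModel :
    IsCurvatureLike (sasakianModel (g x) (φ x) (η x) c) where
  add X X' Y Z W := by
    simp only [sasakianModel, map_add, _root_.add_apply]
    ring
  swap X Y Z W := by
    simp only [sasakianModel]
    rw [hS.inner_φ_swap hx Y X]
    ring
  skew X Y Z W := by
    simp only [sasakianModel, hS.inner_φ_left hx]
    rw [hS.inner_φ_swap hx W Y, hS.inner_φ_swap hx W X, hS.inner_φ_swap hx W Z,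
      hS.inner_φ_swap hx Z Y, hS.inner_φ_swap hx Z X]
    ring
  bianchi X Y Z W := by
    simp only [sasakianModel, hS.inner_φ_left hx]
    rw [hS.metric.symm x hx Y X, hS.metric.symm x hx Z X, hS.metric.symm x hx Z Y,
      hS.inner_φ_swap hx Y X, hS.inner_φ_swap hx Z X, hS.inner_φ_swap hx Z Y]
    ring

lemma inner_curvature_φ_self {u : E} (hu : η x u = 0)
    (hc : ∀ u, u ≠ 0 → η x u = 0 → sectionalCurvature g x u (φ x u) = c) :
    g x (curvature g x u (φ x u) (φ x u)) u = c * g x u u ^ 2 := by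
  rcases eq_or_ne u 0 with rfl | hu₀
  · simp
  · have h := hc u hu₀ hu
    have hpos := (hS.metric.pos x hx u hu₀).ne'
    rw [sectionalCurvature, hS.compatible x hx, hu, hS.inner_φ_self hx] at h
    field_simp at h
    linear_combination h

variable [FiniteDimensional ℝ E]

lemma isKaehlerLike_curvature_sub :
    IsKaehlerLike (fun X Y Z W => g x (curvature g x X Y Z) W
      - sasakianModel (g x) (φ x) (η x) c X Y Z W) (φ x : E →+ E) where
  toIsCurvatureLike :=
    (hS.metric.isCurvatureLike hx).sub (hS.isCurvatureLike_sasakianModel hx)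
  comm X Y Z W := by
    simp only [sasakianModel, AddMonoidHom.coe_coe]
    rw [hS.curvature_φ hx]
    simp only [map_add, map_sub, map_smul, _root_.add_apply, _root_.sub_apply,
      _root_.smul_apply, smul_eq_mul, hS.η_φ x hx, hS.inner_φ_left hx, hS.inner_φ_φ hx]
    simp only [hS.inner_φ_swap hx Z Y, hS.inner_φ_swap hx Z X, hS.metric.symm x hx Z Y,
      hS.metric.symm x hx Z X]
    ring
  sq X Y Z W := by
    have hξ := hS.curvature_ξ hx X Y
    simp only [sasakianModel, AddMonoidHom.coe_coe, hS.φ_sq x hx Z]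
    simp only [← hS.metric.curvatureCLM_apply hx] at hξ ⊢
    simp only [map_add, map_neg, map_smul, hξ, map_sub, _root_.add_apply, _root_.neg_apply,
      _root_.sub_apply, _root_.smul_apply, smul_eq_mul, hS.φ_ξ hx, map_zero, hS.η_ξ x hx,
      ← hS.η_eq x hx, _root_.zero_apply, hS.η_φ x hx, hS.metric.symm x hx _ (ξ x)]
    ring

variable (hc : ∀ u, u ≠ 0 → η x u = 0 → sectionalCurvature g x u (φ x u) = c)

include hc

lemma inner_curvature_eq_sasakianModel (X Y Z W : E) :
    g x (curvature g x X Y Z) W = sasakianModel (g x) (φ x) (η x) c X Y Z W := by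
  have hD := hS.isKaehlerLike_curvature_sub hx (c := c)
  refine sub_eq_zero.mp (hD.eq_zero_of_holomorphic (fun X => ?_) X Y Z W)
  -- `J` is an isometry for the difference tensor, so `X` may be replaced by `φ²X`, which is
  -- orthogonal to `ξ`.
  rw [← hD.apply_J_J, ← hD.J_J_apply, ← hD.apply_J_J, ← hD.J_J_apply]
  simp only [AddMonoidHom.coe_coe]
  generalize hu : φ x (φ x X) = u
  have hη : η x u = 0 := by rw [← hu, hS.η_φ x hx]
  rw [hS.inner_curvature_φ_self hx hη hc]
  simp only [sasakianModel, hS.inner_φ_left hx, hS.inner_φ_φ hx, hS.η_φ x hx, hη,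
    hS.inner_φ_self hx]
  ring

lemma ricci_eq {m : ℕ} (hdim : Module.finrank ℝ E = 2 * m + 1) (Y : E) {Z : E} (hZ : η x Z = 0) :
    ricci g x Y Z = (c * (m + 1) + 3 * m - 1) / 2 * g x Z Y := by
  obtain ⟨e, he⟩ := hS.metric.exists_orthonormal hx
  have hsymm := hS.metric.symm x hx
  have hmodel : ∀ i, g x (curvature g x (e i) Y Z) (e i)
      = (c + 3) / 4 * g x Z Y + (-((c + 3) / 4)) * (g x Z (e i) * g x (e i) Y)
        + (c - 1) / 4 * η x Y * (g x (ξ x) (e i) * g x (e i) Z)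
        + (-((c - 1) / 4 * g x Z Y)) * (g x (ξ x) (e i) * g x (e i) (ξ x))
        + (3 * (c - 1) / 4) * (g x (φ x Z) (e i) * g x (e i) (φ x Y)) := fun i => by
    rw [hS.inner_curvature_eq_sasakianModel hx hc, sasakianModel, hZ]
    simp only [hS.inner_φ_left hx, hS.inner_φ_self hx, he i i, if_true, hS.η_eq x hx]
    rw [hsymm (e i) (ξ x), hsymm (e i) Z, hsymm Y (e i), hsymm Y Z, hS.inner_φ_swap hx (e i) Y]
    ring
  simp only [hS.metric.ricci_eq_sum hx he, hmodel, Finset.sum_add_distrib, ← Finset.mul_sum,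
    he.sum_inner_mul_inner]
  simp only [hS.compatible x hx, ← hS.η_eq x hx, hZ, hS.η_ξ x hx, Finset.sum_const,
    Finset.card_univ, Fintype.card_fin, hdim, nsmul_eq_mul]
  push_cast
  ring

end IsSasakianOn

end SasakianSpaceForm

section Charts

variable {E : Type*} [NormedAddCommGroup E] [NormedSpace ℝ E]
  {H : Type*} [TopologicalSpace H] {I : ModelWithCorners ℝ E H}
  {M : Type*} [TopologicalSpace M] [ChartedSpace H M]

lemma localMetric_apply (g : ∀ p : M, TangentSpace I p →L[ℝ] TangentSpace I p →L[ℝ] ℝ)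
    (p₀ : M) (x u v : E) :
    localMetric I g p₀ x u v
      = g ((extChartAt I p₀).symm x) (fromCoord I p₀ x u) (fromCoord I p₀ x v) :=
  rfl

section One

variable [IsManifold I 1 M] {p₀ : M} {x : E}

lemma toCoord_fromCoord (hx : x ∈ (extChartAt I p₀).target) (u : E) :
    toCoord I p₀ x (fromCoord I p₀ x u) = u :=
  DFunLike.congr_fun (mfderiv_extChartAt_comp_mfderivWithin_extChartAt_symm hx) u

lemma fromCoord_toCoord (hx : x ∈ (extChartAt I p₀).target)
    (u : TangentSpace I ((extChartAt I p₀).symm x)) :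
    fromCoord I p₀ x (toCoord I p₀ x u) = u :=
  DFunLike.congr_fun (mfderivWithin_extChartAt_symm_comp_mfderiv_extChartAt hx) u

lemma mk_mem_source_trivializationAt (hx : x ∈ (extChartAt I p₀).target)
    (u : TangentSpace I ((extChartAt I p₀).symm x)) :
    TotalSpace.mk' E ((extChartAt I p₀).symm x) u
      ∈ (trivializationAt E (TangentSpace I) p₀).source := by
  rw [Trivialization.mem_source]
  simpa using (extChartAt I p₀).map_target hx

lemma trivializationAt_snd (hx : x ∈ (extChartAt I p₀).target)
    (u : TangentSpace I ((extChartAt I p₀).symm x)) :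
    (trivializationAt E (TangentSpace I) p₀ ⟨(extChartAt I p₀).symm x, u⟩).2
      = toCoord I p₀ x u := by
  have h : (extChartAt I p₀).symm x ∈ (chartAt H p₀).source := by
    rw [← extChartAt_source (I := I)]
    exact (extChartAt I p₀).map_target hx
  have h' := DFunLike.congr_fun
    (TangentBundle.continuousLinearMapAt_trivializationAt (𝕜 := ℝ) (I := I) h) u
  refine Eq.trans ?_ h'
  rw [Trivialization.continuousLinearMapAt_apply, Trivialization.coe_linearMapAt_of_mem]
  simpa using h

end One

variable [IsManifold I ∞ M] {p₀ : M} {x : E}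

section Smooth

variable [I.Boundaryless]

lemma contMDiffAt_extChartAt_symm (hx : x ∈ (extChartAt I p₀).target) :
    ContMDiffAt 𝓘(ℝ, E) I ∞ (extChartAt I p₀).symm x :=
  (contMDiffOn_extChartAt_symm p₀).contMDiffAt ((isOpen_extChartAt_target p₀).mem_nhds hx)

lemma contMDiffAt_fromCoord (hx : x ∈ (extChartAt I p₀).target) (u : E) :
    ContMDiffAt 𝓘(ℝ, E) (I.prod 𝓘(ℝ, E)) ∞
      (fun y => TotalSpace.mk' E (E := fun p : M => TangentSpace I p)
        ((extChartAt I p₀).symm y) (fromCoord I p₀ y u)) x := by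
  rw [(trivializationAt E (TangentSpace I) p₀).contMDiffAt_iff]
  · refine ⟨contMDiffAt_extChartAt_symm hx, ?_⟩
    refine (contMDiffAt_const (c := u)).congr_of_eventuallyEq ?_
    filter_upwards [(isOpen_extChartAt_target p₀).mem_nhds hx] with y hy
    rw [trivializationAt_snd hy, toCoord_fromCoord hy]
  · exact mk_mem_source_trivializationAt hx _

lemma contDiffAt_toCoord {v : ∀ y : E, TangentSpace I ((extChartAt I p₀).symm y)}
    (hx : x ∈ (extChartAt I p₀).target)
    (hv : ContMDiffAt 𝓘(ℝ, E) (I.prod 𝓘(ℝ, E)) ∞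
      (fun y => TotalSpace.mk' E (E := fun p : M => TangentSpace I p)
        ((extChartAt I p₀).symm y) (v y)) x) :
    ContDiffAt ℝ ∞ (fun y => toCoord I p₀ y (v y)) x := by
  rw [(trivializationAt E (TangentSpace I) p₀).contMDiffAt_iff] at hv
  · rw [← contMDiffAt_iff_contDiffAt]
    refine hv.2.congr_of_eventuallyEq ?_
    filter_upwards [(isOpen_extChartAt_target p₀).mem_nhds hx] with y hy
    rw [← trivializationAt_snd hy]
  · exact mk_mem_source_trivializationAt hx _

lemma contDiffAt_localVec {ξ : ∀ p : M, TangentSpace I p}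
    (hξ : ContMDiff I (I.prod 𝓘(ℝ, E)) ∞ (fun p => TotalSpace.mk' E p (ξ p)))
    (hx : x ∈ (extChartAt I p₀).target) :
    ContDiffAt ℝ ∞ (localVec I ξ p₀) x :=
  contDiffAt_toCoord hx
    (ContMDiffAt.comp x (hξ.contMDiffAt) (contMDiffAt_extChartAt_symm hx))

lemma contDiffAt_localEnd [FiniteDimensional ℝ E]
    {φ : ∀ p : M, TangentSpace I p →L[ℝ] TangentSpace I p}
    (hφ : ContMDiff I (I.prod 𝓘(ℝ, E →L[ℝ] E)) ∞ (fun p => TotalSpace.mk' (E →L[ℝ] E) p (φ p)))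
    (hx : x ∈ (extChartAt I p₀).target) :
    ContDiffAt ℝ ∞ (localEnd I φ p₀) x := by
  refine contDiffAt_of_apply (isOpen_extChartAt_target p₀) (fun u y hy => ?_) hx
  refine contDiffAt_toCoord (v := fun y => φ _ (fromCoord I p₀ y u)) hy ?_
  exact ContMDiffAt.clm_bundle_apply
    (ContMDiffAt.comp y hφ.contMDiffAt (contMDiffAt_extChartAt_symm hy))
    (contMDiffAt_fromCoord hy u)

lemma contDiffAt_localForm [FiniteDimensional ℝ E]
    {η : ∀ p : M, TangentSpace I p →L[ℝ] ℝ}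
    (hη : ContMDiff I (I.prod 𝓘(ℝ, E →L[ℝ] ℝ)) ∞ (fun p => TotalSpace.mk' (E →L[ℝ] ℝ) p (η p)))
    (hx : x ∈ (extChartAt I p₀).target) :
    ContDiffAt ℝ ∞ (localForm I η p₀) x := by
  refine contDiffAt_of_apply (isOpen_extChartAt_target p₀) (fun u y hy => ?_) hx
  have h := ContMDiffAt.clm_bundle_apply (F₁ := E) (F₂ := ℝ)
    (E₁ := fun p : M => TangentSpace I p) (E₂ := Bundle.Trivial M ℝ)
    (b := (extChartAt I p₀).symm) (ϕ := fun y => η ((extChartAt I p₀).symm y))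
    (ContMDiffAt.comp y hη.contMDiffAt (contMDiffAt_extChartAt_symm hy))
    (contMDiffAt_fromCoord hy u)
  rw [contMDiffAt_totalSpace] at h
  exact contMDiffAt_iff_contDiffAt.1 h.2

lemma contDiffAt_localMetric [FiniteDimensional ℝ E]
    {g : ∀ p : M, TangentSpace I p →L[ℝ] TangentSpace I p →L[ℝ] ℝ}
    (hg : ContMDiff I (I.prod 𝓘(ℝ, E →L[ℝ] E →L[ℝ] ℝ)) ∞
        (fun p => TotalSpace.mk' (E →L[ℝ] E →L[ℝ] ℝ) p (g p)))
    (hx : x ∈ (extChartAt I p₀).target) :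
    ContDiffAt ℝ ∞ (localMetric I g p₀) x := by
  refine contDiffAt_of_apply (isOpen_extChartAt_target p₀) (fun u _ hz =>
    contDiffAt_of_apply (isOpen_extChartAt_target p₀) (fun v y hy => ?_) hz) hx
  have h := ContMDiffAt.clm_bundle_apply₂ (F₁ := E) (F₂ := E) (F₃ := ℝ)
    (E₁ := fun p : M => TangentSpace I p) (E₂ := fun p : M => TangentSpace I p)
    (E₃ := Bundle.Trivial M ℝ)
    (b := (extChartAt I p₀).symm) (ψ := fun y => g ((extChartAt I p₀).symm y))
    (ContMDiffAt.comp y hg.contMDiffAt (contMDiffAt_extChartAt_symm hy))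
    (contMDiffAt_fromCoord hy u) (contMDiffAt_fromCoord hy v)
  rw [contMDiffAt_totalSpace] at h
  exact contMDiffAt_iff_contDiffAt.1 h.2

end Smooth

end Charts

section Metric

variable {E : Type*} [NormedAddCommGroup E] [NormedSpace ℝ E] [FiniteDimensional ℝ E]
  {H : Type*} [TopologicalSpace H] {I : ModelWithCorners ℝ E H} [I.Boundaryless]
  {M : Type*} [TopologicalSpace M] [ChartedSpace H M] [IsManifold I ∞ M]

lemma isMetricOn_localMetric
    (g : ContMDiffRiemannianMetric I ∞ E (fun p : M => TangentSpace I p)) (p₀ : M) :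
    IsMetricOn (localMetric I g.inner p₀) (extChartAt I p₀).target where
  isOpen := isOpen_extChartAt_target p₀
  smooth _ hx := contDiffAt_localMetric g.contMDiff hx
  symm _ _ _ _ := g.symm _ _ _
  pos x hx u hu := by
    refine g.pos _ _ fun h => hu ?_
    rw [← toCoord_fromCoord hx u]
    exact (congrArg (toCoord I p₀ x) h).trans (map_zero _)

end Metric

lemma IsSasakian.isSasakianOn {d : ℕ} {M : Type*} [TopologicalSpace M]
    [ChartedSpace (EuclideanSpace ℝ (Fin d)) M] [IsManifold (𝓡 d) ∞ M]
    {g : ContMDiffRiemannianMetric (𝓡 d) ∞ (EuclideanSpace ℝ (Fin d))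
      (fun p : M => TangentSpace (𝓡 d) p)}
    {φ : ∀ p : M, TangentSpace (𝓡 d) p →L[ℝ] TangentSpace (𝓡 d) p}
    {ξ : ∀ p : M, TangentSpace (𝓡 d) p} {η : ∀ p : M, TangentSpace (𝓡 d) p →L[ℝ] ℝ}
    (hS : IsSasakian g φ ξ η) (p₀ : M) :
    IsSasakianOn (localMetric (𝓡 d) g.inner p₀) (localEnd (𝓡 d) φ p₀) (localVec (𝓡 d) ξ p₀)
      (localForm (𝓡 d) η p₀) (extChartAt (𝓡 d) p₀).target where
  metric := isMetricOn_localMetric g p₀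
  smooth_φ _ hx := contDiffAt_localEnd hS.smooth_φ hx
  smooth_ξ _ hx := contDiffAt_localVec hS.smooth_ξ hx
  smooth_η _ hx := contDiffAt_localForm hS.smooth_η hx
  φ_sq x hx u := by
    simp only [localEnd, localForm, localVec, ContinuousLinearMap.comp_apply,
      fromCoord_toCoord hx, hS.φ_sq, map_add, map_neg, map_smul, toCoord_fromCoord hx]
  η_ξ x hx := by
    simp only [localForm, localVec, ContinuousLinearMap.comp_apply, fromCoord_toCoord hx, hS.η_ξ]
  η_φ x hx u := by
    simp only [localForm, localEnd, ContinuousLinearMap.comp_apply, fromCoord_toCoord hx, hS.η_φ]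
  η_eq x hx u := by
    simp only [localForm, localVec, localMetric_apply, ContinuousLinearMap.comp_apply,
      fromCoord_toCoord hx, hS.η_eq]
  compatible x hx u v := by
    simp only [localForm, localEnd, localMetric_apply, ContinuousLinearMap.comp_apply,
      fromCoord_toCoord hx, hS.compatible]
  contact := hS.contact p₀
  normal := hS.normal p₀

section Warped

variable {E₁ : Type*} [NormedAddCommGroup E₁] [NormedSpace ℝ E₁]
  {H₁ : Type*} [TopologicalSpace H₁] {I₁ : ModelWithCorners ℝ E₁ H₁}
  {M₁ : Type*} [TopologicalSpace M₁] [ChartedSpace H₁ M₁]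
  {E₂ : Type*} [NormedAddCommGroup E₂] [NormedSpace ℝ E₂]
  {H₂ : Type*} [TopologicalSpace H₂] {I₂ : ModelWithCorners ℝ E₂ H₂}
  {M₂ : Type*} [TopologicalSpace M₂] [ChartedSpace H₂ M₂]

lemma warpedMetric_apply (g₁ : ∀ p : M₁, TangentSpace I₁ p →L[ℝ] TangentSpace I₁ p →L[ℝ] ℝ)
    (g₂ : ∀ p : M₂, TangentSpace I₂ p →L[ℝ] TangentSpace I₂ p →L[ℝ] ℝ) (f : M₁ → ℝ)
    (z : M₁ × M₂) (u v : TangentSpace (I₁.prod I₂) z) :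
    warpedMetric I₁ I₂ g₁ g₂ f z u v
      = g₁ z.1 u.1 v.1 + f z.1 ^ 2 * g₂ z.2 u.2 v.2 := by
  simp only [warpedMetric, mfderiv_fst, mfderiv_snd]
  rfl

lemma target_extChartAt_prod (q₀ : M₁ × M₂) :
    (extChartAt (I₁.prod I₂) q₀).target
      = (extChartAt I₁ q₀.1).target ×ˢ (extChartAt I₂ q₀.2).target := by
  rw [extChartAt_prod, PartialEquiv.prod_target]

lemma fromCoord_prod [IsManifold I₁ 1 M₁] [IsManifold I₂ 1 M₂] {q₀ : M₁ × M₂} {z : E₁ × E₂}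
    (hz : z ∈ (extChartAt (I₁.prod I₂) q₀).target) (u : E₁ × E₂) :
    (fromCoord (I₁.prod I₂) q₀ z u : E₁ × E₂)
      = ((fromCoord I₁ q₀.1 z.1 u.1 : E₁), (fromCoord I₂ q₀.2 z.2 u.2 : E₂)) := by
  rw [target_extChartAt_prod] at hz
  have h := mfderivWithin_prodMap (p := z)
    (mdifferentiableWithinAt_extChartAt_symm (I := I₁) hz.1)
    (mdifferentiableWithinAt_extChartAt_symm (I := I₂) hz.2)
    (I₁.uniqueMDiffOn _ (extChartAt_target_subset_range _ hz.1))
    (I₂.uniqueMDiffOn _ (extChartAt_target_subset_range _ hz.2))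
  rw [← modelWithCornersSelf_prod, chartedSpaceSelf_prod, ← ModelWithCorners.range_prod] at h
  exact DFunLike.congr_fun h u

lemma isWarpedOn_localMetric [FiniteDimensional ℝ E₁] [FiniteDimensional ℝ E₂]
    [I₁.Boundaryless] [IsManifold I₁ ∞ M₁] [I₂.Boundaryless] [IsManifold I₂ ∞ M₂]
    (g₁ : ContMDiffRiemannianMetric I₁ ∞ E₁ (fun p : M₁ => TangentSpace I₁ p))
    (g₂ : ContMDiffRiemannianMetric I₂ ∞ E₂ (fun p : M₂ => TangentSpace I₂ p))
    {f : M₁ → ℝ} (hf : ContMDiff I₁ 𝓘(ℝ, ℝ) ∞ f) (hf_pos : ∀ p, 0 < f p) (q₀ : M₁ × M₂) :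
    IsWarpedOn (localMetric (I₁.prod I₂) (warpedMetric I₁ I₂ g₁.inner g₂.inner f) q₀)
      (localMetric I₁ g₁.inner q₀.1) (localMetric I₂ g₂.inner q₀.2)
      (fun y => f ((extChartAt I₁ q₀.1).symm y))
      (extChartAt I₁ q₀.1).target (extChartAt I₂ q₀.2).target where
  metric₁ := isMetricOn_localMetric g₁ q₀.1
  metric₂ := isMetricOn_localMetric g₂ q₀.2
  smooth x hx := contMDiffAt_iff_contDiffAt.1
    (ContMDiffAt.comp x hf.contMDiffAt (contMDiffAt_extChartAt_symm hx))
  pos _ _ := hf_pos _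
  apply z hz u v := by
    have hz' : z ∈ (extChartAt (I₁.prod I₂) q₀).target := by
      rwa [target_extChartAt_prod]
    rw [localMetric_apply, warpedMetric_apply, fromCoord_prod hz', fromCoord_prod hz']
    rfl

end Warped

section Maps

variable {E : Type*} [NormedAddCommGroup E] [NormedSpace ℝ E]
  {H : Type*} [TopologicalSpace H] {I : ModelWithCorners ℝ E H}
  {M : Type*} [TopologicalSpace M] [ChartedSpace H M]
  {E' : Type*} [NormedAddCommGroup E'] [NormedSpace ℝ E']
  {H' : Type*} [TopologicalSpace H'] {I' : ModelWithCorners ℝ E' H'}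
  {N : Type*} [TopologicalSpace N] [ChartedSpace H' N]
  {ψ : M → N} {p₀ : M} {x : E}

lemma mapsTo_writtenInExtChartAt (hx : x ∈ localDomain I I' ψ p₀) :
    writtenInExtChartAt I I' p₀ ψ x ∈ (extChartAt I' (ψ p₀)).target :=
  (extChartAt I' (ψ p₀)).map_source hx.2

lemma extChartAt_symm_writtenInExtChartAt (hx : x ∈ localDomain I I' ψ p₀) :
    (extChartAt I' (ψ p₀)).symm (writtenInExtChartAt I I' p₀ ψ x)
      = ψ ((extChartAt I p₀).symm x) :=
  (extChartAt I' (ψ p₀)).left_inv hx.2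

lemma isOpen_localDomain [I.Boundaryless] (hψ : Continuous ψ) :
    IsOpen (localDomain I I' ψ p₀) :=
  (continuousOn_extChartAt_symm p₀).isOpen_inter_preimage (isOpen_extChartAt_target p₀)
    ((isOpen_extChartAt_source (ψ p₀)).preimage hψ)

lemma mem_localDomain_self (ψ : M → N) (p₀ : M) :
    extChartAt I p₀ p₀ ∈ localDomain I I' ψ p₀ := by
  refine ⟨mem_extChartAt_target p₀, ?_⟩
  simp

lemma contDiffAt_writtenInExtChartAt [I.Boundaryless] [IsManifold I ∞ M]
    [IsManifold I' ∞ N] (hψ : ContMDiff I I' ∞ ψ)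
    (hx : x ∈ localDomain I I' ψ p₀) : ContDiffAt ℝ ∞ (writtenInExtChartAt I I' p₀ ψ) x := by
  rw [← contMDiffAt_iff_contDiffAt]
  exact ContMDiffAt.comp x (contMDiffAt_extChartAt' (by simpa using hx.2))
    (ContMDiffAt.comp x hψ.contMDiffAt (contMDiffAt_extChartAt_symm hx.1))

lemma fromCoord_fderiv_writtenInExtChartAt [I.Boundaryless] [IsManifold I ∞ M]
    [I'.Boundaryless] [IsManifold I' ∞ N] (hψ : ContMDiff I I' ∞ ψ)
    (hx : x ∈ localDomain I I' ψ p₀) (u : E) :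
    (fromCoord I' (ψ p₀) (writtenInExtChartAt I I' p₀ ψ x)
        (fderiv ℝ (writtenInExtChartAt I I' p₀ ψ) x u) : E')
      = (mfderiv I I' ψ ((extChartAt I p₀).symm x) (fromCoord I p₀ x u) : E') := by
  have hx' := mapsTo_writtenInExtChartAt hx
  have h : (extChartAt I' (ψ p₀)).symm ∘ writtenInExtChartAt I I' p₀ ψ
      =ᶠ[nhds x] ψ ∘ (extChartAt I p₀).symm := by
    filter_upwards [(isOpen_localDomain hψ.continuous).mem_nhds hx] with y hy
    exact extChartAt_symm_writtenInExtChartAt hy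
  have h' := h.mfderiv_eq (I := 𝓘(ℝ, E)) (I' := I')
  rw [mfderiv_comp x ((contMDiffAt_extChartAt_symm hx').mdifferentiableAt (by simp))
      ((contDiffAt_writtenInExtChartAt hψ hx).differentiableAt (by simp)).mdifferentiableAt,
    mfderiv_comp x (hψ.contMDiffAt.mdifferentiableAt (by simp))
      ((contMDiffAt_extChartAt_symm hx.1).mdifferentiableAt (by simp)),
    mfderiv_eq_fderiv] at h'
  simp only [fromCoord, ModelWithCorners.range_eq_univ, mfderivWithin_univ]
  exact DFunLike.congr_fun h' u

lemma bilin_apply_congr (G : ∀ q : N, TangentSpace I' q →L[ℝ] TangentSpace I' q →L[ℝ] ℝ)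
    {q q' : N} (h : q = q') (u v : E') :
    (G q : E' →L[ℝ] E' →L[ℝ] ℝ) u v = (G q' : E' →L[ℝ] E' →L[ℝ] ℝ) u v := by
  subst h
  rfl

end Maps

lemma IsIsometricImmersion.isIsometricOn {d : ℕ} {M : Type*} [TopologicalSpace M]
    [ChartedSpace (EuclideanSpace ℝ (Fin d)) M] [IsManifold (𝓡 d) ∞ M]
    {E' : Type*} [NormedAddCommGroup E'] [NormedSpace ℝ E']
    {H' : Type*} [TopologicalSpace H'] {I' : ModelWithCorners ℝ E' H'} [I'.Boundaryless]
    {N : Type*} [TopologicalSpace N] [ChartedSpace H' N] [IsManifold I' ∞ N]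
    {g : ContMDiffRiemannianMetric (𝓡 d) ∞ (EuclideanSpace ℝ (Fin d))
      (fun p : M => TangentSpace (𝓡 d) p)}
    {G : ∀ q : N, TangentSpace I' q →L[ℝ] TangentSpace I' q →L[ℝ] ℝ} {ψ : M → N}
    (hψ : IsIsometricImmersion I' g.inner G ψ) (p₀ : M)
    (hG : IsMetricOn (localMetric I' G (ψ p₀)) (extChartAt I' (ψ p₀)).target) :
    IsIsometricOn (localMetric (𝓡 d) g.inner p₀) (localMetric I' G (ψ p₀))
      (writtenInExtChartAt (𝓡 d) I' p₀ ψ) (localDomain (𝓡 d) I' ψ p₀)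
      (extChartAt I' (ψ p₀)).target where
  source := by
    have h := isMetricOn_localMetric g p₀
    exact ⟨isOpen_localDomain hψ.smooth.continuous, fun x hx => h.smooth x hx.1,
      fun x hx => h.symm x hx.1, fun x hx => h.pos x hx.1⟩
  target := hG
  smooth _ hx := contDiffAt_writtenInExtChartAt hψ.smooth hx
  mapsTo _ hx := mapsTo_writtenInExtChartAt hx
  isometric x hx u v := by
    rw [localMetric_apply, localMetric_apply, ← hψ.isometric]
    refine (bilin_apply_congr G (extChartAt_symm_writtenInExtChartAt hx) _ _).trans ?_
    rw [fromCoord_fderiv_writtenInExtChartAt hψ.smooth hx,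
      fromCoord_fderiv_writtenInExtChartAt hψ.smooth hx]

theorem IsIsometricOn.bitension_eq_zero_iff_of_warped {d m : ℕ}
    {E₁ E₂ : Type*} [NormedAddCommGroup E₁] [NormedSpace ℝ E₁] [FiniteDimensional ℝ E₁]
    [NormedAddCommGroup E₂] [NormedSpace ℝ E₂] [FiniteDimensional ℝ E₂]
    {G₁ : E₁ → E₁ →L[ℝ] E₁ →L[ℝ] ℝ} {G₂ : E₂ → E₂ →L[ℝ] E₂ →L[ℝ] ℝ} {f : E₁ → ℝ}
    {G : E₁ × E₂ → (E₁ × E₂) →L[ℝ] (E₁ × E₂) →L[ℝ] ℝ} {V₁ : Set E₁} {V₂ : Set E₂}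
    {φ : E₁ → E₁ →L[ℝ] E₁} {ξ : E₁ → E₁} {η : E₁ → E₁ →L[ℝ] ℝ} {c h : ℝ}
    {g : EuclideanSpace ℝ (Fin d) →
      EuclideanSpace ℝ (Fin d) →L[ℝ] EuclideanSpace ℝ (Fin d) →L[ℝ] ℝ}
    {ψ : EuclideanSpace ℝ (Fin d) → E₁ × E₂} {U : Set (EuclideanSpace ℝ (Fin d))}
    {x : EuclideanSpace ℝ (Fin d)}
    (hψ : IsIsometricOn g G ψ U (V₁ ×ˢ V₂)) (hw : IsWarpedOn G G₁ G₂ f V₁ V₂)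
    (hS : IsSasakianOn G₁ φ ξ η V₁)
    (hc : ∀ y ∈ V₁, ∀ u, u ≠ 0 → η y u = 0 → sectionalCurvature G₁ y u (φ y u) = c)
    (hm : Module.finrank ℝ E₁ = 2 * m + 1) (hd : d ≠ 0)
    (hH : IsNormalFieldOn G ψ (meanCurvature g G ψ) h U)
    (hx : x ∈ U) (hhor : (meanCurvature g G ψ x).2 = 0)
    (htan : ∃ u, fderiv ℝ ψ x u = (ξ (ψ x).1, 0)) :
    bitension g G ψ x = 0 ↔
      normSqSecondFundamentalForm g G ψ x • meanCurvature g G ψ x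
        = ((c * (m + 1) + 3 * m - 1) / 2) • meanCurvature g G ψ x
          - (Module.finrank ℝ E₂ / f (ψ x).1) •
            covDeriv G id (gradient G (fun y => f y.1)) (ψ x) (meanCurvature g G ψ x) := by
  have hz := hψ.mapsTo x hx
  rw [hψ.bitension_eq_zero_iff hd hx hH]
  obtain ⟨u, hu⟩ := htan
  have hnormal := hH.normal x hx u
  generalize meanCurvature g G ψ x = K at hhor hnormal ⊢
  obtain ⟨X, X'⟩ := K
  obtain rfl : X' = 0 := hhor
  have hη : η (ψ x).1 X = 0 := by
    rw [hu, hw.apply _ hz] at hnormal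
    simpa [hS.η_eq _ hz.1, hw.metric₁.symm _ hz.1] using hnormal
  have hricci : ∀ Z, ricci G (ψ x) Z (X, 0) = G (ψ x) (((c * (m + 1) + 3 * m - 1) / 2) • (X, 0)
      - (Module.finrank ℝ E₂ / f (ψ x).1) •
        covDeriv G id (gradient G (fun y => f y.1)) (ψ x) (X, 0)) Z := by
    intro Z
    rw [hw.ricci_horizontal hz, hS.ricci_eq hz.1 (hc _ hz.1) hm _ hη, map_sub, map_smul, map_smul,
      _root_.sub_apply, _root_.smul_apply, _root_.smul_apply,
      hψ.target.inner_covDeriv_gradient hz (hw.contDiffAt_comp_fst hz), hw.hessian_comp_fst hz,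
      hw.metric₁.hessian_symm hz.1 (hw.smooth _ hz.1), hw.apply _ hz]
    simp
  constructor
  · intro heq
    refine hψ.target.eq_of_forall_inner hz fun Z => ?_
    rw [← hricci, heq, map_smul, _root_.smul_apply, smul_eq_mul]
  · intro heq Z
    rw [hricci, ← heq, map_smul, _root_.smul_apply, smul_eq_mul]

namespace HasConstantMeanCurvature

variable {d : ℕ} {M : Type*} [TopologicalSpace M] [ChartedSpace (EuclideanSpace ℝ (Fin d)) M]
  {E' : Type*} [NormedAddCommGroup E'] [NormedSpace ℝ E']
  {H' : Type*} [TopologicalSpace H'] {I' : ModelWithCorners ℝ E' H'}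
  {N : Type*} [TopologicalSpace N] [ChartedSpace H' N]
  {g : ∀ p : M, TangentSpace (𝓡 d) p →L[ℝ] TangentSpace (𝓡 d) p →L[ℝ] ℝ}
  {G : ∀ q : N, TangentSpace I' q →L[ℝ] TangentSpace I' q →L[ℝ] ℝ} {ψ : M → N} {h : ℝ}
  (hCMC : HasConstantMeanCurvature I' g G ψ h) (hh : h ≠ 0)

include hCMC

include hh in
lemma meanCurvatureAt_ne_zero {p₀ : M} {x : EuclideanSpace ℝ (Fin d)}
    (hx : x ∈ localDomain (𝓡 d) I' ψ p₀) : meanCurvatureAt I' g G ψ p₀ x ≠ 0 := fun hzero =>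
  hh <| by rw [← hCMC p₀ x hx, hzero, map_zero, Real.sqrt_zero]

include hh in
lemma dim_ne_zero [Nonempty M] : d ≠ 0 := by
  rintro rfl
  obtain ⟨p₀⟩ := ‹Nonempty M›
  exact hCMC.meanCurvatureAt_ne_zero hh (mem_localDomain_self ψ p₀)
    (by simp [meanCurvatureAt, meanCurvature])

include hh in
lemma not_isHarmonic [Nonempty M] : ¬ IsHarmonic I' g G ψ := fun hharm => by
  obtain ⟨p₀⟩ := ‹Nonempty M›
  have hx := mem_localDomain_self (I := 𝓡 d) (I' := I') ψ p₀
  refine hCMC.meanCurvatureAt_ne_zero hh hx ?_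
  rw [meanCurvatureAt, meanCurvature, ← tension, hharm p₀ _ hx, smul_zero]

lemma inner_meanCurvatureAt_self {p₀ : M} {x : EuclideanSpace ℝ (Fin d)} {V : Set E'}
    (hG : IsMetricOn (localMetric I' G (ψ p₀)) V) (hx : x ∈ localDomain (𝓡 d) I' ψ p₀)
    (hV : writtenInExtChartAt (𝓡 d) I' p₀ ψ x ∈ V) :
    localMetric I' G (ψ p₀) (writtenInExtChartAt (𝓡 d) I' p₀ ψ x)
      (meanCurvatureAt I' g G ψ p₀ x) (meanCurvatureAt I' g G ψ p₀ x) = h ^ 2 := by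
  rw [← hCMC p₀ x hx, Real.sq_sqrt (hG.nonneg hV _)]

end HasConstantMeanCurvature

section Hypersurface

variable {d d₁ d₂ : ℕ} {M : Type*} [TopologicalSpace M]
  [ChartedSpace (EuclideanSpace ℝ (Fin d)) M] [IsManifold (𝓡 d) ∞ M]
  {M₁ : Type*} [TopologicalSpace M₁] [ChartedSpace (EuclideanSpace ℝ (Fin d₁)) M₁]
  [IsManifold (𝓡 d₁) ∞ M₁]
  {M₂ : Type*} [TopologicalSpace M₂] [ChartedSpace (EuclideanSpace ℝ (Fin d₂)) M₂]
  [IsManifold (𝓡 d₂) ∞ M₂] {ψ : M → M₁ × M₂}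

lemma IsTangentTo.exists_fderiv_eq {ξ : ∀ p : M₁, TangentSpace (𝓡 d₁) p}
    (hξ : IsTangentTo (d := d) (d₂ := d₂) ξ ψ)
    (hψ : ContMDiff (𝓡 d) ((𝓡 d₁).prod (𝓡 d₂)) ∞ ψ) {p₀ : M} {x : EuclideanSpace ℝ (Fin d)}
    (hx : x ∈ localDomain (𝓡 d) ((𝓡 d₁).prod (𝓡 d₂)) ψ p₀) :
    ∃ u, fderiv ℝ (writtenInExtChartAt (𝓡 d) ((𝓡 d₁).prod (𝓡 d₂)) p₀ ψ) x u
      = (localVec (𝓡 d₁) ξ (ψ p₀).1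
          (writtenInExtChartAt (𝓡 d) ((𝓡 d₁).prod (𝓡 d₂)) p₀ ψ x).1, 0) := by
  obtain ⟨u, hu₁, hu₂⟩ := hξ ((extChartAt (𝓡 d) p₀).symm x)
  rw [mfderiv_fst] at hu₁
  rw [mfderiv_snd] at hu₂
  have hz := mapsTo_writtenInExtChartAt hx
  have hderiv := fromCoord_fderiv_writtenInExtChartAt hψ hx (toCoord (𝓡 d) p₀ x u)
  rw [fromCoord_toCoord hx.1, fromCoord_prod hz] at hderiv
  rw [target_extChartAt_prod] at hz
  have hξ_congr : ∀ q q' : M₁, q = q' → (ξ q : EuclideanSpace ℝ (Fin d₁)) = ξ q' := by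
    rintro q _ rfl
    rfl
  have hfst := ((congrArg Prod.fst hderiv).trans hu₁).trans
    (hξ_congr _ _ (congrArg Prod.fst (extChartAt_symm_writtenInExtChartAt hx).symm))
  have hsnd := (congrArg Prod.snd hderiv).trans hu₂
  exact ⟨toCoord (𝓡 d) p₀ x u, Prod.ext
    ((toCoord_fromCoord hz.1 _).symm.trans (congrArg (toCoord (𝓡 d₁) (ψ p₀).1 _) hfst))
    ((toCoord_fromCoord hz.2 _).symm.trans
      ((congrArg (toCoord (𝓡 d₂) (ψ p₀).2 _) hsnd).trans (map_zero _)))⟩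

variable {g : ContMDiffRiemannianMetric (𝓡 d) ∞ (EuclideanSpace ℝ (Fin d))
    (fun p : M => TangentSpace (𝓡 d) p)}
  {g₁ : ContMDiffRiemannianMetric (𝓡 d₁) ∞ (EuclideanSpace ℝ (Fin d₁))
    (fun p : M₁ => TangentSpace (𝓡 d₁) p)}
  {g₂ : ContMDiffRiemannianMetric (𝓡 d₂) ∞ (EuclideanSpace ℝ (Fin d₂))
    (fun p : M₂ => TangentSpace (𝓡 d₂) p)} {f : M₁ → ℝ}

lemma IsIsometricImmersion.isIsometricOn_of_warped
    (hψ : IsIsometricImmersion ((𝓡 d₁).prod (𝓡 d₂)) g.inner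
      (warpedMetric (𝓡 d₁) (𝓡 d₂) g₁.inner g₂.inner f) ψ)
    (hf : ContMDiff (𝓡 d₁) 𝓘(ℝ, ℝ) ∞ f) (hf_pos : ∀ p, 0 < f p) (p₀ : M) :
    IsIsometricOn (localMetric (𝓡 d) g.inner p₀)
      (localMetric ((𝓡 d₁).prod (𝓡 d₂)) (warpedMetric (𝓡 d₁) (𝓡 d₂) g₁.inner g₂.inner f) (ψ p₀))
      (writtenInExtChartAt (𝓡 d) ((𝓡 d₁).prod (𝓡 d₂)) p₀ ψ)
      (localDomain (𝓡 d) ((𝓡 d₁).prod (𝓡 d₂)) ψ p₀)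
      ((extChartAt (𝓡 d₁) (ψ p₀).1).target ×ˢ (extChartAt (𝓡 d₂) (ψ p₀).2).target) := by
  have hG := (isWarpedOn_localMetric g₁ g₂ hf hf_pos (ψ p₀)).isMetricOn
  rw [← target_extChartAt_prod] at hG ⊢
  exact hψ.isIsometricOn p₀ hG

end Hypersurface

end WarpedBiharmonic

end

open WarpedBiharmonic in
theorem mainTheorem2_general {m n d : ℕ} (hd : d = 2 * m + n)
    {M : Type*} [TopologicalSpace M] [ChartedSpace (EuclideanSpace ℝ (Fin d)) M]
    [IsManifold (𝓡 d) ∞ M] [Nonempty M]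
    {M₁ : Type*} [TopologicalSpace M₁] [ChartedSpace (EuclideanSpace ℝ (Fin (2 * m + 1))) M₁]
    [IsManifold (𝓡 (2 * m + 1)) ∞ M₁]
    {M₂ : Type*} [TopologicalSpace M₂] [ChartedSpace (EuclideanSpace ℝ (Fin n)) M₂]
    [IsManifold (𝓡 n) ∞ M₂]
    {g : ContMDiffRiemannianMetric (𝓡 d) ∞ (EuclideanSpace ℝ (Fin d))
      (fun p : M => TangentSpace (𝓡 d) p)}
    {g₁ : ContMDiffRiemannianMetric (𝓡 (2 * m + 1)) ∞ (EuclideanSpace ℝ (Fin (2 * m + 1)))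
      (fun p : M₁ => TangentSpace (𝓡 (2 * m + 1)) p)}
    {g₂ : ContMDiffRiemannianMetric (𝓡 n) ∞ (EuclideanSpace ℝ (Fin n))
      (fun p : M₂ => TangentSpace (𝓡 n) p)}
    {φ : ∀ p : M₁, TangentSpace (𝓡 (2 * m + 1)) p →L[ℝ] TangentSpace (𝓡 (2 * m + 1)) p}
    {ξ : ∀ p : M₁, TangentSpace (𝓡 (2 * m + 1)) p}
    {η : ∀ p : M₁, TangentSpace (𝓡 (2 * m + 1)) p →L[ℝ] ℝ} {c : ℝ}
    (hM₁ : IsSasakianSpaceForm g₁ φ ξ η c)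
    {f : M₁ → ℝ} (hf : ContMDiff (𝓡 (2 * m + 1)) 𝓘(ℝ, ℝ) ∞ f) (hf_pos : ∀ p, 0 < f p)
    {G : ∀ z : M₁ × M₂, TangentSpace ((𝓡 (2 * m + 1)).prod (𝓡 n)) z →L[ℝ]
      TangentSpace ((𝓡 (2 * m + 1)).prod (𝓡 n)) z →L[ℝ] ℝ}
    (hG : G = warpedMetric (𝓡 (2 * m + 1)) (𝓡 n) g₁.inner g₂.inner f)
    {ψ : M → M₁ × M₂}
    (hψ : IsIsometricImmersion ((𝓡 (2 * m + 1)).prod (𝓡 n)) g.inner G ψ)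
    (hξ : IsTangentTo (d := d) (d₂ := n) ξ ψ)
    (hH : HasHorizontalMeanCurvature g.inner G ψ) {h : ℝ} (hh : h ≠ 0)
    (hCMC : HasConstantMeanCurvature ((𝓡 (2 * m + 1)).prod (𝓡 n)) g.inner G ψ h) :
    IsProperBiharmonic ((𝓡 (2 * m + 1)).prod (𝓡 n)) g.inner G ψ ↔
      ∀ p₀ : M, ∀ x ∈ localDomain (𝓡 d) ((𝓡 (2 * m + 1)).prod (𝓡 n)) ψ p₀,
        normSqBAt ((𝓡 (2 * m + 1)).prod (𝓡 n)) g.inner G ψ p₀ x •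
            meanCurvatureAt ((𝓡 (2 * m + 1)).prod (𝓡 n)) g.inner G ψ p₀ x
          = ((c * (m + 1) + 3 * m - 1) / 2) •
              meanCurvatureAt ((𝓡 (2 * m + 1)).prod (𝓡 n)) g.inner G ψ p₀ x
            - (n / f (ψ ((extChartAt (𝓡 d) p₀).symm x)).1) •
              covDerivGradAlongH ((𝓡 (2 * m + 1)).prod (𝓡 n)) g.inner G ψ
                (fun z => f z.1) p₀ x := by
  subst hG
  rw [IsProperBiharmonic, and_iff_left (hCMC.not_isHarmonic hh)]
  refine forall_congr' fun p₀ => forall₂_congr fun x hx => ?_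
  have hwarped := isWarpedOn_localMetric g₁ g₂ hf hf_pos (ψ p₀)
  have hiso := hψ.isIsometricOn_of_warped hf hf_pos p₀
  have hnormal := hiso.isNormalFieldOn_meanCurvature (by simp [hd, add_right_comm]) hh
    fun y hy => hCMC.inner_meanCurvatureAt_self hiso.target hy (hiso.mapsTo y hy)
  refine (hiso.bitension_eq_zero_iff_of_warped hwarped (hM₁.isSasakianOn (ψ p₀).1)
    (hM₁.φ_sectional (ψ p₀).1) finrank_euclideanSpace_fin (hCMC.dim_ne_zero hh) hnormal hx
    (hH p₀ x hx) (hξ.exists_fderiv_eq hψ.smooth hx)).trans ?_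
  have hpoint := congrArg Prod.fst (extChartAt_symm_writtenInExtChartAt hx)
  rw [← hpoint, finrank_euclideanSpace_fin]
  rfl

theorem mainTheorem2 (m n : ℕ)
    {M : Type*} [TopologicalSpace M] [ChartedSpace (EuclideanSpace ℝ (Fin (2 * (m + n)))) M]
    [IsManifold (𝓡 (2 * (m + n))) ∞ M] [Nonempty M]
    {M₁ : Type*} [TopologicalSpace M₁] [ChartedSpace (EuclideanSpace ℝ (Fin (2 * m + 1))) M₁]
    [IsManifold (𝓡 (2 * m + 1)) ∞ M₁]
    {M₂ : Type*} [TopologicalSpace M₂] [ChartedSpace (EuclideanSpace ℝ (Fin (2 * n))) M₂]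
    [IsManifold (𝓡 (2 * n)) ∞ M₂]
    (g : ContMDiffRiemannianMetric (𝓡 (2 * (m + n))) ∞ (EuclideanSpace ℝ (Fin (2 * (m + n))))
      (fun p : M => TangentSpace (𝓡 (2 * (m + n))) p))
    (g₁ : ContMDiffRiemannianMetric (𝓡 (2 * m + 1)) ∞ (EuclideanSpace ℝ (Fin (2 * m + 1)))
      (fun p : M₁ => TangentSpace (𝓡 (2 * m + 1)) p))
    (g₂ : ContMDiffRiemannianMetric (𝓡 (2 * n)) ∞ (EuclideanSpace ℝ (Fin (2 * n)))
      (fun p : M₂ => TangentSpace (𝓡 (2 * n)) p))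
    (φ : ∀ p : M₁, TangentSpace (𝓡 (2 * m + 1)) p →L[ℝ] TangentSpace (𝓡 (2 * m + 1)) p)
    (ξ : ∀ p : M₁, TangentSpace (𝓡 (2 * m + 1)) p)
    (η : ∀ p : M₁, TangentSpace (𝓡 (2 * m + 1)) p →L[ℝ] ℝ) (c : ℝ)
    (hM₁ : WarpedBiharmonic.IsSasakianSpaceForm g₁ φ ξ η c)
    (J : ∀ p : M₂, TangentSpace (𝓡 (2 * n)) p →L[ℝ] TangentSpace (𝓡 (2 * n)) p) (k : ℝ)
    (hM₂ : WarpedBiharmonic.IsComplexSpaceForm g₂ J k)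
    (f : M₁ → ℝ) (hf : ContMDiff (𝓡 (2 * m + 1)) 𝓘(ℝ, ℝ) ∞ f) (hf_pos : ∀ p, 0 < f p)
    (G : ∀ z : M₁ × M₂, TangentSpace ((𝓡 (2 * m + 1)).prod (𝓡 (2 * n))) z →L[ℝ]
      TangentSpace ((𝓡 (2 * m + 1)).prod (𝓡 (2 * n))) z →L[ℝ] ℝ)
    (hG : G = WarpedBiharmonic.warpedMetric (𝓡 (2 * m + 1)) (𝓡 (2 * n)) g₁.inner g₂.inner f)
    (ψ : M → M₁ × M₂)
    (hψ : WarpedBiharmonic.IsIsometricImmersion ((𝓡 (2 * m + 1)).prod (𝓡 (2 * n))) g.inner G ψ)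
    (hξ : WarpedBiharmonic.IsTangentTo (d := 2 * (m + n)) (d₂ := 2 * n) ξ ψ)
    (hH : WarpedBiharmonic.HasHorizontalMeanCurvature g.inner G ψ)
    (h : ℝ) (hh : h ≠ 0)
    (hCMC : WarpedBiharmonic.HasConstantMeanCurvature ((𝓡 (2 * m + 1)).prod (𝓡 (2 * n)))
      g.inner G ψ h) :
    WarpedBiharmonic.IsProperBiharmonic ((𝓡 (2 * m + 1)).prod (𝓡 (2 * n))) g.inner G ψ ↔
      ∀ p₀ : M, ∀ x ∈ WarpedBiharmonic.localDomain (𝓡 (2 * (m + n)))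
          ((𝓡 (2 * m + 1)).prod (𝓡 (2 * n))) ψ p₀,
        WarpedBiharmonic.normSqBAt ((𝓡 (2 * m + 1)).prod (𝓡 (2 * n))) g.inner G ψ p₀ x •
            WarpedBiharmonic.meanCurvatureAt ((𝓡 (2 * m + 1)).prod (𝓡 (2 * n)))
              g.inner G ψ p₀ x
          = ((c * (m + 1) + 3 * m - 1) / 2) •
              WarpedBiharmonic.meanCurvatureAt ((𝓡 (2 * m + 1)).prod (𝓡 (2 * n)))
                g.inner G ψ p₀ x
            - (2 * n / f (ψ ((extChartAt (𝓡 (2 * (m + n))) p₀).symm x)).1) •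
              WarpedBiharmonic.covDerivGradAlongH ((𝓡 (2 * m + 1)).prod (𝓡 (2 * n)))
                g.inner G ψ (fun z => f z.1) p₀ x := by
  simpa using mainTheorem2_general (by ring) hM₁ hf hf_pos hG hψ hξ hH hh hCMC
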